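/- Let $M$ be a smooth $m$-dimensional manifold (Hausdorff, second countable), $\mathbb K\in\{\mathbb R,\mathbb C\}$, $C^\infty(M)$ the ring of smooth $\mathbb K$-valued functions and $\Gamma(TM)$ its module of derivations. Let $A$ be a transitive Lie algebroid over $M$, i.e. a finitely generated projective $C^\infty(M)$-module with a Lie bracket and a surjective $C^\infty(M)$-linear Lie morphism $\rho:A\to\Gamma(TM)$ satisfying $[X,fY]=f[X,Y]+(\rho(X)\cdot f)Y$. Let $\iota:L=\ker\rho\hookrightarrow A$ be the inclusion and let $\Omega^p(A,L)$ be the $C^\infty(M)$-multilinear alternating maps $A^p\to L$. A local trivialization $(U,\Psi,\nabla^0)$ of $A$, with model a Lie algebra $\mathfrak g$ with basis $E_1,\dots,E_n$, consists of an open set $U\subset M$, a trivialization $\Psi:U\times\mathfrak g\to L_U$ of bundles of Lie algebras, and a $C^\infty(U)$-linear Lie morphism $\nabla^0:\Gamma(TU)\to A_U$ with $\rho\circ\nabla^0=\mathrm{id}$ and $[\nabla^0_X,\Psi(\gamma)]=\Psi(X\cdot\gamma)$. It gives the isomorphism $S(X\oplus\gamma)=\nabla^0_X+\iota\Psi(\gamma)$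 from $\Gamma(TU)\oplus\Gamma(U\times\mathfrak g)$ onto $A_U$, and the local form $\omega_{\mathrm{loc}}=\Psi^{-1}\circ\omega\circ S$ of $\omega\in\Omega^p(A,L)$. Assume that $A$ is orientable and oriented: fix an atlas of local trivializations with $\det(\Psi_i^{-1}\Psi_j)>0$ on all overlaps, and an atlas of charts of $M$ with positive Jacobians. Let $\hat g=(g,h,\nabla)$ be a metric on $A$: $g$ and $h$ are (fiberwise) nondegenerate symmetric $C^\infty(M)$-bilinear forms on $\Gamma(TM)$ and on $L$, $\nabla$ is a connection (a $C^\infty(M)$-linear splitting of $\rho$) with connection form $\lambda:A\to L$, $\lambda(X)=\nabla_{\rho(X)}-X$, and $\hat g(X,Y)=g(\rho X,\rho Y)+h(\lambda X,\lambda Y)$. In a trivialization and a chart $(x^\mu)$ write $\lambda_{\mathrm{loc}}=\lambda^aE_a$ (the $dx^\mu,\lambda^a$ form the mixed basis), $g=g_{\mu\nu}dx^\mu dx^\nu$, $h_{ab}=h(\Psi E_a,\Psi E_b)$, $|g|=|\det(g_{\mu\nu})|$, $|h|=|\det(h_{ab})|$, and let $\epsilon$ denote Levi-Civita symbols. Then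 for $0\le p\le m+n$ and $\omega\in\Omega^p(A,L)$ there is a unique form $\star\omega\in\Omega^{m+n-p}(A,L)$ such that, in every trivialization of the atlas and every chart of the oriented atlas, on their common domain, whenever $$\omega_{\mathrm{loc}}=\sum_{r+s=p}\omega^{(r,s)}_{\mu_1\dots\mu_ra_1\dots a_s}\,dx^{\mu_1}\wedge\dots\wedge dx^{\mu_r}\wedge\lambda^{a_1}\wedge\dots\wedge\lambda^{a_s}$$ with $\mathfrak g$-valued components, one has $$(\star\omega)_{\mathrm{loc}}=\sum_{r+s=p}(-1)^{s(m-r)}\frac{\sqrt{|h|}\sqrt{|g|}}{r!\,s!}\,\omega^{(r,s)}_{\mu_1\dots\mu_ra_1\dots a_s}\,\epsilon_{\nu_1\dots\nu_m}\epsilon_{b_1\dots b_n}\,g^{\mu_1\nu_1}\cdots g^{\mu_r\nu_r}h^{a_1b_1}\cdots h^{a_sb_s}\,dx^{\nu_{r+1}}\wedge\dots\wedge dx^{\nu_m}\wedge\lambda^{b_{s+1}}\wedge\dots\wedge\lambda^{b_n}.$$ The map $\star:\Omega^p(A,L)\to\Omega^{m+n-p}(A,L)$ is $C^\infty(M)$-linear.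 If $\det(g_{\mu\nu})\det(h_{ab})>0$ in these trivializations and charts (for instance if the matrices $(g_{\mu\nu})$ and $(h_{ab})$ are real and positive definite), then $$\star\star\omega=(-1)^{(m+n-p)p}\,\omega .$$ For arbitrary nondegenerate $g,h$, at each point, $$\star\star\omega=(-1)^{(m+n-p)p}\,\frac{|\det(g_{\mu\nu})\det(h_{ab})|}{\det(g_{\mu\nu})\det(h_{ab})}\,\omega .$$ -/

import Mathlib

open scoped Manifold ContDiff Topology

/-! ## Smooth functions, vector fields and modules of sections

`M` is a real `m`-dimensional manifold modelled on `EuclideanSpace ℝ (Fin m)` and the scalars `𝕜`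
are `ℝ` or `ℂ`. A vector bundle is represented by its module of sections. -/

/-- `𝕜` is a smooth algebra over `ℝ`, so that smooth `𝕜`-valued functions form a ring. -/
instance RCLike.instContMDiffRingReal (𝕜 : Type*) [RCLike 𝕜] : ContMDiffRing 𝓘(ℝ, 𝕜) ∞ 𝕜 :=
  { instNormedSpaceLieAddGroup with
    contMDiff_mul := by
      rw [contMDiff_iff]
      refine ⟨continuous_mul, fun x y => ?_⟩
      simp only [mfld_simps, chartAt_self_eq]
      rw [contDiffOn_univ]
      exact contDiff_mul }

/-- The ring `C^∞(M)` of smooth `𝕜`-valued functions on the real manifold `M`. -/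
abbrev SmoothFun (m : ℕ) (M 𝕜 : Type*) [RCLike 𝕜] [TopologicalSpace M]
    [ChartedSpace (EuclideanSpace ℝ (Fin m)) M] : Type _ :=
  C^∞⟮𝓡 m, M; 𝓘(ℝ, 𝕜), 𝕜⟯

/-- The module `Γ(TM)` of smooth vector fields, as the derivations of `C^∞(M)`. For `𝕜 = ℂ` these
are the complex vector fields: an `ℝ`-linear derivation satisfies `0 = D (i * i) = 2 * i * D i`,
hence `D i = 0`, so it is automatically `ℂ`-linear. -/
abbrev VecField (m : ℕ) (M 𝕜 : Type*) [RCLike 𝕜] [TopologicalSpace M]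
    [ChartedSpace (EuclideanSpace ℝ (Fin m)) M] : Type _ :=
  Derivation ℝ (SmoothFun m M 𝕜) (SmoothFun m M 𝕜)

namespace LieAlgd

noncomputable section

section Fibers

variable {m : ℕ} {M 𝕜 : Type*} [RCLike 𝕜] [TopologicalSpace M]
  [ChartedSpace (EuclideanSpace ℝ (Fin m)) M]

/-- Evaluation of smooth functions at a point. -/
def evalAt (m : ℕ) {M : Type*} (𝕜 : Type*) [RCLike 𝕜] [TopologicalSpace M]
    [ChartedSpace (EuclideanSpace ℝ (Fin m)) M] (x : M) : SmoothFun m M 𝕜 →+* 𝕜 :=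
  ContMDiffMap.evalRingHom x

/-- Constant functions. -/
def constFun (m : ℕ) (M 𝕜 : Type*) [RCLike 𝕜] [TopologicalSpace M]
    [ChartedSpace (EuclideanSpace ℝ (Fin m)) M] : 𝕜 →+* SmoothFun m M 𝕜 where
  toFun c := ContMDiffMap.const c
  map_one' := rfl
  map_mul' _ _ := rfl
  map_zero' := rfl
  map_add' _ _ := rfl

/-- `𝔪_x N`, where `𝔪_x` is the ideal of the functions that vanish at `x`. For the sections `N` of
a vector bundle this is the submodule of the sections that vanish at `x`. -/
def vanishing (x : M) (N : Type*) [AddCommGroup N] [Module (SmoothFun m M 𝕜) N] :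
    Submodule (SmoothFun m M 𝕜) N :=
  RingHom.ker (evalAt m 𝕜 x) • (⊤ : Submodule (SmoothFun m M 𝕜) N)

/-- The fiber at `x` of the vector bundle with module of sections `N`, that is `N / 𝔪_x N`. -/
def Fiber (m : ℕ) (𝕜 : Type*) {M : Type*} [RCLike 𝕜] [TopologicalSpace M]
    [ChartedSpace (EuclideanSpace ℝ (Fin m)) M] (x : M) (N : Type*) [AddCommGroup N]
    [Module (SmoothFun m M 𝕜) N] : Type _ :=
  N ⧸ (vanishing x N : Submodule (SmoothFun m M 𝕜) N)

variable {N N' : Type*} [AddCommGroup N] [Module (SmoothFun m M 𝕜) N]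
  [AddCommGroup N'] [Module (SmoothFun m M 𝕜) N']

instance (x : M) : AddCommGroup (Fiber m 𝕜 x N) :=
  inferInstanceAs (AddCommGroup (N ⧸ (vanishing x N : Submodule (SmoothFun m M 𝕜) N)))

/-- The `𝕜`-vector space structure of the fiber: scalars act as constant functions. -/
instance (x : M) : Module 𝕜 (Fiber m 𝕜 x N) :=
  letI : Module (SmoothFun m M 𝕜) (Fiber m 𝕜 x N) :=
    inferInstanceAs (Module (SmoothFun m M 𝕜)
      (N ⧸ (vanishing x N : Submodule (SmoothFun m M 𝕜) N)))
  Module.compHom _ (constFun m M 𝕜)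

/-- The value at `x` of a section. -/
def value (x : M) (a : N) : Fiber m 𝕜 x N :=
  (vanishing x N : Submodule (SmoothFun m M 𝕜) N).mkQ a

theorem value_add (x : M) (a b : N) :
    (value x (a + b) : Fiber m 𝕜 x N) = value x a + value x b := rfl

theorem value_const_smul (x : M) (c : 𝕜) (a : N) :
    (value x (constFun m M 𝕜 c • a) : Fiber m 𝕜 x N) = c • value x a := rfl

theorem value_surjective (x : M) : Function.Surjective (value x : N → Fiber m 𝕜 x N) :=
  Submodule.mkQ_surjective _

theorem value_eq_iff (x : M) (a b : N) :
    (value x a : Fiber m 𝕜 x N) = value x b ↔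
      a - b ∈ (vanishing x N : Submodule (SmoothFun m M 𝕜) N) :=
  Submodule.Quotient.eq _

theorem value_eq_zero_iff (x : M) (a : N) :
    (value x a : Fiber m 𝕜 x N) = 0 ↔ a ∈ (vanishing x N : Submodule (SmoothFun m M 𝕜) N) :=
  Submodule.Quotient.mk_eq_zero _

theorem value_smul (x : M) (f : SmoothFun m M 𝕜) (a : N) :
    (value x (f • a) : Fiber m 𝕜 x N) = f x • value x a := by
  rw [← value_const_smul, value_eq_iff, ← sub_smul]
  refine Submodule.smul_mem_smul ?_ Submodule.mem_top
  rw [RingHom.mem_ker, map_sub]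
  exact sub_self (f x)

/-- A module map between modules of sections maps `𝔪_x N` to `𝔪_x N'`. -/
theorem map_mem_vanishing (x : M) (F : N →ₗ[SmoothFun m M 𝕜] N') {a : N}
    (ha : a ∈ (vanishing x N : Submodule (SmoothFun m M 𝕜) N)) :
    F a ∈ (vanishing x N' : Submodule (SmoothFun m M 𝕜) N') := by
  refine Submodule.smul_induction_on ha (fun f hf b _ => ?_) (fun b c hb hc => ?_)
  · rw [map_smul]
    exact Submodule.smul_mem_smul hf Submodule.mem_top
  · rw [map_add]
    exact add_mem hb hc

/-- The linear map between fibers at `x` induced by a module map: `a(x) ↦ (F a)(x)`. -/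
def mapAt (x : M) (F : N →ₗ[SmoothFun m M 𝕜] N') : Fiber m 𝕜 x N →ₗ[𝕜] Fiber m 𝕜 x N' where
  toFun ξ := Quotient.liftOn' ξ (fun a => (value x (F a) : Fiber m 𝕜 x N')) (fun a b hab => by
    have h1 : a - b ∈ (vanishing x N : Submodule (SmoothFun m M 𝕜) N) :=
      (Submodule.quotientRel_def _).1 hab
    have h2 := map_mem_vanishing x F h1
    rw [map_sub] at h2
    exact (value_eq_iff x _ _).2 h2)
  map_add' := by
    intro ξ ζ
    obtain ⟨a, rfl⟩ := value_surjective x ξ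
    obtain ⟨b, rfl⟩ := value_surjective x ζ
    change value x (F (a + b)) = value x (F a) + value x (F b)
    rw [map_add, value_add]
  map_smul' := by
    intro c ξ
    obtain ⟨a, rfl⟩ := value_surjective x ξ
    change value x (F (constFun m M 𝕜 c • a)) = c • value x (F a)
    rw [map_smul, value_const_smul]

theorem mapAt_value (x : M) (F : N →ₗ[SmoothFun m M 𝕜] N') (a : N) :
    mapAt x F (value x a) = value x (F a) := rfl

theorem eval_eq_zero_of_mem_vanishing (x : M) {f : SmoothFun m M 𝕜}
    (hf : f ∈ (vanishing x (SmoothFun m M 𝕜) : Submodule (SmoothFun m M 𝕜) (SmoothFun m M 𝕜))) :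
    f x = 0 := by
  refine Submodule.smul_induction_on hf (fun f hf b _ => ?_) (fun b c hb hc => ?_)
  · have h0 : f x = 0 := hf
    change f x * b x = 0
    rw [h0, zero_mul]
  · change b x + c x = 0
    rw [hb, hc, add_zero]

/-- The linear functional `a(x) ↦ (F a)(x)` on the fiber induced by a module map into `C^∞(M)`. -/
def functionalAt (x : M) (F : N →ₗ[SmoothFun m M 𝕜] SmoothFun m M 𝕜) : Fiber m 𝕜 x N →ₗ[𝕜] 𝕜 where
  toFun ξ := Quotient.liftOn' ξ (fun a => (F a) x) (fun a b hab => by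
    have h1 : a - b ∈ (vanishing x N : Submodule (SmoothFun m M 𝕜) N) :=
      (Submodule.quotientRel_def _).1 hab
    have h2 := eval_eq_zero_of_mem_vanishing x (map_mem_vanishing x F h1)
    rw [map_sub] at h2
    exact sub_eq_zero.1 h2)
  map_add' := by
    intro ξ ζ
    obtain ⟨a, rfl⟩ := value_surjective x ξ
    obtain ⟨b, rfl⟩ := value_surjective x ζ
    change (F (a + b)) x = (F a) x + (F b) x
    rw [map_add]
    rfl
  map_smul' := by
    intro c ξ
    obtain ⟨a, rfl⟩ := value_surjective x ξ
    change (F (constFun m M 𝕜 c • a)) x = c • (F a) x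
    rw [map_smul]
    rfl

theorem functionalAt_value (x : M) (F : N →ₗ[SmoothFun m M 𝕜] SmoothFun m M 𝕜) (a : N) :
    functionalAt x F (value x a) = (F a) x := rfl

/-- The value at `x` of a bilinear form on a bundle: `(a(x), b(x)) ↦ B(a, b)(x)`. -/
def bilinAt (x : M) (B : N →ₗ[SmoothFun m M 𝕜] N →ₗ[SmoothFun m M 𝕜] SmoothFun m M 𝕜) :
    Fiber m 𝕜 x N →ₗ[𝕜] Fiber m 𝕜 x N →ₗ[𝕜] 𝕜 where
  toFun ξ := Quotient.liftOn' ξ (fun a => functionalAt x (B a)) (fun a b hab => by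
    have h1 : a - b ∈ (vanishing x N : Submodule (SmoothFun m M 𝕜) N) :=
      (Submodule.quotientRel_def _).1 hab
    ext ζ
    obtain ⟨c, rfl⟩ := value_surjective x ζ
    have h2 := eval_eq_zero_of_mem_vanishing x (map_mem_vanishing x (B.flip c) h1)
    rw [map_sub] at h2
    exact sub_eq_zero.1 h2)
  map_add' := by
    intro ξ ζ
    obtain ⟨a, rfl⟩ := value_surjective x ξ
    obtain ⟨b, rfl⟩ := value_surjective x ζ
    ext θ
    obtain ⟨c, rfl⟩ := value_surjective x θ
    change (B (a + b) c) x = (B a c) x + (B b c) x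
    rw [map_add]
    rfl
  map_smul' := by
    intro c ξ
    obtain ⟨a, rfl⟩ := value_surjective x ξ
    ext θ
    obtain ⟨b, rfl⟩ := value_surjective x θ
    change (B (constFun m M 𝕜 c • a) b) x = c • (B a b) x
    rw [map_smul]
    rfl

theorem bilinAt_value (x : M) (B : N →ₗ[SmoothFun m M 𝕜] N →ₗ[SmoothFun m M 𝕜] SmoothFun m M 𝕜)
    (a b : N) : bilinAt x B (value x a) (value x b) = (B a b) x := rfl

/-- The value at `x` of a form is well defined on the values at `x` of its arguments. -/
theorem form_value_congr (x : M) {p : ℕ} (w : N [⋀^Fin p]→ₗ[SmoothFun m M 𝕜] N') (a b : Fin p → N)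
    (h : ∀ i, (value x (a i) : Fiber m 𝕜 x N) = value x (b i)) :
    (value x (w a) : Fiber m 𝕜 x N') = value x (w b) := by
  classical
  have key : ∀ s : Finset (Fin p),
      (value x (w (s.piecewise a b)) : Fiber m 𝕜 x N') = value x (w b) := by
    intro s
    induction s using Finset.induction_on with
    | empty => simp
    | insert i s hi ih =>
      rw [← ih, value_eq_iff]
      have h1 : (insert i s).piecewise a b
          = Function.update (s.piecewise a b) i (a i) := Finset.piecewise_insert _ _ _ _
      have h2 : s.piecewise a b = Function.update (s.piecewise a b) i (b i) := by
        rw [Function.eq_update_iff]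
        simp [hi]
      rw [h1]
      nth_rewrite 2 [h2]
      rw [← w.map_update_sub]
      exact map_mem_vanishing x (w.toMultilinearMap.toLinearMap (s.piecewise a b) i)
        ((value_eq_iff x _ _).1 (h i))
  simpa using key Finset.univ

/-- The value at `x` of a form: the alternating map `(a₁(x), …, a_p(x)) ↦ w(a₁, …, a_p)(x)`. -/
def formAt (x : M) {p : ℕ} (w : N [⋀^Fin p]→ₗ[SmoothFun m M 𝕜] N') :
    Fiber m 𝕜 x N [⋀^Fin p]→ₗ[𝕜] Fiber m 𝕜 x N' where
  toFun v := value x (w (fun i => (value_surjective x (v i)).choose))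
  map_update_add' := by
    intro _ v i ξ ζ
    obtain rfl : ‹DecidableEq (Fin p)› = instDecidableEqFin p := Subsingleton.elim _ _
    choose a ha using fun j => value_surjective (m := m) (𝕜 := 𝕜) x (v j)
    obtain ⟨b, rfl⟩ := value_surjective x ξ
    obtain ⟨c, rfl⟩ := value_surjective x ζ
    have hc : ∀ d : N, (value x (w (fun j => (value_surjective (m := m) (𝕜 := 𝕜) x
        (Function.update v i (value x d) j)).choose)) : Fiber m 𝕜 x N')
          = value x (w (Function.update a i d)) := by
      intro d
      refine form_value_congr x w _ _ (fun j => ?_)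
      rw [(value_surjective x _).choose_spec]
      rcases eq_or_ne j i with rfl | hj
      · simp
      · simp [hj, ha]
    rw [← value_add, hc, hc, hc, w.map_update_add, value_add]
  map_update_smul' := by
    intro _ v i c ξ
    obtain rfl : ‹DecidableEq (Fin p)› = instDecidableEqFin p := Subsingleton.elim _ _
    choose a ha using fun j => value_surjective (m := m) (𝕜 := 𝕜) x (v j)
    obtain ⟨b, rfl⟩ := value_surjective x ξ
    have hc : ∀ d : N, (value x (w (fun j => (value_surjective (m := m) (𝕜 := 𝕜) x
        (Function.update v i (value x d) j)).choose)) : Fiber m 𝕜 x N')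
          = value x (w (Function.update a i d)) := by
      intro d
      refine form_value_congr x w _ _ (fun j => ?_)
      rw [(value_surjective x _).choose_spec]
      rcases eq_or_ne j i with rfl | hj
      · simp
      · simp [hj, ha]
    rw [← value_const_smul, hc, hc, w.map_update_smul, value_const_smul]
  map_eq_zero_of_eq' := by
    intro v i j hij hne
    rw [w.map_eq_zero_of_eq _ (i := i) (j := j) (by simp only [hij]) hne]
    rfl

theorem formAt_value (x : M) {p : ℕ} (w : N [⋀^Fin p]→ₗ[SmoothFun m M 𝕜] N') (a : Fin p → N) :
    formAt x w (fun i => value x (a i)) = value x (w a) :=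
  form_value_congr x w _ _ (fun i => (value_surjective x (value x (a i))).choose_spec)

/-- A family `s y` of elements of the fibers over an open set `U` is a smooth local section if
near each point of `U` it agrees with a global section. -/
def IsLocalSection {U : TopologicalSpace.Opens M} (s : ∀ y : U, Fiber m 𝕜 (y : M) N) : Prop :=
  ∀ x : U, ∃ a : N, ∀ᶠ y in 𝓝 x, s y = value (y : M) a

end Fibers

end

/-! ## Transitive Lie algebroids -/

/-- A Lie algebroid structure on a finite projective module `A` over `C^∞(M)` with Lie bracket.
(The bracket is only required to be biadditive: bilinearity over `𝕜` follows from the Leibniz rule,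
as vector fields annihilate the constants.) -/
structure LieAlgebroid (m : ℕ) (M 𝕜 A : Type*) [RCLike 𝕜] [TopologicalSpace M]
    [ChartedSpace (EuclideanSpace ℝ (Fin m)) M] [LieRing A] [Module (SmoothFun m M 𝕜) A] where
  finite : Module.Finite (SmoothFun m M 𝕜) A
  projective : Module.Projective (SmoothFun m M 𝕜) A
  /-- The anchor `ρ : A → Γ(TM)`. -/
  anchor : A →ₗ[SmoothFun m M 𝕜] VecField m M 𝕜
  anchor_lie : ∀ X Y : A, anchor ⁅X, Y⁆ = ⁅anchor X, anchor Y⁆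
  leibniz : ∀ (X Y : A) (f : SmoothFun m M 𝕜), ⁅X, f • Y⁆ = f • ⁅X, Y⁆ + (anchor X f) • Y

noncomputable section

variable {m : ℕ} {M 𝕜 A : Type*} [RCLike 𝕜] [TopologicalSpace M]
  [ChartedSpace (EuclideanSpace ℝ (Fin m)) M] [LieRing A] [Module (SmoothFun m M 𝕜) A]

/-- Surjectivity of the anchor. -/
def LieAlgebroid.IsTransitive (P : LieAlgebroid m M 𝕜 A) : Prop :=
  Function.Surjective P.anchor

/-- The kernel `L` of the anchor. -/
abbrev LieAlgebroid.kernel (P : LieAlgebroid m M 𝕜 A) : Submodule (SmoothFun m M 𝕜) A :=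
  LinearMap.ker P.anchor

/-- The adjoint action of `A` on `L`: the bracket `[a, l] ∈ L` for `a ∈ A` and `l ∈ L`. -/
def LieAlgebroid.adjoint (P : LieAlgebroid m M 𝕜 A) (a : A) (l : P.kernel) : P.kernel :=
  ⟨⁅a, (l : A)⁆, by
    have hl : P.anchor (l : A) = 0 := l.2
    rw [LinearMap.mem_ker, P.anchor_lie, hl]
    ext f
    simp [Derivation.commutator_apply]⟩

/-- `Ω^p(A, L)`: the `p`-forms on `A` with values in the kernel `L`. -/
abbrev LieAlgebroid.Form (P : LieAlgebroid m M 𝕜 A) (p : ℕ) : Type _ :=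
  A [⋀^Fin p]→ₗ[SmoothFun m M 𝕜] P.kernel

/-- A connection: a `C^∞(M)`-linear splitting of the anchor. -/
structure LieAlgebroid.Connection (P : LieAlgebroid m M 𝕜 A) where
  toLinearMap : VecField m M 𝕜 →ₗ[SmoothFun m M 𝕜] A
  anchor_apply : ∀ X, P.anchor (toLinearMap X) = X

/-- The connection form `λ^∇ : A → L`, determined by `X = ∇_{ρ X} - λ^∇(X)`. -/
def LieAlgebroid.Connection.form {P : LieAlgebroid m M 𝕜 A} (D : P.Connection) :
    A →ₗ[SmoothFun m M 𝕜] P.kernel :=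
  (D.toLinearMap ∘ₗ P.anchor - LinearMap.id).codRestrict P.kernel (fun X => by
    rw [LinearMap.mem_ker]
    simp [D.anchor_apply])

/-- A metric `ĝ` on `A` together with its decomposition `ĝ = (g, h, ∇)`, where `g` is a
nondegenerate metric on `M`, `h` is a nondegenerate metric on `L` and `∇` is a connection.
Nondegeneracy is required in each fiber. -/
structure LieAlgebroid.Metric (P : LieAlgebroid m M 𝕜 A) where
  /-- The metric `ĝ` on `A`. -/
  hat : A →ₗ[SmoothFun m M 𝕜] A →ₗ[SmoothFun m M 𝕜] SmoothFun m M 𝕜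
  /-- The metric `g` on the base. -/
  base : VecField m M 𝕜 →ₗ[SmoothFun m M 𝕜] VecField m M 𝕜 →ₗ[SmoothFun m M 𝕜] SmoothFun m M 𝕜
  /-- The inner metric `h`. -/
  inner : P.kernel →ₗ[SmoothFun m M 𝕜] P.kernel →ₗ[SmoothFun m M 𝕜] SmoothFun m M 𝕜
  /-- The connection `∇`. -/
  conn : P.Connection
  base_symm : ∀ X Y, base X Y = base Y X
  base_nondegenerate : ∀ x : M, (bilinAt x base).Nondegenerate
  inner_symm : ∀ k l, inner k l = inner l k
  inner_nondegenerate : ∀ x : M, (bilinAt x inner).Nondegenerate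
  hat_apply : ∀ X Y, hat X Y =
    base (P.anchor X) (P.anchor Y) + inner (conn.form X) (conn.form Y)

/-! ## Local trivializations -/

/-- A local trivialization `(U, Ψ, ∇⁰)` of a Lie algebroid with kernel `L`, the model of the fibers
of `L` being the Lie algebra `𝔤`. The maps `Ψ` and `∇⁰` are given as morphisms of vector bundles over
`U`, that is fiberwise. Brackets of local sections are computed with global sections that have the
same germ. -/
structure LieAlgebroid.LocalTriv (P : LieAlgebroid m M 𝕜 A) (𝔤 : Type*) [LieRing 𝔤]
    [LieAlgebra 𝕜 𝔤] where
  U : TopologicalSpace.Opens M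
  /-- The trivialization `Ψ : U × 𝔤 ≃ L_U`. -/
  Ψ : ∀ x : U, 𝔤 ≃ₗ[𝕜] Fiber m 𝕜 (x : M) P.kernel
  smooth_Ψ : ∀ v : 𝔤, IsLocalSection (U := U) (fun x => Ψ x v)
  /-- `[Ψ(v), Ψ(w)] = Ψ([v, w])`. -/
  lie_Ψ : ∀ (x : U) (v w : 𝔤) (k l : P.kernel),
    value (x : M) k = Ψ x v → value (x : M) l = Ψ x w →
      value (x : M) (P.adjoint (k : A) l) = Ψ x ⁅v, w⁆
  /-- The local flat connection `∇⁰ : TU → A_U`. -/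
  nabla : ∀ x : U, Fiber m 𝕜 (x : M) (VecField m M 𝕜) →ₗ[𝕜] Fiber m 𝕜 (x : M) A
  smooth_nabla : ∀ X : VecField m M 𝕜,
    IsLocalSection (U := U) (fun x => nabla x (value (x : M) X))
  /-- `ρ ∘ ∇⁰_X = X`. -/
  anchor_nabla : ∀ (x : U) (ξ : Fiber m 𝕜 (x : M) (VecField m M 𝕜)),
    mapAt (x : M) P.anchor (nabla x ξ) = ξ
  /-- `[∇⁰_X, ∇⁰_Y] = ∇⁰_[X, Y]`. -/
  lie_nabla : ∀ (X Y : VecField m M 𝕜) (x : U) (a b : A),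
    (∀ᶠ y : U in 𝓝 x, value (y : M) a = nabla y (value (y : M) X)) →
    (∀ᶠ y : U in 𝓝 x, value (y : M) b = nabla y (value (y : M) Y)) →
      value (x : M) ⁅a, b⁆ = nabla x (value (x : M) ⁅X, Y⁆)
  /-- `[∇⁰_X, Ψ(γ)] = Ψ(X · γ)`, for the generators `γ = f ⊗ v` of `Γ(U × 𝔤)`. -/
  lie_nabla_Ψ : ∀ (X : VecField m M 𝕜) (f : SmoothFun m M 𝕜) (v : 𝔤) (x : U) (a : A)
      (l : P.kernel),
    (∀ᶠ y : U in 𝓝 x, value (y : M) a = nabla y (value (y : M) X)) →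
    (∀ᶠ y : U in 𝓝 x, value (y : M) l = Ψ y (f y • v)) →
      value (x : M) (P.adjoint a l) = Ψ x ((X f) x • v)

variable {P : LieAlgebroid m M 𝕜 A} {𝔤 : Type*} [LieRing 𝔤] [LieAlgebra 𝕜 𝔤]

/-- The isomorphism `S(X ⊕ γ) = ∇⁰_X + ι(Ψ(γ))` from the trivial Lie algebroid `TU ⊕ (U × 𝔤)` to
`A_U`, in the fiber over `x`. -/
def LieAlgebroid.LocalTriv.S (T : P.LocalTriv 𝔤) (x : T.U) :
    (Fiber m 𝕜 (x : M) (VecField m M 𝕜) × 𝔤) →ₗ[𝕜] Fiber m 𝕜 (x : M) A :=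
  (T.nabla x).coprod (mapAt (x : M) P.kernel.subtype ∘ₗ (T.Ψ x).toLinearMap)

/-- The local form `w_loc = Ψ⁻¹ ∘ w ∘ S` on the trivial Lie algebroid, with values in `𝔤`,
in the fiber over `x`. -/
def LieAlgebroid.LocalTriv.localForm (T : P.LocalTriv 𝔤) (x : T.U) {p : ℕ} (w : P.Form p) :
    (Fiber m 𝕜 (x : M) (VecField m M 𝕜) × 𝔤) [⋀^Fin p]→ₗ[𝕜] 𝔤 :=
  (T.Ψ x).symm.toLinearMap.compAlternatingMap ((formAt (x : M) w).compLinearMap (T.S x))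

/-- The transition `α^i_j = Ψ_i⁻¹ ∘ Ψ_j ∈ Aut(𝔤)` over a point of `U_i ∩ U_j`. -/
def LieAlgebroid.LocalTriv.transition (Ti Tj : P.LocalTriv 𝔤) (x : M) (hi : x ∈ Ti.U)
    (hj : x ∈ Tj.U) : 𝔤 ≃ₗ[𝕜] 𝔤 :=
  (Tj.Ψ ⟨x, hj⟩).trans (Ti.Ψ ⟨x, hi⟩).symm

/-- A Lie algebroid atlas with `det(α^i_j) > 0` on all overlaps, that is an inner orientation.
(In the basis `E` the matrix of `α^i_j` is `G^i_j`; its determinant does not depend on `E`.) -/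
structure LieAlgebroid.OrientedAtlas (P : LieAlgebroid m M 𝕜 A) (𝔤 : Type*) [LieRing 𝔤]
    [LieAlgebra 𝕜 𝔤] (ι : Type*) where
  triv : ι → P.LocalTriv 𝔤
  cover : ∀ x : M, ∃ i, x ∈ (triv i).U
  det_pos : ∀ (i j : ι) (x : M) (hi : x ∈ (triv i).U) (hj : x ∈ (triv j).U),
    ∃ r : ℝ, 0 < r ∧
      LinearMap.det ((triv i).transition (triv j) x hi hj).toLinearMap = (r : 𝕜)

/-- An oriented atlas of the base manifold: smooth charts which cover `M`, with transition functions
of positive Jacobian determinant. -/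
structure OrientedCharts (m : ℕ) (M : Type*) [TopologicalSpace M]
    [ChartedSpace (EuclideanSpace ℝ (Fin m)) M] where
  charts : Set (OpenPartialHomeomorph M (EuclideanSpace ℝ (Fin m)))
  smooth : charts ⊆ IsManifold.maximalAtlas (𝓡 m) ∞ M
  cover : ∀ x : M, ∃ φ ∈ charts, x ∈ φ.source
  jacobian_pos : ∀ φ ∈ charts, ∀ ψ ∈ charts, ∀ x ∈ φ.source ∩ ψ.source,
    0 < (fderiv ℝ (ψ ∘ φ.symm) (φ x)).det

/-! ## The mixed basis -/

open Classical in
/-- A global smooth function with the same germ at `x` as `u` (if `u` is smooth near `x`). -/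
def extendGerm (m : ℕ) {M 𝕜 : Type*} [RCLike 𝕜] [TopologicalSpace M]
    [ChartedSpace (EuclideanSpace ℝ (Fin m)) M] (u : M → 𝕜) (x : M) : SmoothFun m M 𝕜 :=
  if h : ∃ f : SmoothFun m M 𝕜, ∀ᶠ y in 𝓝 x, f y = u y then h.choose else 0

/-- The differential `dx^μ` at the point `x` of the `μ`-th coordinate of the chart `φ`, as a linear
form on the fiber of the tangent bundle: `X(x) ↦ (X · x^μ)(x)`. -/
def dcoord (𝕜 : Type*) [RCLike 𝕜] (φ : OpenPartialHomeomorph M (EuclideanSpace ℝ (Fin m)))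
    (x : M) (μ : Fin m) : Fiber m 𝕜 x (VecField m M 𝕜) →ₗ[𝕜] 𝕜 :=
  functionalAt x
    { toFun := fun X => X (extendGerm m (fun y => ((φ y μ : ℝ) : 𝕜)) x)
      map_add' := fun _ _ => rfl
      map_smul' := fun _ _ => rfl }

/-- `dx^μ` as a linear form on the fiber of the trivial Lie algebroid `TU ⊕ (U × 𝔤)`. -/
def dx (𝕜 𝔤 : Type*) [RCLike 𝕜] [LieRing 𝔤] [LieAlgebra 𝕜 𝔤]
    (φ : OpenPartialHomeomorph M (EuclideanSpace ℝ (Fin m))) (x : M)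
    (μ : Fin m) : (Fiber m 𝕜 x (VecField m M 𝕜) × 𝔤) →ₗ[𝕜] 𝕜 :=
  dcoord 𝕜 φ x μ ∘ₗ LinearMap.fst 𝕜 _ 𝔤

/-- The mixed basis `λ^a = A^a - θ^a`: the components in the basis `E` of the local expression
`λ_loc = Ψ⁻¹ ∘ λ^∇ ∘ S` of the connection form. -/
def mixed (D : P.Connection) (T : P.LocalTriv 𝔤) {n : ℕ} (E : Module.Basis (Fin n) 𝕜 𝔤) (x : T.U)
    (a : Fin n) : (Fiber m 𝕜 (x : M) (VecField m M 𝕜) × 𝔤) →ₗ[𝕜] 𝕜 :=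
  E.coord a ∘ₗ (T.Ψ x).symm.toLinearMap ∘ₗ mapAt (x : M) D.form ∘ₗ T.S x

/-- The exterior product `α_1 ∧ ⋯ ∧ α_k ∧ β_1 ∧ ⋯ ∧ β_l` of linear forms, normalized so that
`(α_1 ∧ ⋯ ∧ α_k)(v_1, …, v_k) = det (α_i(v_j))`. -/
def wedge {𝕜 V : Type*} [Field 𝕜] [AddCommGroup V] [Module 𝕜 V] {k l q : ℕ} (h : k + l = q)
    (α : Fin k → V →ₗ[𝕜] 𝕜) (β : Fin l → V →ₗ[𝕜] 𝕜) : V [⋀^Fin q]→ₗ[𝕜] 𝕜 :=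
  Matrix.detRowAlternating.compLinearMap
    (LinearMap.pi (fun i : Fin q => Fin.append α β (Fin.cast h.symm i)))

/-- The product `η ⊗ c` of a scalar valued form and a vector. -/
def formSmul {𝕜 V W : Type*} [Field 𝕜] [AddCommGroup V] [Module 𝕜 V] [AddCommGroup W] [Module 𝕜 W]
    {q : ℕ} (η : V [⋀^Fin q]→ₗ[𝕜] 𝕜) (c : W) : V [⋀^Fin q]→ₗ[𝕜] W :=
  (LinearMap.toSpanSingleton 𝕜 W c).compAlternatingMap η

/-- The Levi-Civita symbol `ε_{ν_1 … ν_k}`. -/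
def leviCivita {k : ℕ} (ν : Fin k → Fin k) : ℤ :=
  open Classical in
  if h : Function.Bijective ν then (Equiv.Perm.sign (Equiv.ofBijective ν h) : ℤ) else 0

/-- Components `w^{(r,s)}_{μ_1 … μ_r a_1 … a_s}` with values in `𝔤`, at one point. They are not
required to be antisymmetric. -/
abbrev Components (m n : ℕ) (𝔤 : Type*) : Type _ :=
  ∀ r s : ℕ, (Fin r → Fin m) → (Fin s → Fin n) → 𝔤

section LocalFormulas

variable {V : Type*} [AddCommGroup V] [Module 𝕜 V] {n : ℕ}

/-- `∑_{r+s=p} w^{(r,s)}_{μ_1…μ_r a_1…a_s} dx^{μ_1} ∧ ⋯ ∧ dx^{μ_r} ∧ λ^{a_1} ∧ ⋯ ∧ λ^{a_s}`, for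
linear forms `X^μ = dx^μ` and `Λ^a = λ^a`. The indices are summed over all their values. -/
def expansion (X : Fin m → V →ₗ[𝕜] 𝕜) (Λ : Fin n → V →ₗ[𝕜] 𝕜) (p : ℕ) (c : Components m n 𝔤) :
    V [⋀^Fin p]→ₗ[𝕜] 𝔤 :=
  ∑ r : Fin (m + 1), ∑ s : Fin (n + 1),
    if h : (r : ℕ) + (s : ℕ) = p then
      ∑ μ : Fin r → Fin m, ∑ a : Fin s → Fin n,
        formSmul (wedge h (fun i => X (μ i)) (fun j => Λ (a j))) (c r s μ a)
    else 0

/-- The local formula for the Hodge operator, for the metric components `g_{μν}`, `h_{ab}`: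
`∑_{r+s=p} (-1)^{s(m-r)} (r! s!)⁻¹ √|h| √|g| w^{(r,s)}_{μ_1…μ_r a_1…a_s} ε_{ν_1…ν_m} ε_{b_1…b_n}
g^{μ_1 ν_1} ⋯ g^{μ_r ν_r} h^{a_1 b_1} ⋯ h^{a_s b_s}
dx^{ν_{r+1}} ∧ ⋯ ∧ dx^{ν_m} ∧ λ^{b_{s+1}} ∧ ⋯ ∧ λ^{b_n}`. -/
def hodgeFormula (X : Fin m → V →ₗ[𝕜] 𝕜) (Λ : Fin n → V →ₗ[𝕜] 𝕜)
    (g : Matrix (Fin m) (Fin m) 𝕜) (h : Matrix (Fin n) (Fin n) 𝕜)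
    (p q : ℕ) (hpq : p + q = m + n) (c : Components m n 𝔤) : V [⋀^Fin q]→ₗ[𝕜] 𝔤 :=
  ∑ r : Fin (m + 1), ∑ s : Fin (n + 1),
    if hrs : (r : ℕ) + (s : ℕ) = p then
      ∑ μ : Fin r → Fin m, ∑ a : Fin s → Fin n, ∑ ν : Fin m → Fin m, ∑ b : Fin n → Fin n,
        ((-1 : 𝕜) ^ ((s : ℕ) * (m - r)) * (1 / ((r : ℕ).factorial * (s : ℕ).factorial : 𝕜))
          * ((Real.sqrt ‖h.det‖ : ℝ) : 𝕜) * ((Real.sqrt ‖g.det‖ : ℝ) : 𝕜)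
          * (leviCivita ν : 𝕜) * (leviCivita b : 𝕜)
          * (∏ i : Fin r, g⁻¹ (μ i) (ν (Fin.castLE r.is_le i)))
          * (∏ j : Fin s, h⁻¹ (a j) (b (Fin.castLE s.is_le j)))) •
        formSmul (wedge (k := m - r) (l := n - s) (by omega)
          (fun i => X (ν ⟨r + i, by omega⟩)) (fun j => Λ (b ⟨s + j, by omega⟩))) (c r s μ a)
    else 0

end LocalFormulas

/-- `(g_{μν})` is the matrix of the components of the base metric in the chart `φ` at `x`:
`g = g_{μν} dx^μ dx^ν`. -/
def IsBaseMatrix (G : P.Metric) (φ : OpenPartialHomeomorph M (EuclideanSpace ℝ (Fin m))) (x : M)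
    (g : Matrix (Fin m) (Fin m) 𝕜) : Prop :=
  ∀ ξ ζ : Fiber m 𝕜 x (VecField m M 𝕜),
    bilinAt x G.base ξ ζ = ∑ μ, ∑ ν, g μ ν * dcoord 𝕜 φ x μ ξ * dcoord 𝕜 φ x ν ζ

/-- The matrix `h_{ab} = h(Ψ(E_a), Ψ(E_b))` of the inner metric in a trivialization at `x`. -/
def innerMatrix (G : P.Metric) (T : P.LocalTriv 𝔤) {n : ℕ} (E : Module.Basis (Fin n) 𝕜 𝔤)
    (x : T.U) : Matrix (Fin n) (Fin n) 𝕜 :=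
  Matrix.of fun a b => bilinAt (x : M) G.inner (T.Ψ x (E a)) (T.Ψ x (E b))

/-- `η` is the Hodge dual of `w`: in each trivialization of the oriented Lie algebroid atlas, each
oriented chart and each point of their common domain, whenever `w_loc` is written in the mixed basis
with components `w^{(r,s)}_{μ_1 … μ_r a_1 … a_s}`, the local form `η_loc` is given by the local
formula for the Hodge operator. -/
def IsHodgeDual {n : ℕ} {ι : Type*} (G : P.Metric) (E : Module.Basis (Fin n) 𝕜 𝔤)
    (𝒯 : P.OrientedAtlas 𝔤 ι) (𝒪 : OrientedCharts m M) {p q : ℕ} (hpq : p + q = m + n)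
    (w : P.Form p) (η : P.Form q) : Prop :=
  ∀ (i : ι), ∀ φ ∈ 𝒪.charts, ∀ (x : (𝒯.triv i).U), (x : M) ∈ φ.source →
    ∀ g : Matrix (Fin m) (Fin m) 𝕜, IsBaseMatrix G φ x g →
    ∀ c : Components m n 𝔤,
      (𝒯.triv i).localForm x w
        = expansion (dx 𝕜 𝔤 φ (x : M)) (mixed G.conn (𝒯.triv i) E x) p c →
      (𝒯.triv i).localForm x η
        = hodgeFormula (dx 𝕜 𝔤 φ (x : M)) (mixed G.conn (𝒯.triv i) E x) g
            (innerMatrix G (𝒯.triv i) E x) p q hpq c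

end

end LieAlgd

/-! The problem is reduced to one fiber at a time. The dual of $A_x$ has the basis
$dx^\mu\circ\rho$, $\lambda^a$; the dual basis of $A_x$ consists of the vectors
$\nabla_{\partial_\mu}$ and $-\iota\Psi(E_a)$, the sign coming from
$\lambda\circ\iota=-\mathrm{id}$. In this mixed basis $\hat g$ has the block diagonal Gram matrix
$\mathrm{diag}(g,h)$ (`gramMatrix_hat`), so $\sqrt{|h|}\sqrt{|g|}$ times the exterior product of the
mixed coordinates is its volume form.

A volume form and the map $\sharp$ define a basis-free operator `dualize`,
$\alpha^1\wedge\dots\wedge\alpha^p\otimes c\mapsto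
\mathrm{vol}(\sharp\alpha^1,\dots,\sharp\alpha^p,\cdot)\otimes c$. Writing the contraction with
Levi-Civita symbols shows that the local formula is this operator preceded by multiplication of the
bidegree $(r,s)$ by $(m-r)!(n-s)!/(r!s!)$ (`hodgeFormula_eq`). Hence it depends on
$\omega_{\mathrm{loc}}$ and not on the chosen components. Two mixed bases differ by a block diagonal
matrix whose determinant is a Jacobian times $\det(\Psi_i^{-1}\Psi_j)$; it is positive, so the
volume form and the operator are unchanged (`metricDual_congr`).

The rescaling of bidegrees needs no projections. If $\theta_t$ multiplies horizontal vectors by $t$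
and fixes vertical ones, then $\theta_t^*$ acts on bidegree $(r,s)$ by $t^r$, and Vandermonde
weights $\kappa_j$ make $\sum_j\kappa_j\theta_{j+1}^*$ act by any prescribed function of $r\le m$.
As $\theta_t$ is a module endomorphism of $A$, this operator is globally defined on forms.

For the double dual, the weights of $(r,s)$ and $(m-r,n-s)$ are inverse to each other, and `dualize`
squares to the sign of a block exchange times $|\det g\det h|/(\det g\det h)$ (`dualize_dualize`).

It remains to pass from fibers to sections. Hadamard's lemma shows that a derivation is determined
by its values on coordinates, so the $dx^\mu$ are a basis of the dual of the tangent fiber. Sections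
of a finite projective module are recovered from their values by the dual basis lemma. The dual of a
form is smooth because, in a local frame, it is polynomial in smooth functions together with
$1/\det$ and $\sqrt{|\det|}$ of the Gram matrix. -/

noncomputable section

set_option linter.unusedSectionVars false

/-! ## Alternating forms and determinants -/

namespace AlternatingForm

open Matrix Equiv

variable {𝕜 V V₁ W U κ κ' J ι' : Type*} [Field 𝕜] [AddCommGroup V] [Module 𝕜 V]
  [AddCommGroup V₁] [Module 𝕜 V₁] [AddCommGroup W] [Module 𝕜 W] [AddCommGroup U] [Module 𝕜 U]

section Contraction

/-- The product of a scalar valued form and a vector. -/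
def tensor (η : V [⋀^κ]→ₗ[𝕜] 𝕜) (c : W) : V [⋀^κ]→ₗ[𝕜] W :=
  (LinearMap.toSpanSingleton 𝕜 W c).compAlternatingMap η

@[simp] theorem tensor_apply (η : V [⋀^κ]→ₗ[𝕜] 𝕜) (c : W) (v : κ → V) :
    tensor η c v = η v • c := rfl

/-- Insertion of the vectors `u` into the first arguments of an alternating map. -/
def contractLeft (e : κ ⊕ κ' ≃ J) (Φ : V [⋀^J]→ₗ[𝕜] W) (u : κ → V) : V [⋀^κ']→ₗ[𝕜] W where
  toFun v := Φ (Sum.elim u v ∘ e.symm)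
  map_update_add' := by
    classical
    intro _ v i x y
    have hd : ‹DecidableEq κ'› = fun a b => Classical.propDecidable (a = b) := Subsingleton.elim _ _
    subst hd
    have := (Φ.domDomCongr e.symm).map_update_add (Sum.elim u v) (Sum.inr i) x y
    simp only [← Sum.update_elim_inr]
    exact this
  map_update_smul' := by
    classical
    intro _ v i c x
    have hd : ‹DecidableEq κ'› = fun a b => Classical.propDecidable (a = b) := Subsingleton.elim _ _
    subst hd
    have := (Φ.domDomCongr e.symm).map_update_smul (Sum.elim u v) (Sum.inr i) c x
    simp only [← Sum.update_elim_inr]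
    exact this
  map_eq_zero_of_eq' := by
    intro v i j hij hne
    exact (Φ.domDomCongr e.symm).map_eq_zero_of_eq (Sum.elim u v) (i := Sum.inr i) (j := Sum.inr j)
      hij (by simpa using hne)

theorem contractLeft_apply (e : κ ⊕ κ' ≃ J) (Φ : V [⋀^J]→ₗ[𝕜] W) (u : κ → V) (v : κ' → V) :
    contractLeft e Φ u v = Φ (Sum.elim u v ∘ e.symm) := rfl

/-- Insertion of the vectors `v` into the last arguments of an alternating map. -/
def contractRight (e : κ ⊕ κ' ≃ J) (Φ : V [⋀^J]→ₗ[𝕜] W) (v : κ' → V) : V [⋀^κ]→ₗ[𝕜] W :=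
  contractLeft ((Equiv.sumComm κ' κ).trans e) Φ v

theorem contractRight_apply (e : κ ⊕ κ' ≃ J) (Φ : V [⋀^J]→ₗ[𝕜] W) (u : κ → V) (v : κ' → V) :
    contractRight e Φ v u = Φ (Sum.elim u v ∘ e.symm) := by
  change Φ _ = _
  congr 1
  funext j
  simp only [Function.comp, Equiv.symm_trans_apply]
  cases e.symm j <;> rfl

theorem sum_apply {ι : Type*} (s : Finset ι) (f : ι → V [⋀^κ]→ₗ[𝕜] W) (v : κ → V) :
    (∑ i ∈ s, f i) v = ∑ i ∈ s, f i v := by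
  classical
  induction s using Finset.induction_on with
  | empty => rfl
  | insert i s hi ih => rw [Finset.sum_insert hi, Finset.sum_insert hi, AlternatingMap.add_apply, ih]

end Contraction

variable [Fintype κ] [DecidableEq κ] [Fintype J] [Fintype ι']

/-- The exterior product of a family of linear forms. -/
def wedgeForm (α : κ → V →ₗ[𝕜] 𝕜) : V [⋀^κ]→ₗ[𝕜] 𝕜 :=
  detRowAlternating.compLinearMap (LinearMap.pi α)

theorem wedgeForm_apply (α : κ → V →ₗ[𝕜] 𝕜) (v : κ → V) :
    wedgeForm α v = (of fun i j => α j (v i)).det := rfl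

theorem wedgeForm_apply_transpose (α : κ → V →ₗ[𝕜] 𝕜) (v : κ → V) :
    wedgeForm α v = (of fun i j => α i (v j)).det := by
  rw [wedgeForm_apply, ← det_transpose]; rfl

/-- A determinantal resolution of the identity on alternating maps. -/
theorem sum_det_smul (Ψ : V₁ [⋀^κ]→ₗ[𝕜] U) (x : κ → V₁) (u : ι' → V₁) (c : κ → ι' → 𝕜)
    (hx : ∀ i, x i = ∑ k, c i k • u k) :
    ∑ I : κ → ι', (of fun i j => c j (I i)).det • Ψ (fun i => u (I i))
      = ((Fintype.card κ).factorial : 𝕜) • Ψ x := by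
  classical
  -- Multilinear expansion of `Ψ (x ∘ σ)`. In the alternating sum over `σ` the sign of the
  -- determinant cancels that of `Ψ`, so each of the `κ!` permutations contributes `Ψ x`.
  have key : ∀ σ : Perm κ, ∑ I : κ → ι', (∏ i, c (σ i) (I i)) • Ψ (fun i => u (I i))
      = Ψ (x ∘ σ) := by
    intro σ
    have h1 : x ∘ σ = fun i => ∑ k, c (σ i) k • u k := funext fun i => hx (σ i)
    rw [h1]
    change _ = Ψ.toMultilinearMap _
    rw [MultilinearMap.map_sum]
    refine Finset.sum_congr rfl fun I _ => ?_
    exact (Ψ.toMultilinearMap.map_smul_univ (fun i => c (σ i) (I i)) fun i => u (I i)).symm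
  calc ∑ I : κ → ι', (of fun i j => c j (I i)).det • Ψ (fun i => u (I i))
      = ∑ σ : Perm κ, ((Perm.sign σ : ℤ) : 𝕜) • Ψ (x ∘ σ) := by
        simp_rw [← key, Finset.smul_sum]
        rw [Finset.sum_comm]
        refine Finset.sum_congr rfl fun I _ => ?_
        rw [← det_transpose, det_apply', Finset.sum_smul]
        refine Finset.sum_congr rfl fun σ _ => ?_
        rw [smul_smul]
        rfl
    _ = ∑ σ : Perm κ, Ψ x := by
        refine Finset.sum_congr rfl fun σ _ => ?_
        rw [Ψ.map_perm, Units.smul_def, ← Int.cast_smul_eq_zsmul 𝕜, smul_smul, ← Int.cast_mul,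
          ← Units.val_mul, Int.units_mul_self]
        simp
    _ = _ := by
        rw [Finset.sum_const, Finset.card_univ, Fintype.card_perm, Nat.cast_smul_eq_nsmul]

variable (b : Module.Basis J 𝕜 V)

/-- The resolution of the identity on the dual space, from $\alpha_i=\sum_k\alpha_i(b_k)\,b^k$. It
removes the basis from the definition of `dualize`. -/
theorem sum_wedgeForm_smul_coord (Ψ : (V →ₗ[𝕜] 𝕜) [⋀^κ]→ₗ[𝕜] U) (α : κ → V →ₗ[𝕜] 𝕜) :
    ∑ I : κ → J, wedgeForm α (fun i => b (I i)) • Ψ (fun i => b.coord (I i))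
      = ((Fintype.card κ).factorial : 𝕜) • Ψ α := by
  refine sum_det_smul Ψ α b.coord (fun i k => α i (b k)) fun i => ?_
  refine b.ext fun k => ?_
  classical
  simp

theorem sum_wedgeForm_smul_basis (w : V [⋀^κ]→ₗ[𝕜] W) (v : κ → V) :
    ∑ I : κ → J, wedgeForm (fun i => b.coord (I i)) v • w (fun i => b (I i))
      = ((Fintype.card κ).factorial : 𝕜) • w v := by
  have h := sum_det_smul w v b (fun i k => b.coord k (v i)) fun i => (b.sum_repr (v i)).symm
  rw [← h]
  refine Finset.sum_congr rfl fun I _ => ?_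
  rw [wedgeForm_apply_transpose]

variable [CharZero 𝕜]

/-- An alternating form is a combination of exterior products of the coordinates. -/
theorem eq_sum_tensor (w : V [⋀^κ]→ₗ[𝕜] W) :
    w = ∑ I : κ → J, tensor (wedgeForm (fun i => b.coord (I i)))
      (((Fintype.card κ).factorial : 𝕜)⁻¹ • w (fun i => b (I i))) := by
  ext v
  have h := sum_wedgeForm_smul_basis b w v
  have h0 : ((Fintype.card κ).factorial : 𝕜) ≠ 0 := Nat.cast_ne_zero.2 (Nat.factorial_ne_zero _)
  rw [sum_apply]
  simp only [tensor_apply]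
  simp_rw [smul_comm _ ((Fintype.card κ).factorial : 𝕜)⁻¹]
  rw [← Finset.smul_sum, h, inv_smul_smul₀ h0]

/-- The Hodge type operator of a volume form `vol` and a linear map `sh` from covectors to
vectors, computed with a basis. -/
def dualize (e : κ ⊕ κ' ≃ J) (sh : (V →ₗ[𝕜] 𝕜) →ₗ[𝕜] V) (vol : V [⋀^J]→ₗ[𝕜] 𝕜) :
    (V [⋀^κ]→ₗ[𝕜] W) →ₗ[𝕜] (V [⋀^κ']→ₗ[𝕜] W) where
  toFun w := ((Fintype.card κ).factorial : 𝕜)⁻¹ • ∑ I : κ → J,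
    tensor (contractLeft e vol fun i => sh (b.coord (I i))) (w fun i => b (I i))
  map_add' w w' := by
    rw [← smul_add, ← Finset.sum_add_distrib]
    refine congrArg _ (Finset.sum_congr rfl fun I _ => ?_)
    ext v
    simp
  map_smul' c w := by
    ext v
    simp only [AlternatingMap.smul_apply, sum_apply, tensor_apply, RingHom.id_apply]
    rw [smul_comm c]
    refine congrArg (_ • ·) ?_
    rw [Finset.smul_sum]
    exact Finset.sum_congr rfl fun I _ => smul_comm _ _ _

theorem dualize_apply (e : κ ⊕ κ' ≃ J) (sh : (V →ₗ[𝕜] 𝕜) →ₗ[𝕜] V)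
    (vol : V [⋀^J]→ₗ[𝕜] 𝕜) (w : V [⋀^κ]→ₗ[𝕜] W) (v : κ' → V) :
    dualize b e sh vol w v = ((Fintype.card κ).factorial : 𝕜)⁻¹ • ∑ I : κ → J,
      vol (Sum.elim (fun i => sh (b.coord (I i))) v ∘ e.symm) • w fun i => b (I i) := by
  change (((Fintype.card κ).factorial : 𝕜)⁻¹ • ∑ I : κ → J,
    tensor (contractLeft e vol fun i => sh (b.coord (I i))) (w fun i => b (I i))) v = _
  rw [AlternatingMap.smul_apply, sum_apply]
  rfl

/-- The sum over index families is a resolution of the identity applied to the alternating map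
$\xi\mapsto \mathrm{vol}(\sharp\xi,v)$. The right-hand side contains no basis, and products of
covectors span all forms, so this formula characterizes the operator. -/
theorem dualize_wedgeForm (e : κ ⊕ κ' ≃ J) (sh : (V →ₗ[𝕜] 𝕜) →ₗ[𝕜] V) (vol : V [⋀^J]→ₗ[𝕜] 𝕜)
    (α : κ → V →ₗ[𝕜] 𝕜) (c : W) :
    dualize b e sh vol (tensor (wedgeForm α) c)
      = tensor (contractLeft e vol fun i => sh (α i)) c := by
  ext v
  have h := sum_wedgeForm_smul_coord b ((contractRight e vol v).compLinearMap sh) α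
  have h0 : ((Fintype.card κ).factorial : 𝕜) ≠ 0 := Nat.cast_ne_zero.2 (Nat.factorial_ne_zero _)
  rw [dualize_apply, inv_smul_eq_iff₀ h0]
  simp only [tensor_apply, smul_smul]
  rw [← Finset.sum_smul]
  congr 1
  simp only [AlternatingMap.compLinearMap_apply, contractRight_apply, smul_eq_mul] at h
  simp only [contractLeft_apply]
  rw [← h]
  exact Finset.sum_congr rfl fun I _ => mul_comm _ _

/-- The operator does not depend on the basis. -/
theorem dualize_congr_basis (b b' : Module.Basis J 𝕜 V) (e : κ ⊕ κ' ≃ J)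
    (sh : (V →ₗ[𝕜] 𝕜) →ₗ[𝕜] V) (vol : V [⋀^J]→ₗ[𝕜] 𝕜) (w : V [⋀^κ]→ₗ[𝕜] W) :
    dualize b e sh vol w = dualize b' e sh vol w := by
  rw [eq_sum_tensor b w, map_sum, map_sum]
  exact Finset.sum_congr rfl fun I _ => by rw [dualize_wedgeForm, dualize_wedgeForm]

end AlternatingForm

/-! ### The dualization applied twice -/

namespace AlternatingForm

open Matrix Equiv

section DoubleDual

variable {𝕜 V W κ κ' J : Type*} [Field 𝕜] [AddCommGroup V] [Module 𝕜 V]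
  [AddCommGroup W] [Module 𝕜 W]
  [Fintype κ] [DecidableEq κ] [Fintype κ'] [DecidableEq κ'] [Fintype J] [DecidableEq J]

theorem det_eq_sign_mul_det_submatrix (M : Matrix J J 𝕜) (e π : κ ⊕ κ' ≃ J) :
    M.det = ((Perm.sign (e.symm.trans π) : ℤ) : 𝕜) * (M.submatrix e π).det := by
  have h : M.submatrix e π = (M.submatrix id (e.symm.trans π)).submatrix e e := by
    ext i j
    simp
  rw [h, det_submatrix_equiv_self, det_permute', ← mul_assoc, ← Int.cast_mul, ← Units.val_mul,
    Int.units_mul_self]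
  simp

variable (b : Module.Basis J 𝕜 V)

/-- With rows ordered by `e` and columns by `π`, the matrix is block triangular with an identity
block, because the inserted vectors are basis vectors; only the sign of the reordering remains. -/
theorem wedgeForm_coord_elim_basis (e π : κ ⊕ κ' ≃ J) (v : κ' → V) :
    wedgeForm b.coord (Sum.elim (fun i => b (π (Sum.inl i))) v ∘ e.symm)
      = ((Perm.sign (e.symm.trans π) : ℤ) : 𝕜)
        * wedgeForm (fun i => b.coord (π (Sum.inr i))) v := by
  rw [wedgeForm_apply, det_eq_sign_mul_det_submatrix _ e π, wedgeForm_apply]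
  congr 1
  rw [← one_mul (det (of fun i j => b.coord (π (Sum.inr j)) (v i))), ← det_one (n := κ),
    ← det_fromBlocks_zero₁₂ _ (of fun i j => b.coord (π (Sum.inl j)) (v i))]
  congr 1
  ext i j
  rcases i with i | i <;> rcases j with j | j <;> simp [Matrix.one_apply, Finsupp.single_apply]

/-- The dual computation: here the last covectors are coordinates and the identity block sits at the
lower right. The sign is the same as for vectors, so the two cancel in a product. -/
theorem det_elim_coord (e π : κ ⊕ κ' ≃ J) (y : κ → V →ₗ[𝕜] 𝕜) :
    (of fun i j => (Sum.elim y (fun i => b.coord (π (Sum.inr i))) ∘ e.symm) i (b j)).det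
      = ((Perm.sign (e.symm.trans π) : ℤ) : 𝕜)
        * (of fun i j => y i (b (π (Sum.inl j)))).det := by
  rw [det_eq_sign_mul_det_submatrix _ e π]
  congr 1
  rw [← mul_one (det (of fun i j => y i (b (π (Sum.inl j))))), ← det_one (n := κ'),
    ← det_fromBlocks_zero₂₁ _ (of fun i j => y i (b (π (Sum.inr j))))]
  congr 1
  ext i j
  rcases i with i | i <;> rcases j with j | j <;>
    simp [Matrix.one_apply, Finsupp.single_apply, eq_comm]

theorem exists_equiv_of_injective (e : κ ⊕ κ' ≃ J) (I : κ → J) (hI : Function.Injective I) :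
    ∃ π : κ ⊕ κ' ≃ J, ∀ i, π (Sum.inl i) = I i := by
  classical
  have hc : Fintype.card κ' = Fintype.card ((Set.range I)ᶜ : Set J) := by
    have h1 := Fintype.card_congr e
    have h2 : Fintype.card (Set.range I) = Fintype.card κ := Set.card_range_of_injective hI
    rw [Fintype.card_sum] at h1
    rw [Fintype.card_compl_set, h2]
    omega
  refine ⟨((Equiv.ofInjective I hI).sumCongr (Fintype.equivOfCardEq hc)).trans
    (Equiv.Set.sumCompl _), fun i => ?_⟩
  simp

/-- The determinant of covectors on the basis `b`, as an alternating form. -/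
def coForm : (V →ₗ[𝕜] 𝕜) [⋀^J]→ₗ[𝕜] 𝕜 :=
  detRowAlternating.compLinearMap (LinearMap.pi fun j => LinearMap.applyₗ (b j))

theorem coForm_apply (ξ : J → V →ₗ[𝕜] 𝕜) : coForm b ξ = (of fun i j => ξ i (b j)).det := rfl

/-- Contraction of two volume forms. -/
theorem sum_coForm_mul_wedgeForm (e : κ ⊕ κ' ≃ J) (y : κ → V →ₗ[𝕜] 𝕜) (x : κ → V) :
    ∑ I : κ' → J, coForm b (Sum.elim y (fun i => b.coord (I i)) ∘ e.symm)
        * wedgeForm b.coord (Sum.elim x (fun i => b (I i)) ∘ e.symm)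
      = ((Fintype.card κ').factorial : 𝕜) * (of fun i j => y i (x j)).det := by
  let F : V [⋀^κ]→ₗ[𝕜] 𝕜 := ∑ I : κ' → J,
    coForm b (Sum.elim y (fun i => b.coord (I i)) ∘ e.symm)
      • contractRight e (wedgeForm b.coord) (fun i => b (I i))
  -- Both sides alternate in `x`, so basis vectors with distinct indices suffice. Their indices
  -- extend to a bijection `π`; summing over `I` replaces the covectors `b.coord (I i)` by the
  -- coordinates complementary to these indices, and the sign of `π` appears twice.
  have hF : F = ((Fintype.card κ').factorial : 𝕜) • wedgeForm y := by
    refine Module.Basis.ext_alternating b fun I hI => ?_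
    obtain ⟨π, hπ⟩ := exists_equiv_of_injective e I hI
    have h1 : (fun i => b (I i)) = fun i => b (π (Sum.inl i)) := funext fun i => by rw [hπ]
    rw [h1]
    simp only [F, sum_apply, AlternatingMap.smul_apply, contractRight_apply, smul_eq_mul,
      wedgeForm_coord_elim_basis]
    have h2 := sum_wedgeForm_smul_coord b (contractLeft e (coForm b) y)
      (fun i => b.coord (π (Sum.inr i)))
    simp only [contractLeft_apply, smul_eq_mul, coForm_apply, det_elim_coord] at h2
    simp only [coForm_apply]
    calc _ = ((Perm.sign (e.symm.trans π) : ℤ) : 𝕜) * ∑ I : κ' → J,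
          wedgeForm (fun i => b.coord (π (Sum.inr i))) (fun i => b (I i))
            * (of fun i j => (Sum.elim y (fun i => b.coord (I i)) ∘ e.symm) i (b j)).det := by
          rw [Finset.mul_sum]
          exact Finset.sum_congr rfl fun _ _ => by ring
      _ = _ := by
          rw [h2, wedgeForm_apply_transpose]
          have hs : ((Perm.sign (e.symm.trans π) : ℤ) : 𝕜)
              * ((Perm.sign (e.symm.trans π) : ℤ) : 𝕜) = 1 := by
            rw [← Int.cast_mul, ← Units.val_mul, Int.units_mul_self]
            simp
          linear_combination ((Fintype.card κ').factorial : 𝕜)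
            * (of fun i j => y i (b (π (Sum.inl j)))).det * hs
  have h := congrArg (fun G : V [⋀^κ]→ₗ[𝕜] 𝕜 => G x) hF
  simp only [F, sum_apply, AlternatingMap.smul_apply, contractRight_apply, smul_eq_mul,
    wedgeForm_apply_transpose y] at h
  exact h

/-- The map from covectors to vectors of a bilinear form with matrix `γ` in the basis `b`. -/
def sharp (γ : Matrix J J 𝕜) : (V →ₗ[𝕜] 𝕜) →ₗ[𝕜] V :=
  ∑ i, ∑ j, (LinearMap.toSpanSingleton 𝕜 V (γ⁻¹ i j • b j)) ∘ₗ LinearMap.applyₗ (b i)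

theorem sharp_apply (γ : Matrix J J 𝕜) (ξ : V →ₗ[𝕜] 𝕜) :
    sharp b γ ξ = ∑ j, (∑ i, ξ (b i) * γ⁻¹ i j) • b j := by
  simp only [sharp, LinearMap.sum_apply, LinearMap.comp_apply, LinearMap.applyₗ_apply_apply,
    LinearMap.toSpanSingleton_apply, smul_smul, Finset.sum_smul]
  rw [Finset.sum_comm]

theorem coord_sharp (γ : Matrix J J 𝕜) (ξ : V →ₗ[𝕜] 𝕜) (j : J) :
    b.coord j (sharp b γ ξ) = ∑ i, ξ (b i) * γ⁻¹ i j := by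
  rw [sharp_apply, Module.Basis.coord_apply, Module.Basis.repr_sum_self]

theorem apply_sharp (γ : Matrix J J 𝕜) (ξ ζ : V →ₗ[𝕜] 𝕜) :
    ζ (sharp b γ ξ) = ∑ j, ∑ i, ξ (b i) * γ⁻¹ i j * ζ (b j) := by
  simp [sharp_apply, map_sum, Finset.sum_mul]

theorem apply_sharp_comm {γ : Matrix J J 𝕜} (hγ : γ.IsSymm) (ξ ζ : V →ₗ[𝕜] 𝕜) :
    ζ (sharp b γ ξ) = ξ (sharp b γ ζ) := by
  have h : ∀ i j, γ⁻¹ i j = γ⁻¹ j i := fun i j => by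
    have := congrFun (congrFun (Matrix.transpose_nonsing_inv γ) j) i
    rw [hγ.eq] at this
    exact this
  rw [apply_sharp, apply_sharp, Finset.sum_comm]
  refine Finset.sum_congr rfl fun i _ => Finset.sum_congr rfl fun j _ => ?_
  rw [h i j]
  ring

theorem sharp_surjective {γ : Matrix J J 𝕜} (hγ : γ.det ≠ 0) :
    Function.Surjective (sharp b γ) := by
  intro v
  -- The preimage is the covector $v^\flat$ with components $\sum_l v^l\gamma_{lk}$.
  refine ⟨∑ k, (∑ l, b.coord l v * γ l k) • b.coord k, b.ext_elem fun j => ?_⟩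
  have hu : IsUnit γ.det := isUnit_iff_ne_zero.2 hγ
  have h := Matrix.mul_nonsing_inv γ hu
  have h1 := coord_sharp b γ (∑ k, (∑ l, b.coord l v * γ l k) • b.coord k) j
  rw [Module.Basis.coord_apply] at h1
  rw [h1]
  have h2 : ∀ i, (∑ k, (∑ l, b.coord l v * γ l k) • b.coord k) (b i)
      = ∑ l, b.coord l v * γ l i := by
    intro i
    simp [LinearMap.sum_apply, Finsupp.single_apply]
  simp_rw [h2, Finset.sum_mul]
  rw [Finset.sum_comm]
  have h3 : ∀ l, ∑ i, b.coord l v * γ l i * γ⁻¹ i j = b.coord l v * (1 : Matrix J J 𝕜) l j := by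
    intro l
    rw [← h, Matrix.mul_apply, Finset.mul_sum]
    exact Finset.sum_congr rfl fun _ _ => by ring
  simp_rw [h3]
  simp [Matrix.one_apply]

/-- The matrix of the coordinates of $\sharp\xi_i$ is $(\xi_i(b_j))\,\gamma^{-1}$. This is the
origin of $1/\det\gamma$ in the double dual. -/
theorem wedgeForm_coord_sharp (γ : Matrix J J 𝕜) (ξ : J → V →ₗ[𝕜] 𝕜) :
    wedgeForm b.coord (fun i => sharp b γ (ξ i)) = coForm b ξ * (γ.det)⁻¹ := by
  rw [wedgeForm_apply, coForm_apply]
  have : (of fun i j => b.coord j (sharp b γ (ξ i))) = (of fun i j => ξ i (b j)) * γ⁻¹ := by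
    ext i j
    rw [of_apply, coord_sharp, Matrix.mul_apply]
    rfl
  rw [this, det_mul, Matrix.det_nonsing_inv, Ring.inverse_eq_inv']

variable [CharZero 𝕜]

/-- By linearity the form is a product $\alpha\otimes c$, and its double dual is a sum over $I$ of
$\mathrm{vol}(\sharp b^I,v)\,\mathrm{vol}(\sharp\alpha,b_I)$. With $v=\sharp y$ the first factor
becomes a determinant of covectors divided by $\det\gamma$, so the sum is a contraction of two
volume forms and equals a multiple of $\det(y_i(\sharp\alpha_j))$. By symmetry of $\gamma$ this is
$\alpha(v)$. The sign is that of the exchange of the two blocks of arguments. -/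
theorem dualize_dualize {γ : Matrix J J 𝕜} (hs : γ.IsSymm) (hγ : γ.det ≠ 0) (ρ : 𝕜)
    (e : κ ⊕ κ' ≃ J) (e' : κ' ⊕ κ ≃ J) (w : V [⋀^κ]→ₗ[𝕜] W) :
    dualize b e' (sharp b γ) (ρ • wedgeForm b.coord)
        (dualize b e (sharp b γ) (ρ • wedgeForm b.coord) w)
      = (((Perm.sign ((e'.symm.trans (Equiv.sumComm κ' κ)).trans e) : ℤ) : 𝕜)
          * (ρ * ρ * (γ.det)⁻¹)) • w := by
  rw [eq_sum_tensor b w]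
  simp only [map_sum, Finset.smul_sum]
  refine Finset.sum_congr rfl fun I0 _ => ?_
  generalize (((Fintype.card κ).factorial : 𝕜)⁻¹ • w fun i => b (I0 i)) = c
  generalize (fun i => b.coord (I0 i)) = α
  rw [dualize_wedgeForm]
  ext v
  choose y hy using fun i => sharp_surjective b hγ (v i)
  set σ := (e'.symm.trans (Equiv.sumComm κ' κ)).trans e
  have hσ : ∀ (ξ : κ → V) (ζ : κ' → V),
      (Sum.elim ζ ξ ∘ e'.symm) = (Sum.elim ξ ζ ∘ e.symm) ∘ σ := by
    intro ξ ζ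
    funext j
    simp only [σ, Function.comp, Equiv.trans_apply, Equiv.symm_apply_apply]
    cases e'.symm j <;> rfl
  have h0 : ((Fintype.card κ').factorial : 𝕜) ≠ 0 := Nat.cast_ne_zero.2 (Nat.factorial_ne_zero _)
  have key := sum_coForm_mul_wedgeForm b e y (fun i => sharp b γ (α i))
  have hd : (of fun i j => y i (sharp b γ (α j))).det = wedgeForm α v := by
    rw [wedgeForm_apply]
    congr 1
    ext i j
    rw [of_apply, of_apply, apply_sharp_comm b hs, hy]
  rw [hd] at key
  rw [dualize_apply, inv_smul_eq_iff₀ h0]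
  simp only [AlternatingMap.smul_apply, tensor_apply, smul_smul, ← Finset.sum_smul]
  congr 1
  -- The arguments `v`, which come last in the second dual, are moved in front by `σ`, so that both
  -- volume forms use the order prescribed by `e`.
  have hv : ∀ I : κ' → J, (ρ • wedgeForm b.coord)
      (Sum.elim (fun i => sharp b γ (b.coord (I i))) v ∘ e'.symm)
      = ((Perm.sign σ : ℤ) : 𝕜) * (ρ * (γ.det)⁻¹)
        * coForm b (Sum.elim y (fun i => b.coord (I i)) ∘ e.symm) := by
    intro I
    rw [hσ, AlternatingMap.smul_apply, AlternatingMap.map_perm]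
    have : (Sum.elim v (fun i => sharp b γ (b.coord (I i))) ∘ e.symm)
        = fun j => sharp b γ ((Sum.elim y (fun i => b.coord (I i)) ∘ e.symm) j) := by
      funext j
      rcases h : e.symm j with i | i <;> simp [h, hy]
    rw [this, wedgeForm_coord_sharp, Units.smul_def, ← Int.cast_smul_eq_zsmul 𝕜]
    simp only [smul_eq_mul]
    ring
  simp only [AlternatingMap.smul_apply, smul_eq_mul] at hv
  simp only [contractLeft_apply, AlternatingMap.smul_apply, smul_eq_mul, hv]
  calc _ = ((Perm.sign σ : ℤ) : 𝕜) * (ρ * ρ * (γ.det)⁻¹) * ∑ I : κ' → J,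
        coForm b (Sum.elim y (fun i => b.coord (I i)) ∘ e.symm)
        * wedgeForm b.coord (Sum.elim (fun i => sharp b γ (α i)) (fun i => b (I i)) ∘ e.symm) := by
        rw [Finset.mul_sum]
        exact Finset.sum_congr rfl fun _ _ => by ring
    _ = _ := by rw [key]; ring

end DoubleDual

end AlternatingForm

/-! ### Signs of block permutations and Levi-Civita symbols -/

namespace AlternatingForm

open Matrix Equiv LieAlgd

/-- The sign of a permutation whose inversions are the pairs in `S × K`. -/
theorem sign_eq_neg_one_pow {N : ℕ} {ι : Type*} [Fintype ι] (σ : Perm (Fin N)) (A : ι ≃ Fin N)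
    (S K : ι → Prop) [DecidablePred S] [DecidablePred K]
    (h : ∀ x y, (A x < A y ∧ ¬ σ (A x) < σ (A y)) ↔ S x ∧ K y) :
    Perm.sign σ = (-1) ^ ((∑ x, if S x then 1 else 0) * ∑ y, if K y then 1 else 0) := by
  classical
  -- The sign is the product of `-1` over all inversions. Reindexed by `A`, the inversions form the
  -- full product set `S × K`, whence the exponent.
  have h1 : Perm.sign σ = ∏ i, ∏ j, if i < j ∧ ¬ σ i < σ j then (-1 : ℤˣ) else 1 := by
    rw [Perm.sign_eq_prod_prod_Ioi]
    refine Finset.prod_congr rfl fun i _ => ?_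
    have : Finset.Ioi i = Finset.univ.filter (i < ·) := by ext; simp
    rw [this, Finset.prod_filter]
    refine Finset.prod_congr rfl fun j _ => ?_
    by_cases h1 : i < j <;> by_cases h2 : σ i < σ j <;> simp [h1, h2]
  rw [h1, ← A.prod_comp]
  simp_rw [← A.prod_comp, h]
  have h2 : ∀ x, (∏ y, if S x ∧ K y then (-1 : ℤˣ) else 1)
      = if S x then (-1) ^ (∑ y, if K y then 1 else 0) else 1 := by
    intro x
    by_cases hx : S x
    · simp [hx, Finset.prod_ite]
    · simp [hx]
  simp_rw [h2]
  rw [Finset.prod_ite]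
  simp [← pow_mul, mul_comm]

/-- The splitting of the index set of the basis vectors into blocks of length `p` and `q`. -/
def blockEquiv {m n p q : ℕ} (h : p + q = m + n) : Fin p ⊕ Fin q ≃ Fin m ⊕ Fin n :=
  finSumFinEquiv.trans ((finCongr h).trans finSumFinEquiv.symm)

/-- Exchanging adjacent blocks of lengths `q` and `p` inverts exactly the pairs with one element in
each block. -/
theorem sign_blockEquiv_comm {m n p q : ℕ} (h : p + q = m + n) (h' : q + p = m + n) :
    Perm.sign (((blockEquiv h').symm.trans (Equiv.sumComm (Fin q) (Fin p))).trans (blockEquiv h))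
      = (-1) ^ (q * p) := by
  set σ := ((blockEquiv h').symm.trans (Equiv.sumComm (Fin q) (Fin p))).trans (blockEquiv h)
  rw [← Perm.sign_permCongr finSumFinEquiv σ]
  have key : ∀ x, (finSumFinEquiv.permCongr σ) (finSumFinEquiv (blockEquiv h' x))
      = finSumFinEquiv (blockEquiv h (Equiv.sumComm _ _ x)) := by
    intro x
    simp [σ, Equiv.permCongr_apply]
  have hv : ∀ x, ((finSumFinEquiv (blockEquiv h' x) : Fin (m + n)) : ℕ)
      = (finSumFinEquiv x : Fin (q + p)) := by intro x; simp [blockEquiv]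
  have hw : ∀ x, ((finSumFinEquiv (blockEquiv h x) : Fin (m + n)) : ℕ)
      = (finSumFinEquiv x : Fin (p + q)) := by intro x; simp [blockEquiv]
  rw [sign_eq_neg_one_pow _ ((blockEquiv h').trans finSumFinEquiv)
    (fun x => x.isLeft) (fun x => x.isRight)]
  · simp only [Fintype.sum_sum_type]; simp
  · intro x y
    simp only [Equiv.trans_apply, key, Fin.lt_def, hv, hw]
    rcases x with i | i <;> rcases y with j | j <;> simp <;> omega

section Blocks

variable {r s k l : ℕ}

/-- The exchange of the two middle blocks of indices. -/
def middleSwap (h : (r + s) + (k + l) = (r + k) + (s + l)) :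
    Perm (Fin (r + k) ⊕ Fin (s + l)) :=
  (blockEquiv h).symm.trans ((Equiv.sumCongr finSumFinEquiv.symm finSumFinEquiv.symm).trans
    ((Equiv.sumSumSumComm (Fin r) (Fin s) (Fin k) (Fin l)).trans
      (Equiv.sumCongr finSumFinEquiv finSumFinEquiv)))

/-- The inversions are the pairs formed by an element of the block of length `s` and one of the
block of length `k`. With `k = m - r` this is the sign $(-1)^{s(m-r)}$ of the local formula. -/
theorem sign_middleSwap (h : (r + s) + (k + l) = (r + k) + (s + l)) :
    Perm.sign (middleSwap h) = (-1) ^ (s * k) := by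
  rw [← Perm.sign_permCongr finSumFinEquiv (middleSwap h)]
  let A : (Fin r ⊕ Fin s) ⊕ (Fin k ⊕ Fin l) ≃ Fin (r + k) ⊕ Fin (s + l) :=
    (Equiv.sumCongr finSumFinEquiv finSumFinEquiv).trans (blockEquiv h)
  have key : ∀ x, (finSumFinEquiv.permCongr (middleSwap h)) (finSumFinEquiv (A x))
      = finSumFinEquiv ((Equiv.sumCongr finSumFinEquiv finSumFinEquiv)
        (Equiv.sumSumSumComm (Fin r) (Fin s) (Fin k) (Fin l) x)) := by
    intro x
    simp only [Equiv.permCongr_apply, Equiv.symm_apply_apply, A, middleSwap, Equiv.trans_apply,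
      Equiv.sumCongr_apply, Sum.map_map]
    congr 3
    rcases x with x | x <;> simp
  have hv : ∀ x, ((finSumFinEquiv (A x) : Fin ((r + k) + (s + l))) : ℕ)
      = (finSumFinEquiv (Equiv.sumCongr finSumFinEquiv finSumFinEquiv x) :
          Fin ((r + s) + (k + l))) := by intro x; simp [A, blockEquiv]
  rw [sign_eq_neg_one_pow _ (A.trans finSumFinEquiv)
    (fun x => Sum.elim (fun y => y.isRight) (fun _ => false) x)
    (fun x => Sum.elim (fun _ => false) (fun y => y.isLeft) x)]
  · simp only [Fintype.sum_sum_type]; simp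
  · intro x y
    simp only [Equiv.trans_apply, key, Fin.lt_def, hv]
    rcases x with (i | i) | (i | i) <;> rcases y with (j | j) | (j | j) <;> simp <;> omega

variable {V W : Type*}

theorem append_middleSwap (h : (r + s) + (k + l) = (r + k) + (s + l)) (u : Fin r → V)
    (t : Fin s → V) (u' : Fin k → V) (t' : Fin l → V) :
    Sum.elim (Fin.append u t) (Fin.append u' t') ∘ (blockEquiv h).symm
      = Sum.elim (Fin.append u u') (Fin.append t t') ∘ middleSwap h := by
  funext j
  obtain ⟨x, rfl⟩ := (blockEquiv h).surjective j
  simp only [middleSwap, Function.comp, Equiv.symm_apply_apply, Equiv.trans_apply]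
  rcases x with x | x
  · obtain ⟨y, rfl⟩ := finSumFinEquiv.surjective x
    rcases y with i | i <;> simp
  · obtain ⟨y, rfl⟩ := finSumFinEquiv.surjective x
    rcases y with i | i <;> simp

end Blocks

/-- The Leibniz sum over permutations extends to all index maps since the symbol vanishes on those
that are not bijective. -/
theorem det_eq_sum_leviCivita {R : Type*} [CommRing R] {k : ℕ} (M : Matrix (Fin k) (Fin k) R) :
    M.det = ∑ ν : Fin k → Fin k, (leviCivita ν : R) * ∏ i, M i (ν i) := by
  rw [← det_transpose, det_apply']
  refine Fintype.sum_of_injective (fun σ : Perm (Fin k) => (σ : Fin k → Fin k))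
    DFunLike.coe_injective _ _ ?_ ?_
  · intro ν hν
    have : ¬ Function.Bijective ν := fun hb => hν ⟨Equiv.ofBijective ν hb, rfl⟩
    rw [leviCivita, dif_neg this]
    simp
  · intro σ
    have h1 : leviCivita (σ : Fin k → Fin k) = (Perm.sign σ : ℤ) := by
      have : Equiv.ofBijective σ σ.bijective = σ := Equiv.ext fun _ => rfl
      rw [leviCivita, dif_pos σ.bijective, this]
    simp only [h1, transpose_apply]

end AlternatingForm

/-! ### Bidegrees and the scaling of horizontal vectors -/

namespace AlternatingForm

open Matrix Equiv LieAlgd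

variable {𝕜 V W : Type*} [Field 𝕜] [AddCommGroup V] [Module 𝕜 V] [AddCommGroup W] [Module 𝕜 W]
  {m n : ℕ} (b : Module.Basis (Fin m ⊕ Fin n) 𝕜 V)

theorem wedge_eq_wedgeForm {k l q : ℕ} (h : k + l = q) (α : Fin k → V →ₗ[𝕜] 𝕜)
    (β : Fin l → V →ₗ[𝕜] 𝕜) :
    wedge h α β = wedgeForm fun i => Fin.append α β (Fin.cast h.symm i) := rfl

theorem formSmul_eq_tensor {q : ℕ} (η : V [⋀^Fin q]→ₗ[𝕜] 𝕜) (c : W) :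
    formSmul η c = tensor η c := rfl

/-- The exterior product `e^{μ_1} ∧ ⋯ ∧ e^{μ_r} ∧ f^{a_1} ∧ ⋯ ∧ f^{a_s}` of coordinates. -/
def coordWedge {r s p : ℕ} (h : r + s = p) (μ : Fin r → Fin m) (a : Fin s → Fin n) :
    V [⋀^Fin p]→ₗ[𝕜] 𝕜 :=
  wedge h (fun i => b.coord (Sum.inl (μ i))) fun j => b.coord (Sum.inr (a j))

/-- `θ` multiplies the first basis vectors by `t` and fixes the others. -/
def IsScaling (t : 𝕜) (θ : V →ₗ[𝕜] V) : Prop :=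
  (∀ μ v, b.coord (Sum.inl μ) (θ v) = t * b.coord (Sum.inl μ) v) ∧
    ∀ a v, b.coord (Sum.inr a) (θ v) = b.coord (Sum.inr a) v

theorem exists_isScaling (t : 𝕜) : ∃ θ : V →ₗ[𝕜] V, IsScaling b t θ := by
  refine ⟨b.constr 𝕜 (Sum.elim (fun μ => t • b (Sum.inl μ)) fun a => b (Sum.inr a)),
    fun μ v => ?_, fun a v => ?_⟩
  · have : b.coord (Sum.inl μ) ∘ₗ b.constr 𝕜 (Sum.elim (fun μ => t • b (Sum.inl μ))
        fun a => b (Sum.inr a)) = t • b.coord (Sum.inl μ) := by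
      refine b.ext fun j => ?_
      rcases j with j | j <;> simp [Finsupp.single_apply]
    exact LinearMap.congr_fun this v
  · have : b.coord (Sum.inr a) ∘ₗ b.constr 𝕜 (Sum.elim (fun μ => t • b (Sum.inl μ))
        fun a => b (Sum.inr a)) = b.coord (Sum.inr a) := by
      refine b.ext fun j => ?_
      rcases j with j | j <;> simp [Finsupp.single_apply]
    exact LinearMap.congr_fun this v

variable {b}

/-- Pull-back by `θ` multiplies the `r` horizontal columns of the determinant by `t`: the bidegree
is read off as an eigenvalue. -/
theorem coordWedge_comp_scaling {t : 𝕜} {θ : V →ₗ[𝕜] V} (hθ : IsScaling b t θ) {r s p : ℕ}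
    (h : r + s = p) (μ : Fin r → Fin m) (a : Fin s → Fin n) :
    (coordWedge b h μ a).compLinearMap θ = t ^ r • coordWedge b h μ a := by
  subst h
  ext v
  simp only [coordWedge, wedge_eq_wedgeForm, AlternatingMap.compLinearMap_apply,
    AlternatingMap.smul_apply, wedgeForm_apply, smul_eq_mul]
  have h1 : (of fun i j => (Fin.append (fun i => b.coord (Sum.inl (μ i)))
      (fun j => b.coord (Sum.inr (a j))) (Fin.cast rfl j)) (θ (v i)))
      = of fun i j => (Fin.append (fun _ : Fin r => t) (fun _ : Fin s => 1) j) *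
        (of fun i j => (Fin.append (fun i => b.coord (Sum.inl (μ i)))
      (fun j => b.coord (Sum.inr (a j))) (Fin.cast rfl j)) (v i)) i j := by
    ext i j
    simp only [of_apply, Fin.cast_eq_self]
    refine Fin.addCases (fun j => ?_) (fun j => ?_) j
    · simp only [Fin.append_left]; exact hθ.1 _ _
    · simp only [Fin.append_right, one_mul]; exact hθ.2 _ _
  rw [h1, det_mul_row, Fin.prod_univ_add]
  simp

theorem wedgeForm_coord_scaling {t : 𝕜} {θ : V →ₗ[𝕜] V} (hθ : IsScaling b t θ)
    (v : Fin m ⊕ Fin n → V) :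
    wedgeForm b.coord (fun j => θ (v j)) = t ^ m * wedgeForm b.coord v := by
  simp only [wedgeForm_apply]
  have h1 : (of fun i j => b.coord j (θ (v i)))
      = of fun i j => (Sum.elim (fun _ : Fin m => t) (fun _ : Fin n => 1) j) *
        (of fun i j => b.coord j (v i)) i j := by
    ext i j
    rcases j with j | j
    · exact hθ.1 _ _
    · simpa using hθ.2 _ _
  rw [h1, det_mul_row, Fintype.prod_sum_type]
  simp

theorem scaling_of_horizontal {t : 𝕜} {θ : V →ₗ[𝕜] V} (hθ : IsScaling b t θ) {u : V}
    (hu : ∀ a, b.coord (Sum.inr a) u = 0) : θ u = t • u := by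
  refine b.ext_elem fun j => ?_
  rcases j with j | j
  · simpa using hθ.1 j u
  · have h1 := hθ.2 j u
    have h2 := hu j
    simp only [Module.Basis.coord_apply] at h1 h2
    simp [h1, h2]

theorem scaling_of_vertical {t : 𝕜} {θ : V →ₗ[𝕜] V} (hθ : IsScaling b t θ) {u : V}
    (hu : ∀ μ, b.coord (Sum.inl μ) u = 0) : θ u = u := by
  refine b.ext_elem fun j => ?_
  rcases j with j | j
  · have h1 := hθ.1 j u
    have h2 := hu j
    simp only [Module.Basis.coord_apply] at h1 h2
    simp [h1, h2]
  · simpa using hθ.2 j u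

/-- The contraction of the volume form with `r` horizontal and `s` vertical vectors has degree
`m - r` in the horizontal direction. -/
theorem contractLeft_scaling {t : 𝕜} {θ : V →ₗ[𝕜] V} (hθ : IsScaling b t θ) (ht : t ≠ 0)
    {r s k p q : ℕ} (hm : r + k = m) (hp : r + s = p) (h : p + q = m + n) {u : Fin r → V}
    {u' : Fin s → V} (hu : ∀ i a, b.coord (Sum.inr a) (u i) = 0)
    (hu' : ∀ i μ, b.coord (Sum.inl μ) (u' i) = 0) :
    (contractLeft (blockEquiv h) (wedgeForm b.coord)
        fun i => Fin.append u u' (Fin.cast hp.symm i)).compLinearMap θ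
      = t ^ k • contractLeft (blockEquiv h) (wedgeForm b.coord)
        fun i => Fin.append u u' (Fin.cast hp.symm i) := by
  subst hp
  ext v
  have h1 := wedgeForm_coord_scaling hθ (Sum.elim (Fin.append u u') v ∘ (blockEquiv h).symm)
  have h2 : (fun j => θ ((Sum.elim (Fin.append u u') v ∘ (blockEquiv h).symm) j))
      = Sum.elim (fun i => Fin.append (fun _ : Fin r => t) (fun _ : Fin s => 1) i
          • Fin.append u u' i) (fun i => θ (v i)) ∘ (blockEquiv h).symm := by
    funext j
    simp only [Function.comp]
    rcases (blockEquiv h).symm j with i | i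
    · simp only [Sum.elim_inl]
      refine Fin.addCases (fun j => ?_) (fun j => ?_) i
      · simpa using scaling_of_horizontal hθ (hu j)
      · simpa using scaling_of_vertical hθ (hu' j)
    · rfl
  rw [h2, ← contractRight_apply] at h1
  -- The volume form scales by $t^m=t^rt^k$ when all arguments are scaled. The `r` inserted
  -- horizontal vectors account for $t^r$ and the vertical ones for nothing; cancelling $t^r$
  -- requires `t ≠ 0`.
  have h3 := (contractRight (blockEquiv h) (wedgeForm b.coord) fun i => θ (v i)).map_smul_univ
    (Fin.append (fun _ : Fin r => t) (fun _ : Fin s => 1)) (Fin.append u u')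
  rw [h3, Fin.prod_univ_add, contractRight_apply] at h1
  simp only [Fin.append_left, Fin.append_right, Finset.prod_const, Finset.card_univ,
    Fintype.card_fin, one_pow, mul_one, smul_eq_mul, ← hm, pow_add, mul_assoc] at h1
  exact mul_left_cancel₀ (pow_ne_zero r ht) h1

variable (b)

/-- Each family of indices can be sorted into its two types. -/
theorem exists_sort {p : ℕ} (I : Fin p → Fin m ⊕ Fin n) :
    ∃ (r s : ℕ) (h : r + s = p) (μ : Fin r → Fin m) (a : Fin s → Fin n) (σ : Perm (Fin p)),
      ∀ i, I i = Fin.append (fun i => Sum.inl (μ i)) (fun j => Sum.inr (a j))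
        (Fin.cast h.symm (σ i)) := by
  classical
  let e : Fin p ≃ {i // (I i).isLeft} ⊕ {i // ¬ (I i).isLeft} := (Equiv.sumCompl _).symm
  let r := Fintype.card {i // (I i).isLeft}
  let s := Fintype.card {i // ¬ (I i).isLeft}
  have h : r + s = p := by
    have := Fintype.card_congr e
    rw [Fintype.card_sum, Fintype.card_fin] at this
    exact this.symm
  let E : Fin p ≃ Fin r ⊕ Fin s :=
    e.trans ((Fintype.equivFin _).sumCongr (Fintype.equivFin _))
  let l : {i // (I i).isLeft} → Fin m := fun i => (I i).getLeft i.2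
  let g : {i // ¬ (I i).isLeft} → Fin n := fun i => (I i).getRight (by simpa using i.2)
  refine ⟨r, s, h, fun i => l ((Fintype.equivFin _).symm i), fun i => g ((Fintype.equivFin _).symm i),
    E.trans (finSumFinEquiv.trans (finCongr h)), fun i => ?_⟩
  obtain ⟨x, rfl⟩ := e.symm.surjective i
  rcases x with x | x
  · simp [E, e, l]
  · simp [E, e, g]

theorem wedgeForm_perm {κ : Type*} [Fintype κ] [DecidableEq κ] (α : κ → V →ₗ[𝕜] 𝕜)
    (σ : Perm κ) : wedgeForm (fun i => α (σ i)) = ((Perm.sign σ : ℤ) : 𝕜) • wedgeForm α := by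
  ext v
  exact det_permute' σ (of fun i j => α j (v i))

/-- With more factors of one type than there are coordinates of that type, two factors coincide. -/
theorem coordWedge_eq_zero {r s p : ℕ} (h : r + s = p) (μ : Fin r → Fin m) (a : Fin s → Fin n)
    (hrs : m < r ∨ n < s) : coordWedge b h μ a = 0 := by
  have key : ∃ i j : Fin (r + s), i ≠ j ∧ Fin.append (fun i => b.coord (Sum.inl (μ i)))
      (fun j => b.coord (Sum.inr (a j))) i = Fin.append (fun i => b.coord (Sum.inl (μ i)))
      (fun j => b.coord (Sum.inr (a j))) j := by
    rcases hrs with hr | hs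
    · obtain ⟨i, j, hij, hμ⟩ := Fintype.exists_ne_map_eq_of_card_lt μ (by simpa using hr)
      exact ⟨Fin.castAdd s i, Fin.castAdd s j, by simpa using hij, by simp [hμ]⟩
    · obtain ⟨i, j, hij, ha⟩ := Fintype.exists_ne_map_eq_of_card_lt a (by simpa using hs)
      exact ⟨Fin.natAdd r i, Fin.natAdd r j, by simpa using hij, by simp [ha]⟩
  obtain ⟨i, j, hij, he⟩ := key
  ext v
  rw [coordWedge, wedge_eq_wedgeForm, wedgeForm_apply]
  refine det_zero_of_column_eq (i := Fin.cast h i) (j := Fin.cast h j) (by simpa using hij) ?_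
  intro k
  simp [he]

variable [CharZero 𝕜]

/-- In the basis expansion each index family is sorted into horizontal and vertical indices at the
cost of a sign. The bounds on `r` and `s` are kept because the weights of the grading operator are
prescribed only for `r ≤ m`. -/
theorem mem_span_coordWedge {p : ℕ} (w : V [⋀^Fin p]→ₗ[𝕜] W) :
    w ∈ Submodule.span 𝕜 {η | ∃ (r s : ℕ) (h : r + s = p) (_ : r ≤ m) (_ : s ≤ n)
      (μ : Fin r → Fin m) (a : Fin s → Fin n) (c : W), η = tensor (coordWedge b h μ a) c} := by
  rw [eq_sum_tensor b w]
  refine Submodule.sum_mem _ fun I _ => ?_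
  obtain ⟨r, s, h, μ, a, σ, hI⟩ := exists_sort I
  set c := (((Fintype.card (Fin p)).factorial : 𝕜)⁻¹ • w fun i => b (I i))
  have h1 : wedgeForm (fun i => b.coord (I i))
      = ((Perm.sign σ : ℤ) : 𝕜) • coordWedge b h μ a := by
    rw [coordWedge, wedge_eq_wedgeForm, ← wedgeForm_perm]
    congr 1
    funext i
    rw [hI]
    generalize Fin.cast h.symm (σ i) = j
    refine Fin.addCases (fun j => ?_) (fun j => ?_) j <;> simp
  have h2 : tensor (wedgeForm fun i => b.coord (I i)) c
      = ((Perm.sign σ : ℤ) : 𝕜) • tensor (coordWedge b h μ a) c := by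
    rw [h1]
    ext v
    simp [mul_smul]
  rw [h2]
  by_cases hrs : r ≤ m ∧ s ≤ n
  · exact Submodule.smul_mem _ _ (Submodule.subset_span ⟨r, s, h, hrs.1, hrs.2, μ, a, c, rfl⟩)
  · rw [coordWedge_eq_zero b h μ a (by omega)]
    have : tensor (0 : V [⋀^Fin p]→ₗ[𝕜] 𝕜) c = 0 := by ext v; simp
    rw [this, smul_zero]
    exact zero_mem _

/-- There are weights `κ_j` with `∑ κ_j (j + 1) ^ r = K r` for all `r ≤ m`. -/
theorem exists_weights (𝕜 : Type*) [Field 𝕜] [CharZero 𝕜] (m : ℕ) (K : ℕ → 𝕜) :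
    ∃ κ : Fin (m + 1) → 𝕜, ∀ r, r ≤ m → ∑ j, κ j * ((j : 𝕜) + 1) ^ r = K r := by
  -- The nodes are `1, …, m + 1`: distinct in characteristic zero, and nonzero as the scaling of
  -- contractions requires.
  let A : Matrix (Fin (m + 1)) (Fin (m + 1)) 𝕜 := vandermonde fun j => (j : 𝕜) + 1
  have hA : IsUnit A.det := by
    rw [isUnit_iff_ne_zero, det_vandermonde_ne_zero_iff]
    intro i j hij
    simpa [Fin.val_inj] using hij
  refine ⟨(fun r : Fin (m + 1) => K r) ᵥ* A⁻¹, fun r hr => ?_⟩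
  have h1 : ((fun r : Fin (m + 1) => K r) ᵥ* A⁻¹) ᵥ* A = fun r : Fin (m + 1) => K r := by
    rw [vecMul_vecMul, nonsing_inv_mul _ hA, vecMul_one]
  exact congrFun h1 (⟨r, by omega⟩ : Fin (m + 1))

end AlternatingForm

/-! ### The grading operator and expansions of bihomogeneous forms -/

namespace AlternatingForm

open Matrix Equiv LieAlgd

variable {𝕜 V W : Type*} [Field 𝕜] [AddCommGroup V] [Module 𝕜 V] [AddCommGroup W] [Module 𝕜 W]
  {m n : ℕ}

/-- The operator `w ↦ ∑ κ_j (w ∘ θ_j)`. -/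
def gradeOp (κ : Fin (m + 1) → 𝕜) (θ : Fin (m + 1) → V →ₗ[𝕜] V) {p : ℕ} :
    (V [⋀^Fin p]→ₗ[𝕜] W) →ₗ[𝕜] (V [⋀^Fin p]→ₗ[𝕜] W) where
  toFun w := ∑ j, κ j • w.compLinearMap (θ j)
  map_add' w w' := by
    rw [← Finset.sum_add_distrib]
    exact Finset.sum_congr rfl fun j _ => by rw [← smul_add]; rfl
  map_smul' c w := by
    rw [RingHom.id_apply, Finset.smul_sum]
    exact Finset.sum_congr rfl fun j _ => by rw [smul_comm]; rfl

theorem gradeOp_apply (κ : Fin (m + 1) → 𝕜) (θ : Fin (m + 1) → V →ₗ[𝕜] V) {p : ℕ}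
    (w : V [⋀^Fin p]→ₗ[𝕜] W) : gradeOp κ θ w = ∑ j, κ j • w.compLinearMap (θ j) := rfl

theorem gradeOp_of_homogeneous {κ : Fin (m + 1) → 𝕜} {θ : Fin (m + 1) → V →ₗ[𝕜] V} {K : 𝕜} {r : ℕ}
    (hκ : ∑ j, κ j * ((j : 𝕜) + 1) ^ r = K) {p : ℕ} {w : V [⋀^Fin p]→ₗ[𝕜] W}
    (hw : ∀ j : Fin (m + 1), w.compLinearMap (θ j) = ((j : 𝕜) + 1) ^ r • w) :
    gradeOp κ θ w = K • w := by
  rw [gradeOp_apply, ← hκ, Finset.sum_smul]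
  exact Finset.sum_congr rfl fun j _ => by rw [hw, smul_smul]

variable (b : Module.Basis (Fin m ⊕ Fin n) 𝕜 V)

theorem gradeOp_tensor_coordWedge {b : Module.Basis (Fin m ⊕ Fin n) 𝕜 V} {κ : Fin (m + 1) → 𝕜}
    {θ : Fin (m + 1) → V →ₗ[𝕜] V} (hθ : ∀ j : Fin (m + 1), IsScaling b ((j : 𝕜) + 1) (θ j)) {K : 𝕜}
    {r s p : ℕ} (hκ : ∑ j, κ j * ((j : 𝕜) + 1) ^ r = K) (h : r + s = p) (μ : Fin r → Fin m)
    (a : Fin s → Fin n) (c : W) :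
    gradeOp κ θ (tensor (coordWedge b h μ a) c) = K • tensor (coordWedge b h μ a) c := by
  refine gradeOp_of_homogeneous hκ fun j => ?_
  ext v
  have := congrArg (fun η : V [⋀^Fin p]→ₗ[𝕜] 𝕜 => η v) (coordWedge_comp_scaling (hθ j) h μ a)
  simp only [AlternatingMap.compLinearMap_apply, AlternatingMap.smul_apply, smul_eq_mul] at this
  simp [this, mul_smul]

variable [CharZero 𝕜]

/-- With weights equal to `1` at `r = k` and `0` elsewhere, the grading operator is the projection
onto horizontal degree `k`. It fixes `Φ` and kills all other products in an expansion of `Φ`. -/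
theorem homogeneous_mem_span {k l q : ℕ} (h : k + l = q) (hk : k ≤ m) {Φ : V [⋀^Fin q]→ₗ[𝕜] W}
    (hΦ : ∀ (t : 𝕜) (θ : V →ₗ[𝕜] V), t ≠ 0 → IsScaling b t θ → Φ.compLinearMap θ = t ^ k • Φ) :
    Φ ∈ Submodule.span 𝕜 {η | ∃ (μ : Fin k → Fin m) (a : Fin l → Fin n) (c : W),
      η = tensor (coordWedge b h μ a) c} := by
  obtain ⟨κ, hκ⟩ := exists_weights 𝕜 m (fun r => if r = k then 1 else 0)
  choose θ hθ using fun j : Fin (m + 1) => exists_isScaling b ((j : 𝕜) + 1)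
  have h1 : gradeOp κ θ Φ = Φ := by
    have := gradeOp_of_homogeneous (θ := θ) (hκ k hk) (w := Φ)
      fun j => hΦ _ _ (Nat.cast_add_one_ne_zero _) (hθ j)
    simpa using this
  rw [← h1]
  refine Submodule.span_induction (p := fun w _ => gradeOp κ θ w ∈ _) ?_ ?_ ?_ ?_
    (mem_span_coordWedge b Φ)
  · rintro _ ⟨r, s, hrs, hr, hs, μ, a, c, rfl⟩
    rw [gradeOp_tensor_coordWedge hθ (hκ r hr)]
    by_cases hrk : r = k
    · subst hrk
      obtain rfl : s = l := by omega
      exact Submodule.smul_mem _ _ (Submodule.subset_span ⟨μ, a, c, rfl⟩)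
    · rw [if_neg hrk, zero_smul]
      exact zero_mem _
  · rw [map_zero]; exact zero_mem _
  · intro x y _ _ hx hy
    rw [map_add]; exact add_mem hx hy
  · intro c x _ hx
    rw [map_smul]; exact Submodule.smul_mem _ _ hx

/-- The determinant of covectors on fixed vectors, as an alternating form. -/
def evalForm {κ : Type*} [Fintype κ] [DecidableEq κ] (v : κ → V) :
    (V →ₗ[𝕜] 𝕜) [⋀^κ]→ₗ[𝕜] 𝕜 :=
  detRowAlternating.compLinearMap (LinearMap.pi fun j => LinearMap.applyₗ (v j))

theorem wedge_eq_evalForm {k l : ℕ} (α : Fin k → V →ₗ[𝕜] 𝕜) (β : Fin l → V →ₗ[𝕜] 𝕜)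
    (v : Fin (k + l) → V) :
    wedge rfl α β v = evalForm v (Sum.elim α β ∘ (finSumFinEquiv (m := k) (n := l)).symm) := by
  rw [wedge_eq_wedgeForm, wedgeForm_apply_transpose]
  change _ = (of fun i j => (Sum.elim α β ∘ finSumFinEquiv.symm) i (v j)).det
  congr 1
  ext i j
  simp only [of_apply, Fin.cast_eq_self, Function.comp]
  refine Fin.addCases (fun j => ?_) (fun j => ?_) i <;> simp

theorem coordWedge_apply_basis {k l q : ℕ} (h : k + l = q) (μ : Fin k → Fin m) (a : Fin l → Fin n)
    (μ' : Fin k → Fin m) (a' : Fin l → Fin n) :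
    coordWedge b h μ a (fun i => Fin.append (fun i => b (Sum.inl (μ' i)))
        (fun j => b (Sum.inr (a' j))) (Fin.cast h.symm i))
      = (of fun i j => b.coord (Sum.inl (μ j)) (b (Sum.inl (μ' i)))).det
        * (of fun i j => b.coord (Sum.inr (a j)) (b (Sum.inr (a' i)))).det := by
  subst h
  rw [coordWedge, wedge_eq_wedgeForm, wedgeForm_apply, ← det_submatrix_equiv_self finSumFinEquiv,
    ← det_fromBlocks_zero₁₂ _ (0 : Matrix (Fin l) (Fin k) 𝕜)]
  congr 1
  ext i j
  rcases i with i | i <;> rcases j with j | j <;> simp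

/-- On basis vectors with the horizontal ones first the determinant splits into two blocks, so the
resolution of the identity applies to horizontal and vertical covectors separately. This gives `k!
l!` instead of `q!`. -/
theorem sum_coordWedge_apply_smul {k l q : ℕ} (h : k + l = q) (μ : Fin k → Fin m)
    (a : Fin l → Fin n) :
    ∑ μ' : Fin k → Fin m, ∑ a' : Fin l → Fin n,
      coordWedge b h μ a (fun i => Fin.append (fun i => b (Sum.inl (μ' i)))
        (fun j => b (Sum.inr (a' j))) (Fin.cast h.symm i)) • coordWedge b h μ' a'
      = (k.factorial * l.factorial : 𝕜) • coordWedge b h μ a := by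
  simp_rw [coordWedge_apply_basis]
  subst h
  ext v
  simp only [sum_apply, AlternatingMap.smul_apply, coordWedge, wedge_eq_evalForm, smul_eq_mul]
  have h1 := fun β : Fin l → V →ₗ[𝕜] 𝕜 =>
    sum_det_smul (contractRight finSumFinEquiv (evalForm v) β) (fun i => b.coord (Sum.inl (μ i)))
      (fun i : Fin m => b.coord (Sum.inl i)) (fun j k => b.coord (Sum.inl (μ j)) (b (Sum.inl k)))
      (fun i => by simp [Finsupp.single_apply])
  have h2 := fun α : Fin k → V →ₗ[𝕜] 𝕜 =>
    sum_det_smul (contractLeft finSumFinEquiv (evalForm v) α) (fun i => b.coord (Sum.inr (a i)))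
      (fun i : Fin n => b.coord (Sum.inr i)) (fun j k => b.coord (Sum.inr (a j)) (b (Sum.inr k)))
      (fun i => by simp [Finsupp.single_apply])
  simp only [contractRight_apply, contractLeft_apply, smul_eq_mul, Fintype.card_fin] at h1 h2
  simp only [mul_assoc, ← Finset.mul_sum, h2]
  simp only [mul_left_comm _ (l.factorial : 𝕜), ← Finset.mul_sum, h1]

/-- A form of pure bidegree is recovered from its values on basis vectors in the order horizontal,
then vertical. By linearity this follows from the case of a single product of coordinates. -/
theorem eq_sum_of_homogeneous {k l q : ℕ} (h : k + l = q) (hk : k ≤ m) {Φ : V [⋀^Fin q]→ₗ[𝕜] 𝕜}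
    (hΦ : ∀ (t : 𝕜) (θ : V →ₗ[𝕜] V), t ≠ 0 → IsScaling b t θ → Φ.compLinearMap θ = t ^ k • Φ) :
    ∑ μ' : Fin k → Fin m, ∑ a' : Fin l → Fin n,
      Φ (fun i => Fin.append (fun i => b (Sum.inl (μ' i)))
        (fun j => b (Sum.inr (a' j))) (Fin.cast h.symm i)) • coordWedge b h μ' a'
      = (k.factorial * l.factorial : 𝕜) • Φ := by
  refine Submodule.span_induction (p := fun Φ _ => ∑ μ' : Fin k → Fin m, ∑ a' : Fin l → Fin n,
      Φ (fun i => Fin.append (fun i => b (Sum.inl (μ' i)))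
        (fun j => b (Sum.inr (a' j))) (Fin.cast h.symm i)) • coordWedge b h μ' a'
      = (k.factorial * l.factorial : 𝕜) • Φ) ?_ ?_ ?_ ?_ (homogeneous_mem_span b h hk hΦ)
  · rintro _ ⟨μ, a, c, rfl⟩
    have h1 : tensor (coordWedge b h μ a) c = c • coordWedge b h μ a := by
      ext v; simp [mul_comm]
    rw [h1]
    simp only [AlternatingMap.smul_apply, smul_assoc, ← Finset.smul_sum,
      sum_coordWedge_apply_smul]
    rw [smul_comm]
  · simp
  · intro x y _ _ hx hy
    rw [smul_add, ← hx, ← hy]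
    simp [add_smul, Finset.sum_add_distrib]
  · intro c x _ hx
    rw [smul_comm, ← hx]
    simp [mul_smul, Finset.smul_sum]

end AlternatingForm

/-! ### Contractions of the volume form in coordinates -/

namespace AlternatingForm

open Matrix Equiv LieAlgd

section Contraction

variable {𝕜 V : Type*} [Field 𝕜] [AddCommGroup V] [Module 𝕜 V] [CharZero 𝕜]

/-- Converts a sum over the free indices of the remaining wedge factors into one over the full index
maps `ν` and `β`, of which those are the last entries. -/
theorem sum_collapse {R A B A' B' : Type*} [CommRing R] [Fintype A] [Fintype B] [Fintype A']
    [Fintype B'] [DecidableEq A'] [DecidableEq B'] (c : R) (x : A → R) (y : B → R) (f : A → A')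
    (g : B → B') (F : A' → B' → R) :
    ∑ a', ∑ b', (c * ((∑ a, x a * if f a = a' then 1 else 0)
        * ∑ b, y b * if g b = b' then 1 else 0)) * F a' b'
      = ∑ a, ∑ b, c * x a * y b * F (f a) (g b) := by
  calc _ = ∑ a', ∑ b', ∑ a, ∑ b,
        if f a = a' then if g b = b' then c * x a * y b * F a' b' else 0 else 0 := by
        refine Finset.sum_congr rfl fun a' _ => Finset.sum_congr rfl fun b' _ => ?_
        rw [Finset.sum_mul_sum, Finset.mul_sum, Finset.sum_mul]
        refine Finset.sum_congr rfl fun a _ => ?_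
        rw [Finset.mul_sum, Finset.sum_mul]
        refine Finset.sum_congr rfl fun b _ => ?_
        split_ifs <;> ring
    _ = ∑ a, ∑ b, ∑ a', ∑ b',
        if f a = a' then if g b = b' then c * x a * y b * F a' b' else 0 else 0 := by
        rw [Finset.sum_congr rfl fun a' _ => Finset.sum_comm, Finset.sum_comm]
        refine Finset.sum_congr rfl fun a _ => ?_
        rw [Finset.sum_congr rfl fun a' _ => Finset.sum_comm, Finset.sum_comm]
    _ = _ := by
        refine Finset.sum_congr rfl fun a _ => Finset.sum_congr rfl fun b _ => ?_
        rw [Finset.sum_comm]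
        simp

/-- The value of the volume form on vectors of which the last `k` are basis vectors. -/
theorem det_append_basis {r k : ℕ} (X : Fin (r + k) → V →ₗ[𝕜] 𝕜) (b : Fin (r + k) → V)
    (hX : ∀ i j, X i (b j) = if i = j then 1 else 0) (u : Fin r → V) (ν' : Fin k → Fin (r + k)) :
    (of fun i j => X j (Fin.append u (fun i => b (ν' i)) i)).det
      = ∑ ν : Fin (r + k) → Fin (r + k), (leviCivita ν : 𝕜) * (∏ i : Fin r,
          X (ν (Fin.castAdd k i)) (u i)) * if (fun j => ν (Fin.natAdd r j)) = ν' then 1 else 0 := by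
  rw [det_eq_sum_leviCivita]
  refine Finset.sum_congr rfl fun ν _ => ?_
  rw [Fin.prod_univ_add, ← mul_assoc]
  congr 1
  · simp
  · simp only [of_apply, Fin.append_right, hX]
    rw [Finset.prod_ite_zero]
    simp [funext_iff]

variable {r s k l : ℕ} (b : Module.Basis (Fin (r + k) ⊕ Fin (s + l)) 𝕜 V)

/-- Once the two middle blocks are exchanged, all horizontal vectors precede all others and have no
vertical coordinates. The matrix is then block triangular and the determinant factors. -/
theorem wedgeForm_coord_append (h : (r + s) + (k + l) = (r + k) + (s + l)) {u : Fin r → V}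
    {t : Fin s → V} {u' : Fin k → V} {t' : Fin l → V} (hu : ∀ i a, b.coord (Sum.inr a) (u i) = 0)
    (hu' : ∀ i a, b.coord (Sum.inr a) (u' i) = 0) :
    wedgeForm b.coord (Sum.elim (Fin.append u t) (Fin.append u' t') ∘ (blockEquiv h).symm)
      = (-1) ^ (s * k) * ((of fun i j => b.coord (Sum.inl j) (Fin.append u u' i)).det
        * (of fun i j => b.coord (Sum.inr j) (Fin.append t t' i)).det) := by
  rw [append_middleSwap, AlternatingMap.map_perm, sign_middleSwap, Units.smul_def,
    ← Int.cast_smul_eq_zsmul 𝕜, smul_eq_mul, wedgeForm_apply]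
  congr 1
  · simp
  · rw [← det_fromBlocks_zero₁₂ _
      (of fun i j => b.coord (Sum.inl j) (Fin.append t t' i))]
    congr 1
    ext i j
    rcases i with i | i <;> rcases j with j | j <;> try rfl
    simp only [of_apply, Sum.elim_inl, fromBlocks_apply₁₂, Matrix.zero_apply]
    refine Fin.addCases (fun i => ?_) (fun i => ?_) i
    · simpa using hu i j
    · simpa using hu' i j

/-- The contraction has pure bidegree `(k, l)`, hence is given by its values on basis vectors, which
factor into two determinants expanded with Levi-Civita symbols. The dimensions are written as `r +
k` and `s + l` so that index maps split without casts. -/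
theorem contractLeft_eq_sum_aux (h : (r + s) + (k + l) = (r + k) + (s + l)) {u : Fin r → V}
    {t : Fin s → V} (hu : ∀ i a, b.coord (Sum.inr a) (u i) = 0)
    (ht : ∀ i μ, b.coord (Sum.inl μ) (t i) = 0) :
    (k.factorial * l.factorial : 𝕜)
        • contractLeft (blockEquiv h) (wedgeForm b.coord) (Fin.append u t)
      = ∑ ν : Fin (r + k) → Fin (r + k), ∑ β : Fin (s + l) → Fin (s + l),
        ((-1) ^ (s * k) * (leviCivita ν : 𝕜) * (leviCivita β : 𝕜)
          * (∏ i : Fin r, b.coord (Sum.inl (ν (Fin.castAdd k i))) (u i))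
          * (∏ j : Fin s, b.coord (Sum.inr (β (Fin.castAdd l j))) (t j)))
        • coordWedge b rfl (fun i => ν (Fin.natAdd r i)) (fun j => β (Fin.natAdd s j)) := by
  have h1 := eq_sum_of_homogeneous b (rfl : k + l = k + l) (Nat.le_add_left k r)
    (Φ := contractLeft (blockEquiv h) (wedgeForm b.coord) (Fin.append u t))
    fun τ θ hτ hθ => contractLeft_scaling hθ hτ rfl rfl h hu ht
  rw [← h1]
  have hX : ∀ i j, b.coord (Sum.inl i) (b (Sum.inl j)) = if i = j then 1 else 0 := by
    intro i j; simp [Finsupp.single_apply, eq_comm]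
  have hY : ∀ i j, b.coord (Sum.inr i) (b (Sum.inr j)) = if i = j then 1 else 0 := by
    intro i j; simp [Finsupp.single_apply, eq_comm]
  have h2 : ∀ (μ' : Fin k → Fin (r + k)) (a' : Fin l → Fin (s + l)),
      contractLeft (blockEquiv h) (wedgeForm b.coord) (Fin.append u t)
        (fun i => Fin.append (fun i => b (Sum.inl (μ' i))) (fun j => b (Sum.inr (a' j)))
          (Fin.cast rfl i))
      = (-1) ^ (s * k) * ((∑ ν : Fin (r + k) → Fin (r + k), (leviCivita ν : 𝕜) * (∏ i : Fin r,
          b.coord (Sum.inl (ν (Fin.castAdd k i))) (u i))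
            * if (fun j => ν (Fin.natAdd r j)) = μ' then 1 else 0)
        * ∑ β : Fin (s + l) → Fin (s + l), (leviCivita β : 𝕜) * (∏ i : Fin s,
          b.coord (Sum.inr (β (Fin.castAdd l i))) (t i))
            * if (fun j => β (Fin.natAdd s j)) = a' then 1 else 0) := by
    intro μ' a'
    rw [contractLeft_apply]
    simp only [Fin.cast_eq_self]
    rw [wedgeForm_coord_append b h hu (by intro i a; simp),
      det_append_basis (fun i => b.coord (Sum.inl i)) (fun i => b (Sum.inl i)) hX,
      det_append_basis (fun i => b.coord (Sum.inr i)) (fun i => b (Sum.inr i)) hY]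
  simp only [h2]
  ext v
  simp only [sum_apply, AlternatingMap.smul_apply, smul_eq_mul]
  rw [sum_collapse]
  exact Finset.sum_congr rfl fun ν _ => Finset.sum_congr rfl fun β _ => by ring

/-- The contraction of the volume form with horizontal and vertical vectors, in coordinates. -/
theorem contractLeft_eq_sum {m n r s k l p q : ℕ} (b : Module.Basis (Fin m ⊕ Fin n) 𝕜 V)
    (hm : r + k = m) (hn : s + l = n) (hp : r + s = p) (hq : k + l = q) (h : p + q = m + n)
    {u : Fin r → V} {t : Fin s → V} (hu : ∀ i a, b.coord (Sum.inr a) (u i) = 0)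
    (ht : ∀ i μ, b.coord (Sum.inl μ) (t i) = 0) :
    (k.factorial * l.factorial : 𝕜) • contractLeft (blockEquiv h) (wedgeForm b.coord)
        (fun i => Fin.append u t (Fin.cast hp.symm i))
      = ∑ ν : Fin m → Fin m, ∑ β : Fin n → Fin n,
        ((-1) ^ (s * k) * (leviCivita ν : 𝕜) * (leviCivita β : 𝕜)
          * (∏ i : Fin r, b.coord (Sum.inl (ν (Fin.castLE (by omega) i))) (u i))
          * (∏ j : Fin s, b.coord (Sum.inr (β (Fin.castLE (by omega) j))) (t j)))
        • wedge hq (fun i => b.coord (Sum.inl (ν ⟨r + i, by omega⟩)))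
            (fun j => b.coord (Sum.inr (β ⟨s + j, by omega⟩))) := by
  subst hm hn hp hq
  exact contractLeft_eq_sum_aux b h hu ht

end Contraction

end AlternatingForm

/-! ### The Hodge operator of a block diagonal metric -/

namespace AlternatingForm

open Matrix Equiv LieAlgd

section Hodge

variable {𝕜 V W : Type*} [Field 𝕜] [AddCommGroup V] [Module 𝕜 V] [CharZero 𝕜]
  [AddCommGroup W] [Module 𝕜 W] {m n : ℕ} (b : Module.Basis (Fin m ⊕ Fin n) 𝕜 V)

/-- The block diagonal matrix of the metric of a Lie algebroid in a mixed basis. -/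
abbrev blockMatrix (g : Matrix (Fin m) (Fin m) 𝕜) (h : Matrix (Fin n) (Fin n) 𝕜) :
    Matrix (Fin m ⊕ Fin n) (Fin m ⊕ Fin n) 𝕜 := fromBlocks g 0 0 h

theorem blockMatrix_inv {g : Matrix (Fin m) (Fin m) 𝕜} {h : Matrix (Fin n) (Fin n) 𝕜}
    (hg : g.det ≠ 0) (hh : h.det ≠ 0) : (blockMatrix g h)⁻¹ = blockMatrix g⁻¹ h⁻¹ := by
  refine Matrix.inv_eq_right_inv ?_
  rw [fromBlocks_multiply, mul_nonsing_inv _ (isUnit_iff_ne_zero.2 hg),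
    mul_nonsing_inv _ (isUnit_iff_ne_zero.2 hh)]
  simp

theorem det_blockMatrix (g : Matrix (Fin m) (Fin m) 𝕜) (h : Matrix (Fin n) (Fin n) 𝕜) :
    (blockMatrix g h).det = g.det * h.det := det_fromBlocks_zero₂₁ _ _ _

section Sharp

variable {g : Matrix (Fin m) (Fin m) 𝕜} {h : Matrix (Fin n) (Fin n) 𝕜}
  (hg : g.det ≠ 0) (hh : h.det ≠ 0)
include hg hh

/-- As the inverse matrix is block diagonal too, $\sharp$ respects the splitting into horizontal and
vertical parts. This makes the contractions in the Hodge operator bihomogeneous. -/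
theorem inr_sharp_inl (μ : Fin m) (a : Fin n) :
    b.coord (Sum.inr a) (sharp b (blockMatrix g h) (b.coord (Sum.inl μ))) = 0 := by
  rw [coord_sharp, blockMatrix_inv hg hh]; simp

theorem inl_sharp_inr (μ : Fin m) (a : Fin n) :
    b.coord (Sum.inl μ) (sharp b (blockMatrix g h) (b.coord (Sum.inr a))) = 0 := by
  rw [coord_sharp, blockMatrix_inv hg hh]; simp

theorem inl_sharp_inl (μ ν : Fin m) :
    b.coord (Sum.inl ν) (sharp b (blockMatrix g h) (b.coord (Sum.inl μ))) = g⁻¹ μ ν := by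
  rw [coord_sharp, blockMatrix_inv hg hh]; simp [Finsupp.single_apply]

theorem inr_sharp_inr (a c : Fin n) :
    b.coord (Sum.inr c) (sharp b (blockMatrix g h) (b.coord (Sum.inr a))) = h⁻¹ a c := by
  rw [coord_sharp, blockMatrix_inv hg hh]; simp [Finsupp.single_apply]

end Sharp

/-- The normalization of the Hodge operator in bidegree `(r, p - r)`. -/
def hodgeWeight (𝕜 : Type*) [Field 𝕜] (m n p r : ℕ) : 𝕜 :=
  ((m - r).factorial * (n - (p - r)).factorial : 𝕜) / (r.factorial * (p - r).factorial : 𝕜)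

theorem contractLeft_smul {κ κ' J : Type*} (e : κ ⊕ κ' ≃ J) (ρ : 𝕜) (Φ : V [⋀^J]→ₗ[𝕜] W)
    (u : κ → V) : contractLeft e (ρ • Φ) u = ρ • contractLeft e Φ u := rfl

theorem dualize_coordWedge {r s p q : ℕ} (hrs : r + s = p) (hpq : p + q = m + n) (ρ : 𝕜)
    (γ : Matrix (Fin m ⊕ Fin n) (Fin m ⊕ Fin n) 𝕜) (μ : Fin r → Fin m) (a : Fin s → Fin n) (c : W) :
    dualize b (blockEquiv hpq) (sharp b γ) (ρ • wedgeForm b.coord) (tensor (coordWedge b hrs μ a) c)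
      = tensor (ρ • contractLeft (blockEquiv hpq) (wedgeForm b.coord) (fun i =>
          Fin.append (fun i => sharp b γ (b.coord (Sum.inl (μ i))))
            (fun j => sharp b γ (b.coord (Sum.inr (a j)))) (Fin.cast hrs.symm i))) c := by
  rw [coordWedge, wedge_eq_wedgeForm, dualize_wedgeForm, contractLeft_smul]
  congr 3
  funext i
  generalize Fin.cast hrs.symm i = j
  refine Fin.addCases (fun j => ?_) (fun j => ?_) j <;> simp

/-- On a product of bidegree $(r,s)$ each grading operator acts as a scalar, since dualization sends
bidegree $(r,s)$ to $(m-r,n-s)$. The two scalars are inverse to each other and only the double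
dualization is left. -/
theorem dualize_gradeOp_dualize_gradeOp {g : Matrix (Fin m) (Fin m) 𝕜}
    {h : Matrix (Fin n) (Fin n) 𝕜} (hg : g.det ≠ 0) (hh : h.det ≠ 0) (hgs : g.IsSymm)
    (hhs : h.IsSymm) (ρ : 𝕜) {p q : ℕ} (hpq : p + q = m + n) (hqp : q + p = m + n)
    {κ κ' : Fin (m + 1) → 𝕜} {θ : Fin (m + 1) → V →ₗ[𝕜] V}
    (hκ : ∀ r, r ≤ m → ∑ j, κ j * ((j : 𝕜) + 1) ^ r = hodgeWeight 𝕜 m n p r)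
    (hκ' : ∀ r, r ≤ m → ∑ j, κ' j * ((j : 𝕜) + 1) ^ r = hodgeWeight 𝕜 m n q r)
    (hθ : ∀ j : Fin (m + 1), IsScaling b ((j : 𝕜) + 1) (θ j)) (w : V [⋀^Fin p]→ₗ[𝕜] W) :
    dualize b (blockEquiv hqp) (sharp b (blockMatrix g h)) (ρ • wedgeForm b.coord) (gradeOp κ' θ
      (dualize b (blockEquiv hpq) (sharp b (blockMatrix g h)) (ρ • wedgeForm b.coord)
        (gradeOp κ θ w)))
      = ((-1) ^ (q * p) * (ρ * ρ * (g.det * h.det)⁻¹)) • w := by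
  refine Submodule.span_induction (p := fun w _ => dualize b (blockEquiv hqp)
    (sharp b (blockMatrix g h)) (ρ • wedgeForm b.coord) (gradeOp κ' θ
      (dualize b (blockEquiv hpq) (sharp b (blockMatrix g h)) (ρ • wedgeForm b.coord)
        (gradeOp κ θ w)))
      = ((-1) ^ (q * p) * (ρ * ρ * (g.det * h.det)⁻¹)) • w) ?_ ?_ ?_ ?_ (mem_span_coordWedge b w)
  · rintro _ ⟨r, s, hrs, hr, hs, μ, a, c, rfl⟩
    rw [gradeOp_tensor_coordWedge hθ (hκ r hr), map_smul, map_smul, map_smul]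
    have h1 : gradeOp κ' θ (dualize b (blockEquiv hpq) (sharp b (blockMatrix g h))
        (ρ • wedgeForm b.coord) (tensor (coordWedge b hrs μ a) c))
        = hodgeWeight 𝕜 m n q (m - r) • dualize b (blockEquiv hpq) (sharp b (blockMatrix g h))
        (ρ • wedgeForm b.coord) (tensor (coordWedge b hrs μ a) c) := by
      refine gradeOp_of_homogeneous (hκ' (m - r) (Nat.sub_le _ _)) fun j => ?_
      rw [dualize_coordWedge]
      have h2 := contractLeft_scaling (hθ j) (Nat.cast_add_one_ne_zero _)
        (show r + (m - r) = m by omega) hrs hpq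
        (fun i a => inr_sharp_inl b hg hh (μ i) a) (fun i μ => inl_sharp_inr b hg hh μ (a i))
      ext v
      have h3 := congrArg (fun η : V [⋀^Fin q]→ₗ[𝕜] 𝕜 => η v) h2
      simp only [AlternatingMap.compLinearMap_apply, AlternatingMap.smul_apply,
        smul_eq_mul] at h3
      simp only [AlternatingMap.compLinearMap_apply, AlternatingMap.smul_apply, tensor_apply,
        smul_eq_mul, h3, smul_smul]
      congr 1
      ring
    have hγs : (blockMatrix g h).IsSymm := hgs.fromBlocks (by simp) hhs
    have hγ : (blockMatrix g h).det ≠ 0 := by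
      rw [det_blockMatrix]; exact mul_ne_zero hg hh
    rw [h1, map_smul, dualize_dualize b hγs hγ, sign_blockEquiv_comm, smul_smul, smul_smul,
      det_blockMatrix]
    congr 1
    -- Passing to the complementary bidegree exchanges $r!\,s!$ with $(m-r)!\,(n-s)!$.
    have h4 : hodgeWeight 𝕜 m n p r * hodgeWeight 𝕜 m n q (m - r) = 1 := by
      have e1 : p - r = s := by omega
      have e2 : m - (m - r) = r := by omega
      have e3 : q - (m - r) = n - s := by omega
      have e4 : n - (n - s) = s := by omega
      rw [hodgeWeight, hodgeWeight, e1, e2, e3, e4]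
      have hf : ∀ i : ℕ, (i.factorial : 𝕜) ≠ 0 :=
        fun i => Nat.cast_ne_zero.2 (Nat.factorial_ne_zero i)
      have := hf r
      have := hf s
      have := hf (m - r)
      have := hf (n - s)
      field_simp
    rw [h4]
    simp
  · simp
  · intro x y _ _ hx hy
    simp only [map_add, hx, hy, smul_add]
  · intro c x _ hx
    simp only [map_smul, hx]
    rw [smul_comm]

end Hodge

/-! ### The local formula as a rescaling followed by dualization -/

section HodgeFormula

variable {𝕜 V 𝔤 : Type*} [RCLike 𝕜] [AddCommGroup V] [Module 𝕜 V] [LieRing 𝔤] [LieAlgebra 𝕜 𝔤]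
  {m n : ℕ} (b : Module.Basis (Fin m ⊕ Fin n) 𝕜 V)

theorem expansion_add (X : Fin m → V →ₗ[𝕜] 𝕜) (Λ : Fin n → V →ₗ[𝕜] 𝕜) (p : ℕ)
    (c c' : Components m n 𝔤) : expansion X Λ p (fun r s μ a => c r s μ a + c' r s μ a)
      = expansion X Λ p c + expansion X Λ p c' := by
  simp only [expansion, ← Finset.sum_add_distrib]
  refine Finset.sum_congr rfl fun r _ => Finset.sum_congr rfl fun s _ => ?_
  split_ifs with h
  · simp only [← Finset.sum_add_distrib]
    refine Finset.sum_congr rfl fun μ _ => Finset.sum_congr rfl fun a _ => ?_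
    ext v
    simp [formSmul_eq_tensor]
  · simp

theorem expansion_smul (X : Fin m → V →ₗ[𝕜] 𝕜) (Λ : Fin n → V →ₗ[𝕜] 𝕜) (p : ℕ) (t : 𝕜)
    (c : Components m n 𝔤) : expansion X Λ p (fun r s μ a => t • c r s μ a)
      = t • expansion X Λ p c := by
  simp only [expansion, Finset.smul_sum]
  refine Finset.sum_congr rfl fun r _ => Finset.sum_congr rfl fun s _ => ?_
  split_ifs with h
  · simp only [Finset.smul_sum]
    refine Finset.sum_congr rfl fun μ _ => Finset.sum_congr rfl fun a _ => ?_
    ext v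
    simp [formSmul_eq_tensor, smul_comm t]
  · simp

open Classical in
theorem exists_expansion {p : ℕ} (w : V [⋀^Fin p]→ₗ[𝕜] 𝔤) : ∃ c : Components m n 𝔤,
    w = expansion (fun μ => b.coord (Sum.inl μ)) (fun a => b.coord (Sum.inr a)) p c := by
  refine Submodule.span_induction (p := fun w _ => ∃ c : Components m n 𝔤,
    w = expansion (fun μ => b.coord (Sum.inl μ)) (fun a => b.coord (Sum.inr a)) p c)
    ?_ ?_ ?_ ?_ (mem_span_coordWedge b w)
  · rintro _ ⟨r, s, hrs, hr, hs, μ, a, c, rfl⟩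
    -- All components vanish but one. Sigma types allow the comparison of index families whose
    -- lengths `r'` and `s'` vary.
    refine ⟨fun r' s' μ' a' => if (⟨r', μ'⟩ : Σ r, Fin r → Fin m) = ⟨r, μ⟩ ∧
      (⟨s', a'⟩ : Σ s, Fin s → Fin n) = ⟨s, a⟩ then c else 0, ?_⟩
    rw [expansion, Finset.sum_eq_single (⟨r, by omega⟩ : Fin (m + 1)),
      Finset.sum_eq_single (⟨s, by omega⟩ : Fin (n + 1)), dif_pos hrs,
      Finset.sum_eq_single μ, Finset.sum_eq_single a]
    · simp [formSmul_eq_tensor, coordWedge]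
    · intro a' _ ha'
      have : ¬ (⟨s, a'⟩ : Σ s, Fin s → Fin n) = ⟨s, a⟩ := by simpa using ha'
      ext v
      simp [formSmul_eq_tensor, ha']
    · simp
    · intro μ' _ hμ'
      refine Finset.sum_eq_zero fun a' _ => ?_
      ext v
      simp [formSmul_eq_tensor, hμ']
    · simp
    · intro s' _ hs'
      rw [dif_neg]
      intro h
      exact hs' (Fin.ext (by simp at h ⊢; omega))
    · simp
    · intro r' _ hr'
      refine Finset.sum_eq_zero fun s' _ => ?_
      split_ifs with h
      · refine Finset.sum_eq_zero fun μ' _ => Finset.sum_eq_zero fun a' _ => ?_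
        have : ¬ (⟨r', μ'⟩ : Σ r, Fin r → Fin m) = ⟨r, μ⟩ := by
          intro he
          exact hr' (Fin.ext (congrArg Sigma.fst he))
        ext v
        simp only [formSmul_eq_tensor, tensor_apply, this, false_and, if_false, smul_zero,
          AlternatingMap.zero_apply]
      · rfl
    · simp
  -- Zero is written as a multiple so that homogeneity of the expansion in its components yields the
  -- zero form.
  · refine ⟨fun _ _ _ _ => (0 : 𝕜) • 0, ?_⟩
    rw [expansion_smul (c := fun _ _ _ _ => 0), zero_smul]
  · rintro x y _ _ ⟨c, rfl⟩ ⟨c', rfl⟩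
    exact ⟨_, (expansion_add _ _ _ _ _).symm⟩
  · rintro t x _ ⟨c, rfl⟩
    exact ⟨_, (expansion_smul _ _ _ _ _).symm⟩

/-- The local formula is the composition of the rescaling of the bidegrees with the dualization. -/
theorem hodgeFormula_eq {g : Matrix (Fin m) (Fin m) 𝕜} {h : Matrix (Fin n) (Fin n) 𝕜}
    (hg : g.det ≠ 0) (hh : h.det ≠ 0) {p q : ℕ} (hpq : p + q = m + n) {κ : Fin (m + 1) → 𝕜}
    {θ : Fin (m + 1) → V →ₗ[𝕜] V}
    (hκ : ∀ r, r ≤ m → ∑ j, κ j * ((j : 𝕜) + 1) ^ r = hodgeWeight 𝕜 m n p r)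
    (hθ : ∀ j : Fin (m + 1), IsScaling b ((j : 𝕜) + 1) (θ j)) (c : Components m n 𝔤) :
    hodgeFormula (fun μ => b.coord (Sum.inl μ)) (fun a => b.coord (Sum.inr a)) g h p q hpq c
      = dualize b (blockEquiv hpq) (sharp b (blockMatrix g h))
        ((((Real.sqrt ‖h.det‖ : ℝ) : 𝕜) * ((Real.sqrt ‖g.det‖ : ℝ) : 𝕜)) • wedgeForm b.coord)
        (gradeOp κ θ (expansion (fun μ => b.coord (Sum.inl μ)) (fun a => b.coord (Sum.inr a))
          p c)) := by
  simp only [hodgeFormula, expansion, map_sum]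
  refine Finset.sum_congr rfl fun r _ => Finset.sum_congr rfl fun s _ => ?_
  by_cases hrs : (r : ℕ) + (s : ℕ) = p
  · rw [dif_pos hrs, dif_pos hrs]
    simp only [map_sum]
    refine Finset.sum_congr rfl fun μ _ => Finset.sum_congr rfl fun a _ => ?_
    rw [formSmul_eq_tensor]
    have hr : (r : ℕ) ≤ m := r.is_le
    have hs : (s : ℕ) ≤ n := s.is_le
    have h1 := gradeOp_tensor_coordWedge hθ (hκ r hr) hrs μ a (c r s μ a)
    rw [coordWedge] at h1
    rw [h1, map_smul]
    change _ = _ • dualize b _ _ _ (tensor (coordWedge b hrs μ a) _)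
    rw [dualize_coordWedge]
    have h2 := contractLeft_eq_sum b (show (r : ℕ) + (m - r) = m by omega)
      (show (s : ℕ) + (n - s) = n by omega) hrs (show (m - r) + (n - s) = q by omega) hpq
      (fun i a => inr_sharp_inl b hg hh (μ i) a) (fun i μ => inl_sharp_inr b hg hh μ (a i))
    ext v
    have h3 := congrArg (fun η : V [⋀^Fin q]→ₗ[𝕜] 𝕜 => η v) h2
    simp only [sum_apply, AlternatingMap.smul_apply, smul_eq_mul, inl_sharp_inl b hg hh,
      inr_sharp_inr b hg hh] at h3
    simp only [sum_apply, AlternatingMap.smul_apply, tensor_apply, formSmul_eq_tensor,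
      smul_eq_mul, smul_smul, ← Finset.sum_smul]
    congr 1
    have e1 : p - (r : ℕ) = s := by omega
    rw [hodgeWeight, e1]
    set A := contractLeft (blockEquiv hpq) (wedgeForm b.coord) _ v
    have hf : ∀ i : ℕ, (i.factorial : 𝕜) ≠ 0 :=
      fun i => Nat.cast_ne_zero.2 (Nat.factorial_ne_zero i)
    -- The unrestricted Levi-Civita sum is $(m-r)!(n-s)!$ times the contraction `A`. With the
    -- prefactor $1/(r!s!)$ of the formula this gives precisely the Hodge weight.
    calc _ = (1 / ((r : ℕ).factorial * (s : ℕ).factorial : 𝕜)) * (((Real.sqrt ‖h.det‖ : ℝ) : 𝕜)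
          * ((Real.sqrt ‖g.det‖ : ℝ) : 𝕜)) *
          (((m - (r : ℕ)).factorial * (n - (s : ℕ)).factorial : 𝕜) * A) := by
          rw [h3]
          simp only [Finset.mul_sum]
          exact Finset.sum_congr rfl fun ν _ => Finset.sum_congr rfl fun β _ => by ring
      _ = _ := by ring
  · rw [dif_neg hrs, dif_neg hrs, map_zero, map_zero]

end HodgeFormula

end AlternatingForm

/-! ## Hadamard's lemma -/

namespace Hadamard

open MeasureTheory Set

universe v

variable {E : Type} [NormedAddCommGroup E] [NormedSpace ℝ E] [FiniteDimensional ℝ E]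

theorem hasFDerivAt_intervalIntegral {F : Type v} [NormedAddCommGroup F] [NormedSpace ℝ F]
    [CompleteSpace F] {f : E → ℝ → F} (hf : ContDiff ℝ ∞ (Function.uncurry f)) (x : E) :
    HasFDerivAt (fun x => ∫ t in (0 : ℝ)..1, f x t)
      (∫ t in (0 : ℝ)..1, fderiv ℝ (fun y => f y t) x) x := by
  have hd : ∀ y t, HasFDerivAt (fun y => f y t) (fderiv ℝ (fun y => f y t) y) y := by
    intro y t
    have : ContDiff ℝ ∞ fun y => f y t := hf.comp (contDiff_id.prodMk contDiff_const)
    exact (this.differentiable (by simp) y).hasFDerivAt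
  have hc : Continuous (Function.uncurry fun y t => fderiv ℝ (fun y => f y t) y) := by
    have : ContDiff ℝ ∞ fun q : E × ℝ => fderiv ℝ (fun y => f y q.2) q.1 :=
      ContDiff.fderiv (m := ∞) (n := ∞)
        (hf.comp (contDiff_snd.prodMk (contDiff_snd.comp contDiff_fst))) contDiff_fst (by simp)
    exact this.continuous
  have hfc : ∀ y, Continuous (f y) := fun y =>
    hf.continuous.comp (continuous_const.prodMk continuous_id)
  have hdc : ∀ y, Continuous fun t => fderiv ℝ (fun y => f y t) y := fun y =>
    hc.comp (continuous_const.prodMk continuous_id)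
  -- A constant bound for the derivative on this compact set dominates the differentiation under the
  -- integral.
  have hK : IsCompact (Metric.closedBall x 1 ×ˢ Icc (0 : ℝ) 1) :=
    (isCompact_closedBall x 1).prod isCompact_Icc
  obtain ⟨C, hC⟩ := hK.exists_bound_of_continuousOn hc.continuousOn
  refine intervalIntegral.hasFDerivAt_integral_of_dominated_of_fderiv_le (bound := fun _ => C)
    (Metric.closedBall_mem_nhds x one_pos)
    (Filter.Eventually.of_forall fun y => (hfc y).aestronglyMeasurable)
    ((hfc x).intervalIntegrable _ _) ((hdc x).aestronglyMeasurable) ?_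
    (by simp) (Filter.Eventually.of_forall fun t _ y _ => hd y t)
  refine Filter.Eventually.of_forall fun t ht y hy => hC (y, t) ⟨hy, ?_⟩
  rw [uIoc_of_le zero_le_one] at ht
  exact ⟨ht.1.le, ht.2⟩

/-- The derivative is an integral of the same kind with values in `E →L[ℝ] F`, so the induction on
`k` runs over all targets. Since `E` lives in `Type`, this new target stays in the universe of `F`.
-/
theorem contDiff_intervalIntegral_nat (k : ℕ) : ∀ {F : Type v} [NormedAddCommGroup F]
    [NormedSpace ℝ F] [CompleteSpace F] {f : E → ℝ → F},
    ContDiff ℝ ∞ (Function.uncurry f) → ContDiff ℝ k fun x => ∫ t in (0 : ℝ)..1, f x t := by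
  induction k with
  | zero =>
    intro F _ _ _ f hf
    have : Continuous fun x => ∫ t in (0 : ℝ)..1, f x t :=
      intervalIntegral.continuous_parametric_intervalIntegral_of_continuous' hf.continuous 0 1
    rw [Nat.cast_zero, contDiff_zero]
    exact this
  | succ k ih =>
    intro F _ _ _ f hf
    rw [Nat.cast_add, Nat.cast_one, contDiff_succ_iff_hasFDerivAt]
    refine ⟨fun x => ∫ t in (0 : ℝ)..1, fderiv ℝ (fun y => f y t) x, ih ?_,
      fun x => hasFDerivAt_intervalIntegral hf x⟩
    exact ContDiff.fderiv (m := ∞) (n := ∞)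
        (hf.comp (contDiff_snd.prodMk (contDiff_snd.comp contDiff_fst))) contDiff_fst (by simp)

theorem contDiff_intervalIntegral {F : Type v} [NormedAddCommGroup F]
    [NormedSpace ℝ F] [CompleteSpace F] {f : E → ℝ → F}
    (hf : ContDiff ℝ ∞ (Function.uncurry f)) :
    ContDiff ℝ ∞ fun x => ∫ t in (0 : ℝ)..1, f x t :=
  contDiff_infty.2 fun k => contDiff_intervalIntegral_nat k hf

/-- The fundamental theorem of calculus along the segment from `x` to `y`; `H y` is the mean of the
derivative over this segment. -/
theorem exists_hadamard {E : Type} [NormedAddCommGroup E] [NormedSpace ℝ E]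
    [FiniteDimensional ℝ E] {F : Type v} [NormedAddCommGroup F] [NormedSpace ℝ F]
    [CompleteSpace F] {f : E → F} (hf : ContDiff ℝ ∞ f) (x : E) :
    ∃ H : E → E →L[ℝ] F, ContDiff ℝ ∞ H ∧ H x = fderiv ℝ f x ∧
      ∀ y, f y = f x + H y (y - x) := by
  have hd : ContDiff ℝ ∞ (fderiv ℝ f) := hf.fderiv_right (by simp)
  have hl : ContDiff ℝ ∞ fun q : E × ℝ => x + q.2 • (q.1 - x) :=
    contDiff_const.add (contDiff_snd.smul (contDiff_fst.sub contDiff_const))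
  refine ⟨fun y => ∫ t in (0 : ℝ)..1, fderiv ℝ f (x + t • (y - x)),
    contDiff_intervalIntegral (hd.comp hl), by simp, fun y => ?_⟩
  have hc : Continuous fun t : ℝ => fderiv ℝ f (x + t • (y - x)) :=
    hd.continuous.comp (by fun_prop)
  rw [ContinuousLinearMap.intervalIntegral_apply (hc.intervalIntegrable _ _)]
  have h1 : ∀ t ∈ uIcc (0 : ℝ) 1, HasDerivAt (fun t : ℝ => f (x + t • (y - x)))
      (fderiv ℝ f (x + t • (y - x)) (y - x)) t := by
    intro t _
    have h2 : HasDerivAt (fun t : ℝ => x + t • (y - x)) (y - x) t := by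
      simpa using ((hasDerivAt_id t).smul_const (y - x)).const_add x
    exact ((hf.differentiable (by simp) _).hasFDerivAt).comp_hasDerivAt t h2
  rw [intervalIntegral.integral_eq_sub_of_hasDerivAt h1
    ((hc.clm_apply continuous_const).intervalIntegrable _ _)]
  simp

end Hadamard

/-! ## Smooth functions and derivations -/

namespace SmoothGerm

open LieAlgd Set Filter

variable {m : ℕ} {M 𝕜 : Type*} [RCLike 𝕜] [TopologicalSpace M] [T2Space M]
  [ChartedSpace (EuclideanSpace ℝ (Fin m)) M] [IsManifold (𝓡 m) ∞ M]

theorem contMDiff_ofReal_comp {u : M → ℝ} (hu : ContMDiff (𝓡 m) 𝓘(ℝ, ℝ) ∞ u) :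
    ContMDiff (𝓡 m) 𝓘(ℝ, 𝕜) ∞ fun y => ((u y : ℝ) : 𝕜) :=
  ((RCLike.ofRealCLM (K := 𝕜)).contDiff.contMDiff).comp hu

theorem contMDiffOn_ofReal_comp {u : M → ℝ} {O : Set M} (hu : ContMDiffOn (𝓡 m) 𝓘(ℝ, ℝ) ∞ u O) :
    ContMDiffOn (𝓡 m) 𝓘(ℝ, 𝕜) ∞ (fun y => ((u y : ℝ) : 𝕜)) O :=
  ((RCLike.ofRealCLM (K := 𝕜)).contDiff.contMDiff).comp_contMDiffOn hu

variable (m 𝕜) in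
theorem exists_bump (x : M) {s : Set M} (hs : s ∈ 𝓝 x) :
    ∃ ψ : SmoothFun m M 𝕜, (∀ᶠ y in 𝓝 x, ψ y = 1) ∧ tsupport ψ ⊆ s := by
  obtain ⟨f, -, hf⟩ := (SmoothBumpFunction.nhds_basis_tsupport (I := 𝓡 m) x).mem_iff.1 hs
  refine ⟨⟨fun y => ((f y : ℝ) : 𝕜), contMDiff_ofReal_comp f.contMDiff⟩, ?_, ?_⟩
  · filter_upwards [f.eventuallyEq_one] with y hy
    change ((f y : ℝ) : 𝕜) = 1
    rw [hy]
    simp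
  · refine (closure_mono ?_).trans hf
    intro y hy
    rw [Function.mem_support] at hy ⊢
    intro h0
    exact hy (by change ((f y : ℝ) : 𝕜) = 0; rw [h0]; simp)

theorem contMDiff_mul_of_tsupport {ψ : SmoothFun m M 𝕜} {O : Set M} (hO : IsOpen O)
    (hψ : tsupport ψ ⊆ O) {u : M → 𝕜} (hu : ContMDiffOn (𝓡 m) 𝓘(ℝ, 𝕜) ∞ u O) :
    ContMDiff (𝓡 m) 𝓘(ℝ, 𝕜) ∞ fun y => ψ y * u y := by
  refine contMDiff_of_tsupport fun y hy => ?_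
  have hyO : y ∈ O := hψ (tsupport_mul_subset_left hy)
  exact (ψ.contMDiff y).mul ((hu y hyO).contMDiffAt (hO.mem_nhds hyO))

theorem exists_smoothFun_eventuallyEq {O : Set M} (hO : IsOpen O) {x : M} (hx : x ∈ O) {u : M → 𝕜}
    (hu : ContMDiffOn (𝓡 m) 𝓘(ℝ, 𝕜) ∞ u O) :
    ∃ f : SmoothFun m M 𝕜, ∀ᶠ y in 𝓝 x, f y = u y := by
  obtain ⟨ψ, h1, h2⟩ := exists_bump m 𝕜 x (hO.mem_nhds hx)
  refine ⟨⟨_, contMDiff_mul_of_tsupport hO h2 hu⟩, ?_⟩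
  filter_upwards [h1] with y hy
  change ψ y * u y = u y
  rw [hy, one_mul]

theorem extendGerm_eventuallyEq {u : M → 𝕜} {x : M}
    (h : ∃ f : SmoothFun m M 𝕜, ∀ᶠ y in 𝓝 x, f y = u y) :
    ∀ᶠ y in 𝓝 x, extendGerm m u x y = u y := by
  rw [extendGerm, dif_pos h]
  exact h.choose_spec

theorem evalAt_apply (x : M) (f : SmoothFun m M 𝕜) : evalAt m 𝕜 x f = f x := rfl

theorem sum_eval {ι : Type*} (s : Finset ι) (f : ι → SmoothFun m M 𝕜) (x : M) :
    (∑ i ∈ s, f i) x = ∑ i ∈ s, f i x := by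
  simp only [← evalAt_apply, map_sum]

section Derivation

variable (D : VecField m M 𝕜)

/-- A bump function `ψ` supported where `f` vanishes gives $\psi f=0$, and the Leibniz rule at `x`
reduces to $\psi(x)\,(Df)(x)=0$. -/
theorem derivation_eq_zero_of_eventually {f : SmoothFun m M 𝕜} {x : M}
    (hf : ∀ᶠ y in 𝓝 x, f y = 0) : D f x = 0 := by
  obtain ⟨ψ, h1, h2⟩ := exists_bump m 𝕜 x hf
  have h3 : ψ * f = 0 := by
    ext y
    by_cases hy : y ∈ tsupport ψ
    · have : f y = 0 := h2 hy
      change ψ y * f y = 0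
      rw [this, mul_zero]
    · change ψ y * f y = 0
      rw [image_eq_zero_of_notMem_tsupport hy, zero_mul]
  have h4 : D (ψ * f) = 0 := by rw [h3, map_zero]
  rw [D.leibniz] at h4
  have h5 : ψ x * D f x + f x * D ψ x = 0 := congrArg (fun F : SmoothFun m M 𝕜 => F x) h4
  rwa [h1.self_of_nhds, hf.self_of_nhds, one_mul, zero_mul, add_zero] at h5

theorem derivation_congr {f f' : SmoothFun m M 𝕜} {x : M} (hf : ∀ᶠ y in 𝓝 x, f y = f' y) :
    D f x = D f' x := by
  have h : D (f - f') x = 0 := by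
    refine derivation_eq_zero_of_eventually D ?_
    filter_upwards [hf] with y hy
    exact sub_eq_zero.2 hy
  rw [map_sub] at h
  exact sub_eq_zero.1 h

theorem derivation_const_real (r : ℝ) : D (constFun m M 𝕜 (r : 𝕜)) = 0 := by
  have : constFun m M 𝕜 (r : 𝕜) = algebraMap ℝ (SmoothFun m M 𝕜) r := by
    rw [Algebra.algebraMap_eq_smul_one]
    ext y
    change (r : 𝕜) = r • (1 : 𝕜)
    rw [RCLike.real_smul_eq_coe_mul, mul_one]
  rw [this, D.map_algebraMap]

theorem derivation_const (c : 𝕜) : D (constFun m M 𝕜 c) = 0 := by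
  have hI : D (constFun m M 𝕜 RCLike.I) = 0 := by
    -- In the real case `I = 0`. Otherwise $0=D(-1)=D(I\cdot I)=2I\,D(I)$.
    rcases RCLike.I_mul_I (K := 𝕜) with h | h
    · rw [h, map_zero, map_zero]
    · have h1 : D (constFun m M 𝕜 RCLike.I * constFun m M 𝕜 RCLike.I) = 0 := by
        rw [← map_mul, h]
        have := derivation_const_real D (-1)
        rwa [RCLike.ofReal_neg, RCLike.ofReal_one] at this
      rw [D.leibniz] at h1
      ext y
      have h2 : (RCLike.I : 𝕜) * D (constFun m M 𝕜 RCLike.I) y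
          + RCLike.I * D (constFun m M 𝕜 RCLike.I) y = 0 :=
        congrArg (fun F : SmoothFun m M 𝕜 => F y) h1
      have h3 : (RCLike.I : 𝕜) ≠ 0 := by
        intro h0
        rw [h0] at h
        simp at h
      rw [← two_mul] at h2
      simpa [h3] using h2
  have hc : constFun m M 𝕜 c = constFun m M 𝕜 (RCLike.re c : 𝕜)
      + constFun m M 𝕜 (RCLike.im c : 𝕜) * constFun m M 𝕜 RCLike.I := by
    rw [← map_mul, ← map_add, RCLike.re_add_im]
  rw [hc, map_add, D.leibniz, derivation_const_real, derivation_const_real, hI]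
  simp

end Derivation

section Chart

variable {φ : OpenPartialHomeomorph M (EuclideanSpace ℝ (Fin m))}
  (hφ : φ ∈ IsManifold.maximalAtlas (𝓡 m) ∞ M)
include hφ

theorem contMDiffOn_coord (μ : Fin m) :
    ContMDiffOn (𝓡 m) 𝓘(ℝ, 𝕜) ∞ (fun y => ((φ y μ : ℝ) : 𝕜)) φ.source :=
  contMDiffOn_ofReal_comp
    (((EuclideanSpace.proj (𝕜 := ℝ) μ).contDiff.contMDiff).comp_contMDiffOn
      (contMDiffOn_of_mem_maximalAtlas hφ))

theorem extendGerm_coord_eventuallyEq {x : M} (hx : x ∈ φ.source) (μ : Fin m) :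
    ∀ᶠ y in 𝓝 x, extendGerm m (fun y => ((φ y μ : ℝ) : 𝕜)) x y = ((φ y μ : ℝ) : 𝕜) :=
  extendGerm_eventuallyEq
    (exists_smoothFun_eventuallyEq φ.open_source hx (contMDiffOn_coord hφ μ))

theorem contDiffOn_comp_symm (f : SmoothFun m M 𝕜) :
    ContDiffOn ℝ ∞ (fun z => f (φ.symm z)) φ.target := by
  rw [← contMDiffOn_iff_contDiffOn]
  exact f.contMDiff.comp_contMDiffOn (contMDiffOn_symm_of_mem_maximalAtlas hφ)

/-- A derivation is determined by its values on the coordinates. -/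
theorem derivation_apply_eq_sum (D : VecField m M 𝕜) (f : SmoothFun m M 𝕜) {x : M}
    (hx : x ∈ φ.source) :
    D f x = ∑ μ, D (extendGerm m (fun y => ((φ y μ : ℝ) : 𝕜)) x) x
      * fderiv ℝ (fun z => f (φ.symm z)) (φ x) (EuclideanSpace.single μ 1) := by
  -- Hadamard's lemma needs a function smooth on the whole space, so the local expression of `f` is
  -- replaced by a global function with the same germ.
  obtain ⟨F, hF⟩ := exists_smoothFun_eventuallyEq φ.open_target (φ.map_source hx)
    (contMDiffOn_iff_contDiffOn.2 (contDiffOn_comp_symm hφ f))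
  have hFc : ContDiff ℝ ∞ F := contMDiff_iff_contDiff.1 F.contMDiff
  obtain ⟨H, hH, hHx, hHy⟩ := Hadamard.exists_hadamard hFc (φ x)
  have hφc : ContMDiffOn (𝓡 m) (𝓡 m) ∞ φ φ.source := contMDiffOn_of_mem_maximalAtlas hφ
  have hh : ∀ μ, ∃ h : SmoothFun m M 𝕜, ∀ᶠ y in 𝓝 x,
      h y = H (φ y) (EuclideanSpace.single μ 1) := by
    intro μ
    refine exists_smoothFun_eventuallyEq φ.open_source hx ?_
    have : ContDiff ℝ ∞ fun z => H z (EuclideanSpace.single μ 1) := hH.clm_apply contDiff_const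
    exact this.contMDiff.comp_contMDiffOn hφc
  choose h hh using hh
  set X : Fin m → SmoothFun m M 𝕜 := fun μ => extendGerm m (fun y => ((φ y μ : ℝ) : 𝕜)) x
  have hX : ∀ μ, ∀ᶠ y in 𝓝 x, X μ y = ((φ y μ : ℝ) : 𝕜) := extendGerm_coord_eventuallyEq hφ hx
  -- Near `x`, $f=f(x)+\sum_\mu(x^\mu-x^\mu(x))h_\mu$. Applying `D` at `x` kills the constant and
  -- the terms with $Dh_\mu$, leaving $h_\mu(x)$, the partial derivatives of `f`.
  have key : ∀ᶠ y in 𝓝 x, f y = (constFun m M 𝕜 (f x)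
      + ∑ μ, (X μ - constFun m M 𝕜 ((φ x μ : ℝ) : 𝕜)) * h μ) y := by
    have hF' : ∀ᶠ y in 𝓝 x, F (φ y) = f (φ.symm (φ y)) :=
      (φ.continuousAt hx).eventually hF
    filter_upwards [hF', eventually_all.2 hX, eventually_all.2 hh,
      φ.open_source.mem_nhds hx] with y h1 h2 h3 h4
    have e1 : (constFun m M 𝕜 (f x)
      + ∑ μ, (X μ - constFun m M 𝕜 ((φ x μ : ℝ) : 𝕜)) * h μ) y
      = f x + ∑ μ, (X μ y - ((φ x μ : ℝ) : 𝕜)) * h μ y := by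
      rw [← evalAt_apply, map_add, map_sum]
      rfl
    have e2 : F (φ x) = f x := by
      have := hF.self_of_nhds
      rwa [φ.left_inv hx] at this
    rw [e1, ← φ.left_inv h4, ← h1, φ.left_inv h4, hHy (φ y), e2]
    congr 1
    have e3 : φ y - φ x = ∑ μ, (φ y μ - φ x μ) • EuclideanSpace.single μ (1 : ℝ) := by
      ext ν
      simp [Finset.sum_apply, Pi.single_apply]
    rw [e3, map_sum]
    refine Finset.sum_congr rfl fun μ _ => ?_
    rw [map_smul, h2, h3, RCLike.real_smul_eq_coe_mul]
    push_cast
    rfl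
  rw [derivation_congr D key, map_add, derivation_const, zero_add, map_sum]
  rw [sum_eval]
  refine Finset.sum_congr rfl fun μ _ => ?_
  rw [D.leibniz, map_sub, derivation_const, sub_zero]
  have e4 : fderiv ℝ (fun z => f (φ.symm z)) (φ x) = H (φ x) := by
    rw [hHx]
    exact (Filter.EventuallyEq.fderiv_eq hF).symm
  rw [e4, ← (hh μ).self_of_nhds]
  change (X μ x - ((φ x μ : ℝ) : 𝕜)) * D (h μ) x + h μ x * D (X μ) x = _
  rw [(hX μ).self_of_nhds, sub_self, zero_mul, zero_add, mul_comm]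

end Chart

end SmoothGerm

/-! ## Coordinate frames -/

namespace SmoothGerm

open LieAlgd Set Filter

variable {m : ℕ} {M 𝕜 : Type*} [RCLike 𝕜] [TopologicalSpace M] [T2Space M]
  [ChartedSpace (EuclideanSpace ℝ (Fin m)) M] [IsManifold (𝓡 m) ∞ M]
  {φ φ' : OpenPartialHomeomorph M (EuclideanSpace ℝ (Fin m))}

theorem differentiableAt_comp_symm (hφ : φ ∈ IsManifold.maximalAtlas (𝓡 m) ∞ M)
    (f : SmoothFun m M 𝕜) {y : M} (hy : y ∈ φ.source) :
    DifferentiableAt ℝ (fun z => f (φ.symm z)) (φ y) :=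
  ((contDiffOn_comp_symm hφ f).differentiableOn (by simp)).differentiableAt
    (φ.open_target.mem_nhds (φ.map_source hy))

/-- The vector field `ψ ∂_μ`, for a function `ψ` with support in the domain of the chart. -/
def partialField (hφ : φ ∈ IsManifold.maximalAtlas (𝓡 m) ∞ M) (ψ : SmoothFun m M 𝕜)
    (hψ : tsupport ψ ⊆ φ.source) (μ : Fin m) : VecField m M 𝕜 :=
  Derivation.mk'
    { toFun := fun f => ⟨fun y => ψ y * fderiv ℝ (fun z => f (φ.symm z)) (φ y)
          (EuclideanSpace.single μ 1), by
        refine contMDiff_mul_of_tsupport φ.open_source hψ ?_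
        have h1 : ContDiffOn ℝ ∞ (fun z => fderiv ℝ (fun z => f (φ.symm z)) z
            (EuclideanSpace.single μ 1)) φ.target :=
          ((contDiffOn_comp_symm hφ f).fderiv_of_isOpen φ.open_target (by simp)).clm_apply
            contDiffOn_const
        exact (contMDiffOn_iff_contDiffOn.2 h1).comp (contMDiffOn_of_mem_maximalAtlas hφ)
          fun y hy => φ.map_source hy⟩
      map_add' := by
        intro f f'
        ext y
        change ψ y * fderiv ℝ (fun z => f (φ.symm z) + f' (φ.symm z)) (φ y) _
          = ψ y * _ + ψ y * _
        by_cases hy : y ∈ φ.source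
        · rw [fderiv_fun_add (differentiableAt_comp_symm hφ f hy)
            (differentiableAt_comp_symm hφ f' hy), ← mul_add]
          rfl
        · rw [image_eq_zero_of_notMem_tsupport fun h => hy (hψ h)]
          simp
      map_smul' := by
        intro c f
        ext y
        change ψ y * fderiv ℝ (fun z => c • f (φ.symm z)) (φ y) _ = c • (ψ y * _)
        by_cases hy : y ∈ φ.source
        · rw [fderiv_fun_const_smul (differentiableAt_comp_symm hφ f hy), ← mul_smul_comm]
          rfl
        · rw [image_eq_zero_of_notMem_tsupport fun h => hy (hψ h)]
          simp }
    (by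
      intro f f'
      ext y
      change ψ y * fderiv ℝ (fun z => f (φ.symm z) * f' (φ.symm z)) (φ y) _
        = f y * (ψ y * _) + f' y * (ψ y * _)
      by_cases hy : y ∈ φ.source
      · rw [fderiv_fun_mul (differentiableAt_comp_symm hφ f hy)
          (differentiableAt_comp_symm hφ f' hy)]
        simp only [add_apply, smul_apply, smul_eq_mul,
          φ.left_inv hy]
        ring
      · rw [image_eq_zero_of_notMem_tsupport fun h => hy (hψ h)]
        simp)

theorem partialField_apply (hφ : φ ∈ IsManifold.maximalAtlas (𝓡 m) ∞ M) (ψ : SmoothFun m M 𝕜)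
    (hψ : tsupport ψ ⊆ φ.source) (μ : Fin m) (f : SmoothFun m M 𝕜) (y : M) :
    partialField hφ ψ hψ μ f y
      = ψ y * fderiv ℝ (fun z => f (φ.symm z)) (φ y) (EuclideanSpace.single μ 1) := rfl

theorem dcoord_value (X : VecField m M 𝕜) (y : M) (ν : Fin m) :
    dcoord 𝕜 φ y ν (value y X) = X (extendGerm m (fun y => ((φ y ν : ℝ) : 𝕜)) y) y := rfl

/-- At each point `dcoord` uses its own global extension of the coordinate. Near `x` one extension
serves for all points, because derivations depend only on germs; hence the components of a vector
field are smooth. -/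
theorem dcoord_value_eventually (hφ : φ ∈ IsManifold.maximalAtlas (𝓡 m) ∞ M) {x : M}
    (hx : x ∈ φ.source) (ν : Fin m) : ∀ᶠ y in 𝓝 x, ∀ X : VecField m M 𝕜,
    dcoord 𝕜 φ y ν (value y X) = X (extendGerm m (fun y => ((φ y ν : ℝ) : 𝕜)) x) y := by
  filter_upwards [(extendGerm_coord_eventuallyEq (𝕜 := 𝕜) hφ hx ν).eventually_nhds,
    φ.open_source.mem_nhds hx] with y h1 h2 X
  rw [dcoord_value]
  refine derivation_congr X ?_
  filter_upwards [h1, extendGerm_coord_eventuallyEq (𝕜 := 𝕜) hφ h2 ν] with z h3 h4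
  rw [h3, h4]

theorem dcoord_partialField (hφ : φ ∈ IsManifold.maximalAtlas (𝓡 m) ∞ M)
    (hφ' : φ' ∈ IsManifold.maximalAtlas (𝓡 m) ∞ M) (ψ : SmoothFun m M 𝕜)
    (hψ : tsupport ψ ⊆ φ.source) (μ ν : Fin m) {y : M} (hy : y ∈ φ.source) (hy' : y ∈ φ'.source) :
    dcoord 𝕜 φ' y ν (value y (partialField hφ ψ hψ μ))
      = ψ y * ((fderiv ℝ (φ' ∘ φ.symm) (φ y) (EuclideanSpace.single μ 1) ν : ℝ) : 𝕜) := by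
  rw [dcoord_value, partialField_apply]
  congr 1
  have h1 := extendGerm_coord_eventuallyEq (𝕜 := 𝕜) hφ' hy' ν
  have hs : Tendsto φ.symm (𝓝 (φ y)) (𝓝 y) := by
    have := φ.continuousAt_symm (φ.map_source hy)
    rwa [ContinuousAt, φ.left_inv hy] at this
  have h2 := hs.eventually h1
  have hd : DifferentiableAt ℝ (φ' ∘ φ.symm) (φ y) := by
    have hc : ContMDiffAt (𝓡 m) (𝓡 m) ∞ (φ' ∘ φ.symm) (φ y) := by
      refine ContMDiffAt.comp (φ y) (I' := 𝓡 m) ?_ ?_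
      · refine (contMDiffOn_of_mem_maximalAtlas hφ').contMDiffAt ?_
        rw [φ.left_inv hy]
        exact φ'.open_source.mem_nhds hy'
      · exact (contMDiffOn_symm_of_mem_maximalAtlas hφ).contMDiffAt
          (φ.open_target.mem_nhds (φ.map_source hy))
    exact (contMDiffAt_iff_contDiffAt.1 hc).differentiableAt (by simp)
  rw [Filter.EventuallyEq.fderiv_eq h2]
  have h3 := ((RCLike.ofRealCLM (K := 𝕜)).comp (EuclideanSpace.proj (𝕜 := ℝ) ν)).hasFDerivAt.comp
    (φ y) hd.hasFDerivAt
  have h4 : fderiv ℝ (fun z => ((φ' (φ.symm z) ν : ℝ) : 𝕜)) (φ y) = _ := h3.fderiv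
  rw [h4]
  rfl

/-- A tangent vector with vanishing components is zero. -/
theorem eq_zero_of_dcoord_eq_zero (hφ : φ ∈ IsManifold.maximalAtlas (𝓡 m) ∞ M) {x : M}
    (hx : x ∈ φ.source) {ξ : Fiber m 𝕜 x (VecField m M 𝕜)} (h : ∀ μ, dcoord 𝕜 φ x μ ξ = 0) :
    ξ = 0 := by
  obtain ⟨X, rfl⟩ := value_surjective x ξ
  set u : Fin m → SmoothFun m M 𝕜 := fun μ => X (extendGerm m (fun y => ((φ y μ : ℝ) : 𝕜)) x)
  have hu : ∀ᶠ y in 𝓝 x, y ∈ φ.source ∧ ∀ μ, dcoord 𝕜 φ y μ (value y X) = u μ y := by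
    filter_upwards [eventually_all.2 fun μ => dcoord_value_eventually (𝕜 := 𝕜) hφ hx μ,
      φ.open_source.mem_nhds hx] with y h1 h2
    exact ⟨h2, fun μ => h1 μ X⟩
  obtain ⟨ψ, h1, h2⟩ := exists_bump m 𝕜 x hu
  have hψ : tsupport ψ ⊆ φ.source := fun y hy => (h2 hy).1
  -- After the cut-off the coordinate expression of the field holds globally. The coefficients `u μ`
  -- vanish at `x`, as does `1 - ψ`, so `X` lies in $\mathfrak m_x\Gamma(TM)$.
  have h3 : ψ • X = ∑ μ, u μ • partialField hφ ψ hψ μ := by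
    ext f y
    have e1 : (∑ μ, u μ • partialField hφ ψ hψ μ) f y
        = ∑ μ, u μ y * (ψ y * fderiv ℝ (fun z => f (φ.symm z)) (φ y)
          (EuclideanSpace.single μ 1)) := by
      have : (∑ μ, u μ • partialField hφ ψ hψ μ) f
          = ∑ μ, u μ • partialField hφ ψ hψ μ f := by
        change Derivation.coeFnAddMonoidHom (∑ μ, u μ • partialField hφ ψ hψ μ) f = _
        rw [map_sum, Finset.sum_apply]
        rfl
      rw [this, sum_eval]
      rfl
    rw [e1]
    change ψ y * X f y = _
    by_cases hy : y ∈ tsupport ψ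
    · rw [derivation_apply_eq_sum hφ X f (hψ hy), Finset.mul_sum]
      refine Finset.sum_congr rfl fun μ _ => ?_
      rw [← (h2 hy).2 μ, dcoord_value]
      ring
    · rw [image_eq_zero_of_notMem_tsupport hy]
      simp
  have h4 : X = ψ • X + (1 - ψ) • X := by rw [← add_smul]; simp
  rw [value_eq_zero_iff, h4, h3]
  refine add_mem (sum_mem fun μ _ => ?_) ?_
  · exact Submodule.smul_mem_smul (h μ) Submodule.mem_top
  · refine Submodule.smul_mem_smul ?_ Submodule.mem_top
    change (1 : 𝕜) - ψ x = 0
    rw [h1.self_of_nhds, sub_self]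

/-- Existence of a coordinate frame of global vector fields. -/
theorem exists_coord_frame (hφ : φ ∈ IsManifold.maximalAtlas (𝓡 m) ∞ M) {x : M}
    (hx : x ∈ φ.source) : ∃ X : Fin m → VecField m M 𝕜, ∀ᶠ y in 𝓝 x,
      ∀ φ' ∈ IsManifold.maximalAtlas (𝓡 m) ∞ M, y ∈ φ'.source → ∀ μ ν,
        dcoord 𝕜 φ' y ν (value y (X μ))
          = ((fderiv ℝ (φ' ∘ φ.symm) (φ y) (EuclideanSpace.single μ 1) ν : ℝ) : 𝕜) := by
  obtain ⟨ψ, h1, h2⟩ := exists_bump m 𝕜 x (φ.open_source.mem_nhds hx)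
  refine ⟨partialField hφ ψ h2, ?_⟩
  filter_upwards [h1, φ.open_source.mem_nhds hx] with y hy hy' φ' hφ' hy'' μ ν
  rw [dcoord_partialField hφ hφ' ψ h2 μ ν hy' hy'', hy, one_mul]

theorem fderiv_comp_symm_self (y : M) (hy : y ∈ φ.source) (μ ν : Fin m) :
    ((fderiv ℝ (φ ∘ φ.symm) (φ y) (EuclideanSpace.single μ 1) ν : ℝ) : 𝕜)
      = if ν = μ then 1 else 0 := by
  have h1 : φ ∘ φ.symm =ᶠ[𝓝 (φ y)] id := by
    filter_upwards [φ.open_target.mem_nhds (φ.map_source hy)] with z hz using φ.right_inv hz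
  rw [h1.fderiv_eq, fderiv_id]
  simp

end SmoothGerm

/-! ## Change of basis -/

namespace AlternatingForm

open Matrix LieAlgd

variable {𝕜 V J : Type*} [RCLike 𝕜] [AddCommGroup V] [Module 𝕜 V] [Fintype J] [DecidableEq J]
  {B : V →ₗ[𝕜] V →ₗ[𝕜] 𝕜} {γ γ' : Matrix J J 𝕜} {b b' : Module.Basis J 𝕜 V}

theorem bilin_sharp (hB : ∀ i j, B (b i) (b j) = γ i j) (hγ : γ.det ≠ 0) (ξ : V →ₗ[𝕜] 𝕜) (v : V) :
    B (sharp b γ ξ) v = ξ v := by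
  have h : B (sharp b γ ξ) = ξ := by
    refine b.ext fun k => ?_
    simp only [sharp_apply, map_sum, LinearMap.sum_apply, map_smul, LinearMap.smul_apply, hB,
      smul_eq_mul, Finset.sum_mul]
    rw [Finset.sum_comm]
    have h1 : ∀ i, ∑ j, ξ (b i) * γ⁻¹ i j * γ j k = ξ (b i) * (1 : Matrix J J 𝕜) i k := by
      intro i
      rw [← nonsing_inv_mul γ (isUnit_iff_ne_zero.2 hγ), Matrix.mul_apply, Finset.mul_sum]
      exact Finset.sum_congr rfl fun _ _ => by ring
    simp_rw [h1]
    simp [Matrix.one_apply]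
  rw [h]

/-- A basis-free characterization: $B(\sharp\xi,\cdot)=\xi$. The difference of the two candidates is
some $\sharp\zeta$, and this property forces $\zeta=0$. -/
theorem sharp_congr (hB : ∀ i j, B (b i) (b j) = γ i j) (hγ : γ.det ≠ 0)
    (hB' : ∀ i j, B (b' i) (b' j) = γ' i j) (hγ' : γ'.det ≠ 0) : sharp b γ = sharp b' γ' := by
  ext ξ
  obtain ⟨ζ, hζ⟩ := sharp_surjective b hγ (sharp b γ ξ - sharp b' γ' ξ)
  have h0 : ζ = 0 := by
    ext v
    rw [← bilin_sharp hB hγ, hζ, map_sub, LinearMap.sub_apply, bilin_sharp hB hγ,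
      bilin_sharp hB' hγ', sub_self, LinearMap.zero_apply]
  rw [h0, map_zero] at hζ
  exact sub_eq_zero.1 hζ.symm

theorem wedgeForm_coord_change (b b' : Module.Basis J 𝕜 V) :
    wedgeForm b'.coord = (of fun k i => b'.coord k (b i)).det • wedgeForm b.coord := by
  ext v
  rw [AlternatingMap.smul_apply, smul_eq_mul, wedgeForm_apply, wedgeForm_apply, mul_comm,
    ← det_transpose (of fun k i => b'.coord k (b i)), ← det_mul]
  congr 1
  ext i j
  rw [of_apply, Matrix.mul_apply]
  have h := congrArg (b'.coord j) (b.sum_repr (v i))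
  rw [map_sum] at h
  rw [← h]
  exact Finset.sum_congr rfl fun k _ => by simp

theorem gram_change (hB : ∀ i j, B (b i) (b j) = γ i j) (hB' : ∀ i j, B (b' i) (b' j) = γ' i j) :
    γ.det = (of fun k i => b'.coord k (b i)).det ^ 2 * γ'.det := by
  have h : γ = (of fun k i => b'.coord k (b i))ᵀ * γ' * of fun k i => b'.coord k (b i) := by
    ext i j
    rw [← hB, Matrix.mul_apply]
    conv_lhs => rw [← b'.sum_repr (b i), ← b'.sum_repr (b j)]
    simp only [map_sum, LinearMap.sum_apply, map_smul, LinearMap.smul_apply, hB', smul_eq_mul,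
      Matrix.mul_apply, Finset.sum_mul]
    refine Finset.sum_congr rfl fun k _ => ?_
    rw [Finset.mul_sum]
    refine Finset.sum_congr rfl fun l _ => ?_
    simp only [transpose_apply, of_apply, Module.Basis.coord_apply]
    ring
  conv_lhs => rw [h]
  rw [det_mul, det_mul, det_transpose]
  ring

/-- The Gram determinant changes by the square of the determinant `t` of the change of basis, so its
root changes by $|t|$, while the product of coordinates changes by `t`. The factors match because
`t` is positive, which is what the orientations provide. -/
theorem volume_congr (hB : ∀ i j, B (b i) (b j) = γ i j) (hB' : ∀ i j, B (b' i) (b' j) = γ' i j)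
    {t : ℝ} (ht : 0 < t) (hP : (of fun k i => b'.coord k (b i)).det = (t : 𝕜)) :
    ((Real.sqrt ‖γ'.det‖ : ℝ) : 𝕜) • wedgeForm b'.coord
      = ((Real.sqrt ‖γ.det‖ : ℝ) : 𝕜) • wedgeForm b.coord := by
  rw [wedgeForm_coord_change b b', gram_change hB hB', hP, smul_smul]
  congr 1
  rw [norm_mul, norm_pow, RCLike.norm_ofReal, sq_abs, Real.sqrt_mul (sq_nonneg t),
    Real.sqrt_sq ht.le]
  push_cast
  ring

end AlternatingForm

/-! ## Mixed bases of the fibers -/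

namespace LieAlgd

open AlternatingForm SmoothGerm Matrix

variable {m n : ℕ} {M 𝕜 A 𝔤 : Type*} [RCLike 𝕜] [TopologicalSpace M] [T2Space M]
  [ChartedSpace (EuclideanSpace ℝ (Fin m)) M] [IsManifold (𝓡 m) ∞ M] [LieRing A]
  [Module (SmoothFun m M 𝕜) A] [LieRing 𝔤] [LieAlgebra 𝕜 𝔤] {P : LieAlgebroid m M 𝕜 A}

section Connection

variable (D : P.Connection) (x : M)

theorem mapAt_anchor_conn (ξ : Fiber m 𝕜 x (VecField m M 𝕜)) :
    mapAt x P.anchor (mapAt x D.toLinearMap ξ) = ξ := by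
  obtain ⟨X, rfl⟩ := value_surjective x ξ
  rw [mapAt_value, mapAt_value, D.anchor_apply]

theorem form_conn (X : VecField m M 𝕜) : D.form (D.toLinearMap X) = 0 := by
  refine Subtype.ext ?_
  change D.toLinearMap (P.anchor (D.toLinearMap X)) - D.toLinearMap X = 0
  rw [D.anchor_apply, sub_self]

/-- The convention $\lambda(X)=\nabla_{\rho(X)}-X$ gives $-\mathrm{id}$ on $L$; the minus signs
attached to vertical vectors below come from here. -/
theorem form_kernel (l : P.kernel) : D.form (l : A) = -l := by
  refine Subtype.ext ?_
  change D.toLinearMap (P.anchor l) - (l : A) = -(l : A)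
  have hl : P.anchor (l : A) = 0 := l.2
  rw [hl, map_zero, zero_sub]

theorem mapAt_form_conn (ξ : Fiber m 𝕜 x (VecField m M 𝕜)) :
    mapAt x D.form (mapAt x D.toLinearMap ξ) = 0 := by
  obtain ⟨X, rfl⟩ := value_surjective x ξ
  rw [mapAt_value, mapAt_value, form_conn]
  rfl

theorem mapAt_anchor_kernel (k : Fiber m 𝕜 x P.kernel) :
    mapAt x P.anchor (mapAt x P.kernel.subtype k) = 0 := by
  obtain ⟨l, rfl⟩ := value_surjective x k
  have hl : P.anchor (l : A) = 0 := l.2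
  rw [mapAt_value, mapAt_value, Submodule.subtype_apply, hl]
  rfl

theorem mapAt_form_kernel (k : Fiber m 𝕜 x P.kernel) :
    mapAt x D.form (mapAt x P.kernel.subtype k) = -k := by
  obtain ⟨l, rfl⟩ := value_surjective x k
  rw [mapAt_value, mapAt_value, Submodule.subtype_apply, form_kernel]
  rfl

theorem conn_sub_kernel (v : Fiber m 𝕜 x A) :
    mapAt x D.toLinearMap (mapAt x P.anchor v) - mapAt x P.kernel.subtype (mapAt x D.form v)
      = v := by
  obtain ⟨a, rfl⟩ := value_surjective x v
  change value x (D.toLinearMap (P.anchor a) - (D.toLinearMap (P.anchor a) - a)) = _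
  rw [sub_sub_cancel]

/-- Surjectivity makes pull-back along $S$ injective, so identities between local forms can be
checked on the fiber of $A$. The vector $v-\nabla^0_{\rho v}$ is vertical and equals $\iota$ of
minus its image under $\lambda$. -/
theorem surjective_S (T : P.LocalTriv 𝔤) (D : P.Connection) (x : T.U) :
    Function.Surjective (T.S x) := by
  intro v
  set ξ := mapAt (x : M) P.anchor v
  have h := conn_sub_kernel D (x : M) (v - T.nabla x ξ)
  rw [map_sub, T.anchor_nabla, sub_self, map_zero, zero_sub] at h
  refine ⟨(ξ, (T.Ψ x).symm (-mapAt (x : M) D.form (v - T.nabla x ξ))), ?_⟩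
  change T.nabla x ξ + mapAt (x : M) P.kernel.subtype
    ((T.Ψ x) ((T.Ψ x).symm (-mapAt (x : M) D.form (v - T.nabla x ξ)))) = v
  rw [LinearEquiv.apply_symm_apply, map_neg, h]
  abel

theorem anchor_S (T : P.LocalTriv 𝔤) (x : T.U) (u : Fiber m 𝕜 (x : M) (VecField m M 𝕜) × 𝔤) :
    mapAt (x : M) P.anchor (T.S x u) = u.1 := by
  change mapAt (x : M) P.anchor (T.nabla x u.1 + mapAt (x : M) P.kernel.subtype (T.Ψ x u.2)) = _
  rw [map_add, T.anchor_nabla, mapAt_anchor_kernel, add_zero]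

end Connection

section Bases

variable {φ φ' : OpenPartialHomeomorph M (EuclideanSpace ℝ (Fin m))}

theorem exists_dcoord_dual (hφ : φ ∈ IsManifold.maximalAtlas (𝓡 m) ∞ M) {x : M}
    (hx : x ∈ φ.source) : ∃ e : Fin m → Fiber m 𝕜 x (VecField m M 𝕜),
      (∀ μ ν, dcoord 𝕜 φ x ν (e μ) = if ν = μ then 1 else 0) ∧
      ∀ φ' ∈ IsManifold.maximalAtlas (𝓡 m) ∞ M, x ∈ φ'.source → ∀ μ ν, dcoord 𝕜 φ' x ν (e μ)
          = ((fderiv ℝ (φ' ∘ φ.symm) (φ x) (EuclideanSpace.single μ 1) ν : ℝ) : 𝕜) := by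
  obtain ⟨X, hX⟩ := exists_coord_frame (𝕜 := 𝕜) hφ hx
  have h := hX.self_of_nhds
  exact ⟨fun μ => value x (X μ), fun μ ν => by rw [h φ hφ hx, fderiv_comp_symm_self x hx],
    fun φ' h1 h2 => h φ' h1 h2⟩

theorem dcoord_bijective (hφ : φ ∈ IsManifold.maximalAtlas (𝓡 m) ∞ M) {x : M} (hx : x ∈ φ.source) :
    Function.Bijective (LinearMap.pi fun μ => dcoord 𝕜 φ x μ) := by
  constructor
  · rw [injective_iff_map_eq_zero]
    intro ξ hξ
    exact eq_zero_of_dcoord_eq_zero hφ hx fun μ => congrFun hξ μ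
  · intro c
    obtain ⟨e, he, -⟩ := exists_dcoord_dual (𝕜 := 𝕜) hφ hx
    refine ⟨∑ μ, c μ • e μ, funext fun ν => ?_⟩
    simp [he]

/-- The coordinate basis of the tangent space. -/
def tangentBasis (𝕜 : Type*) [RCLike 𝕜] (hφ : φ ∈ IsManifold.maximalAtlas (𝓡 m) ∞ M) {x : M}
    (hx : x ∈ φ.source) : Module.Basis (Fin m) 𝕜 (Fiber m 𝕜 x (VecField m M 𝕜)) :=
  Module.Basis.ofEquivFun (LinearEquiv.ofBijective _ (dcoord_bijective hφ hx))

theorem tangentBasis_coord (hφ : φ ∈ IsManifold.maximalAtlas (𝓡 m) ∞ M) {x : M}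
    (hx : x ∈ φ.source) (μ : Fin m) : (tangentBasis 𝕜 hφ hx).coord μ = dcoord 𝕜 φ x μ := by
  ext ξ
  rw [Module.Basis.coord_apply, tangentBasis, Module.Basis.ofEquivFun_repr_apply]
  rfl

theorem dcoord_tangentBasis (hφ : φ ∈ IsManifold.maximalAtlas (𝓡 m) ∞ M) {x : M}
    (hx : x ∈ φ.source) (hφ' : φ' ∈ IsManifold.maximalAtlas (𝓡 m) ∞ M) (hx' : x ∈ φ'.source)
    (μ ν : Fin m) : dcoord 𝕜 φ' x ν (tangentBasis 𝕜 hφ hx μ)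
      = ((fderiv ℝ (φ' ∘ φ.symm) (φ x) (EuclideanSpace.single μ 1) ν : ℝ) : 𝕜) := by
  obtain ⟨e, he, he'⟩ := exists_dcoord_dual (𝕜 := 𝕜) hφ hx
  have : tangentBasis 𝕜 hφ hx μ = e μ := by
    refine (tangentBasis 𝕜 hφ hx).ext_elem fun ν => ?_
    rw [← Module.Basis.coord_apply, ← Module.Basis.coord_apply, tangentBasis_coord, he,
      ← tangentBasis_coord hφ hx]
    simp [Finsupp.single_apply, eq_comm]
  rw [this, he' φ' hφ' hx']

variable (D : P.Connection) (T : P.LocalTriv 𝔤) (E : Module.Basis (Fin n) 𝕜 𝔤)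

/-- The components of a vector of the fiber of the Lie algebroid in the mixed basis. -/
def mixedCoord (φ : OpenPartialHomeomorph M (EuclideanSpace ℝ (Fin m))) (x : T.U) :
    Fiber m 𝕜 (x : M) A →ₗ[𝕜] (Fin m ⊕ Fin n → 𝕜) :=
  LinearMap.pi (Sum.elim (fun μ => dcoord 𝕜 φ (x : M) μ ∘ₗ mapAt (x : M) P.anchor)
    fun a => E.coord a ∘ₗ (T.Ψ x).symm.toLinearMap ∘ₗ mapAt (x : M) D.form)

/-- The decomposition $v=\nabla_{\rho v}-\iota\lambda v$ gives injectivity. For surjectivity the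
vertical part is inserted with a minus sign, which $\lambda$ undoes. -/
theorem mixedCoord_bijective (hφ : φ ∈ IsManifold.maximalAtlas (𝓡 m) ∞ M) {x : T.U}
    (hx : (x : M) ∈ φ.source) : Function.Bijective (mixedCoord D T E φ x) := by
  constructor
  · rw [injective_iff_map_eq_zero]
    intro v hv
    have h1 : mapAt (x : M) P.anchor v = 0 :=
      eq_zero_of_dcoord_eq_zero hφ hx fun μ => congrFun hv (Sum.inl μ)
    have h2 : (T.Ψ x).symm (mapAt (x : M) D.form v) = 0 :=
      E.ext_elem fun a => by
        rw [map_zero]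
        exact congrFun hv (Sum.inr a)
    rw [LinearEquiv.map_eq_zero_iff] at h2
    rw [← conn_sub_kernel D (x : M) v, h1, h2, map_zero, map_zero, sub_zero]
  · intro c
    obtain ⟨ξ, hξ⟩ := (dcoord_bijective (𝕜 := 𝕜) hφ hx).2 fun μ => c (Sum.inl μ)
    refine ⟨mapAt (x : M) D.toLinearMap ξ
      + mapAt (x : M) P.kernel.subtype (T.Ψ x (-∑ a, c (Sum.inr a) • E a)), funext fun j => ?_⟩
    rcases j with μ | a
    · change dcoord 𝕜 φ (x : M) μ (mapAt (x : M) P.anchor _) = _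
      rw [map_add, mapAt_anchor_conn, mapAt_anchor_kernel, add_zero]
      exact congrFun hξ μ
    · change E.coord a ((T.Ψ x).symm (mapAt (x : M) D.form _)) = _
      rw [map_add, mapAt_form_conn, mapAt_form_kernel, zero_add, ← map_neg, neg_neg,
        LinearEquiv.symm_apply_apply, Module.Basis.coord_apply, Module.Basis.repr_sum_self]

/-- The mixed basis of the fiber of the Lie algebroid. -/
def mixedBasis (hφ : φ ∈ IsManifold.maximalAtlas (𝓡 m) ∞ M) {x : T.U} (hx : (x : M) ∈ φ.source) :
    Module.Basis (Fin m ⊕ Fin n) 𝕜 (Fiber m 𝕜 (x : M) A) :=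
  Module.Basis.ofEquivFun (LinearEquiv.ofBijective _ (mixedCoord_bijective D T E hφ hx))

variable (hφ : φ ∈ IsManifold.maximalAtlas (𝓡 m) ∞ M) {x : T.U} (hx : (x : M) ∈ φ.source)

theorem mixedBasis_coord (j : Fin m ⊕ Fin n) (v : Fiber m 𝕜 (x : M) A) :
    (mixedBasis D T E hφ hx).coord j v = mixedCoord D T E φ x v j := by
  rw [Module.Basis.coord_apply, mixedBasis, Module.Basis.ofEquivFun_repr_apply]
  rfl

theorem mixedBasis_coord_inl (μ : Fin m) (v : Fiber m 𝕜 (x : M) A) :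
    (mixedBasis D T E hφ hx).coord (Sum.inl μ) v
      = dcoord 𝕜 φ (x : M) μ (mapAt (x : M) P.anchor v) := mixedBasis_coord D T E hφ hx _ v

theorem mixedBasis_coord_inr (a : Fin n) (v : Fiber m 𝕜 (x : M) A) :
    (mixedBasis D T E hφ hx).coord (Sum.inr a) v
      = E.coord a ((T.Ψ x).symm (mapAt (x : M) D.form v)) := mixedBasis_coord D T E hφ hx _ v

theorem mixedBasis_inl (μ : Fin m) : mixedBasis D T E hφ hx (Sum.inl μ)
    = mapAt (x : M) D.toLinearMap (tangentBasis 𝕜 hφ hx μ) := by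
  refine (mixedBasis D T E hφ hx).ext_elem fun j => ?_
  rw [← Module.Basis.coord_apply, ← Module.Basis.coord_apply]
  rcases j with ν | a
  · rw [mixedBasis_coord_inl _ _ _ _ _ _ (mapAt _ _ _), mapAt_anchor_conn,
      ← tangentBasis_coord hφ hx]
    simp [Finsupp.single_apply]
  · rw [mixedBasis_coord_inr _ _ _ _ _ _ (mapAt _ _ _), mapAt_form_conn]
    simp

theorem mixedBasis_inr (a : Fin n) : mixedBasis D T E hφ hx (Sum.inr a)
    = -mapAt (x : M) P.kernel.subtype (T.Ψ x (E a)) := by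
  refine (mixedBasis D T E hφ hx).ext_elem fun j => ?_
  rw [← Module.Basis.coord_apply, ← Module.Basis.coord_apply]
  rcases j with ν | c
  · rw [map_neg, mixedBasis_coord_inl _ _ _ _ _ _ (mapAt _ _ _), mapAt_anchor_kernel]
    simp
  · rw [map_neg, mixedBasis_coord_inr _ _ _ _ _ _ (mapAt _ _ _), mapAt_form_kernel]
    simp [Finsupp.single_apply]

end Bases

end LieAlgd

/-! ## The duality operator of a bilinear form -/

namespace AlternatingForm

open Matrix LieAlgd

section MetricDual

variable {𝕜 V W W' κ κ' J : Type*} [RCLike 𝕜] [AddCommGroup V] [Module 𝕜 V] [AddCommGroup W]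
  [Module 𝕜 W] [AddCommGroup W'] [Module 𝕜 W'] [Fintype κ] [DecidableEq κ] [Fintype J]
  [DecidableEq J] (B : V →ₗ[𝕜] V →ₗ[𝕜] 𝕜) (b b' : Module.Basis J 𝕜 V)

/-- The Gram matrix of a bilinear form. -/
def gramMatrix : Matrix J J 𝕜 := of fun i j => B (b i) (b j)

theorem apply_basis (i j : J) : B (b i) (b j) = gramMatrix B b i j := rfl

theorem gramMatrix_det_ne_zero (hB : B.Nondegenerate) : (gramMatrix B b).det ≠ 0 := by
  have h : gramMatrix B b = LinearMap.toMatrix₂ b b B := by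
    ext i j
    rw [LinearMap.toMatrix₂_apply]
    rfl
  rw [h]
  exact (LinearMap.nondegenerate_iff_det_ne_zero b).1 hB

theorem gramMatrix_isSymm (hB : ∀ v u, B v u = B u v) : (gramMatrix B b).IsSymm := by
  ext i j
  exact hB _ _

/-- The duality operator on alternating maps defined by a bilinear form and the orientation of a
basis. -/
def metricDual (e : κ ⊕ κ' ≃ J) : (V [⋀^κ]→ₗ[𝕜] W) →ₗ[𝕜] (V [⋀^κ']→ₗ[𝕜] W) :=
  dualize b e (sharp b (gramMatrix B b))
    (((Real.sqrt ‖(gramMatrix B b).det‖ : ℝ) : 𝕜) • wedgeForm b.coord)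

variable {B b b'}

theorem metricDual_congr (hb : (gramMatrix B b).det ≠ 0) {t : ℝ} (ht : 0 < t)
    (hP : (of fun k i => b'.coord k (b i)).det = (t : 𝕜)) (e : κ ⊕ κ' ≃ J) :
    metricDual (W := W) B b e = metricDual B b' e := by
  have h1 := gram_change (apply_basis B b) (apply_basis B b')
  have hb' : (gramMatrix B b').det ≠ 0 := by
    intro h
    exact hb (by rw [h1, h, mul_zero])
  ext1 w
  rw [metricDual, metricDual, dualize_congr_basis b b',
    sharp_congr (apply_basis B b) hb (apply_basis B b') hb',
    volume_congr (apply_basis B b) (apply_basis B b') ht hP]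

/-- Coordinates are replaced by $B(\sharp b^j,\cdot)$, so only values of the bilinear form, its Gram
matrix and the basis vectors occur. All of these are smooth when the basis varies smoothly. -/
theorem metricDual_apply (hb : (gramMatrix B b).det ≠ 0) (e : κ ⊕ κ' ≃ J) (w : V [⋀^κ]→ₗ[𝕜] W)
    (v : κ' → V) : metricDual B b e w v = ((Fintype.card κ).factorial : 𝕜)⁻¹ • ∑ I : κ → J,
      (((Real.sqrt ‖(gramMatrix B b).det‖ : ℝ) : 𝕜)
        * (of fun i j => B (sharp b (gramMatrix B b) (b.coord j))
          ((Sum.elim (fun i => sharp b (gramMatrix B b) (b.coord (I i))) v ∘ e.symm) i)).det)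
        • w fun i => b (I i) := by
  rw [metricDual, dualize_apply]
  congr 1
  refine Finset.sum_congr rfl fun I _ => ?_
  rw [AlternatingMap.smul_apply, smul_eq_mul, wedgeForm_apply]
  congr 3
  funext i j
  rw [of_apply, of_apply, bilin_sharp (apply_basis B b) hb]

theorem dualize_compAlternatingMap (L : W →ₗ[𝕜] W') (e : κ ⊕ κ' ≃ J)
    (sh : (V →ₗ[𝕜] 𝕜) →ₗ[𝕜] V) (vol : V [⋀^J]→ₗ[𝕜] 𝕜) (w : V [⋀^κ]→ₗ[𝕜] W) :
    dualize b e sh vol (L.compAlternatingMap w) = L.compAlternatingMap (dualize b e sh vol w) := by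
  ext v
  rw [LinearMap.compAlternatingMap_apply, dualize_apply, dualize_apply, map_smul, map_sum]
  simp only [map_smul, LinearMap.compAlternatingMap_apply]

end MetricDual

theorem gradeOp_compAlternatingMap {𝕜 V W W' : Type*} [Field 𝕜] [AddCommGroup V] [Module 𝕜 V]
    [AddCommGroup W] [Module 𝕜 W] [AddCommGroup W'] [Module 𝕜 W'] {m p : ℕ}
    (κ : Fin (m + 1) → 𝕜) (θ : Fin (m + 1) → V →ₗ[𝕜] V) (L : W →ₗ[𝕜] W')
    (w : V [⋀^Fin p]→ₗ[𝕜] W) :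
    gradeOp κ θ (L.compAlternatingMap w) = L.compAlternatingMap (gradeOp κ θ w) := by
  ext v
  rw [LinearMap.compAlternatingMap_apply, gradeOp_apply, gradeOp_apply, sum_apply, sum_apply,
    map_sum]
  simp

/-- The pull-back of alternating maps, as a linear map. -/
def pullback {𝕜 V V' W : Type*} (κ : Type*) [Field 𝕜] [AddCommGroup V] [Module 𝕜 V]
    [AddCommGroup V'] [Module 𝕜 V'] [AddCommGroup W] [Module 𝕜 W] (S : V' →ₗ[𝕜] V) :
    (V [⋀^κ]→ₗ[𝕜] W) →ₗ[𝕜] V' [⋀^κ]→ₗ[𝕜] W where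
  toFun w := w.compLinearMap S
  map_add' _ _ := rfl
  map_smul' _ _ := rfl

/-! ### Naturality of the local formulas under pull-back -/

section Pullback

variable {𝕜 V V' 𝔤 : Type*} [RCLike 𝕜] [AddCommGroup V] [Module 𝕜 V] [AddCommGroup V']
  [Module 𝕜 V'] [LieRing 𝔤] [LieAlgebra 𝕜 𝔤] {m n : ℕ} (X : Fin m → V →ₗ[𝕜] 𝕜)
  (Λ : Fin n → V →ₗ[𝕜] 𝕜) (S : V' →ₗ[𝕜] V)

theorem formSmul_wedge_comp {k l q : ℕ} (h : k + l = q) (α : Fin k → V →ₗ[𝕜] 𝕜)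
    (β : Fin l → V →ₗ[𝕜] 𝕜) (c : 𝔤) : (formSmul (wedge h α β) c).compLinearMap S
      = formSmul (wedge h (fun i => α i ∘ₗ S) fun j => β j ∘ₗ S) c := by
  subst h
  ext v
  rw [AlternatingMap.compLinearMap_apply, formSmul_eq_tensor, formSmul_eq_tensor, tensor_apply,
    tensor_apply, wedge_eq_wedgeForm, wedge_eq_wedgeForm, wedgeForm_apply, wedgeForm_apply]
  congr 2
  ext i j
  refine Fin.addCases (fun j => ?_) (fun j => ?_) j <;> simp

theorem expansion_comp (p : ℕ) (c : Components m n 𝔤) :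
    (expansion X Λ p c).compLinearMap S
      = expansion (fun μ => X μ ∘ₗ S) (fun a => Λ a ∘ₗ S) p c := by
  change pullback (Fin _) S _ = _
  simp only [expansion, map_sum]
  refine Finset.sum_congr rfl fun r _ => Finset.sum_congr rfl fun s _ => ?_
  split_ifs with h
  · simp only [map_sum]
    refine Finset.sum_congr rfl fun μ _ => Finset.sum_congr rfl fun a _ => ?_
    exact formSmul_wedge_comp S h _ _ _
  · rw [map_zero]

theorem hodgeFormula_comp (g : Matrix (Fin m) (Fin m) 𝕜) (h : Matrix (Fin n) (Fin n) 𝕜) (p q : ℕ)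
    (hpq : p + q = m + n) (c : Components m n 𝔤) :
    (hodgeFormula X Λ g h p q hpq c).compLinearMap S
      = hodgeFormula (fun μ => X μ ∘ₗ S) (fun a => Λ a ∘ₗ S) g h p q hpq c := by
  change pullback (Fin _) S _ = _
  simp only [hodgeFormula, map_sum]
  refine Finset.sum_congr rfl fun r _ => Finset.sum_congr rfl fun s _ => ?_
  split_ifs with h
  · simp only [map_sum, map_smul]
    refine Finset.sum_congr rfl fun μ _ => Finset.sum_congr rfl fun a _ =>
      Finset.sum_congr rfl fun ν _ => Finset.sum_congr rfl fun b _ => ?_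
    congr 1
    exact formSmul_wedge_comp S _ _ _ _
  · rw [map_zero]

end Pullback

end AlternatingForm

/-! ## Sections and forms are determined by their values -/

namespace LieAlgd

open AlternatingForm SmoothGerm Matrix

section Sections

variable {m : ℕ} {M 𝕜 N N' : Type*} [RCLike 𝕜] [TopologicalSpace M]
  [ChartedSpace (EuclideanSpace ℝ (Fin m)) M] [AddCommGroup N] [Module (SmoothFun m M 𝕜) N]
  [AddCommGroup N'] [Module (SmoothFun m M 𝕜) N']

theorem value_sum {κ : Type*} (x : M) (s : Finset κ) (a : κ → N) :
    (value x (∑ i ∈ s, a i) : Fiber m 𝕜 x N) = ∑ i ∈ s, value x (a i) :=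
  map_sum (⟨⟨value x, rfl⟩, value_add x⟩ : N →+ Fiber m 𝕜 x N) a s

/-- The dual basis lemma: a splitting of a surjection from a free module yields the functionals `g
i`. It replaces partitions of unity in the passage from fibers to sections. -/
theorem exists_dual_frame [Module.Finite (SmoothFun m M 𝕜) N]
    [Module.Projective (SmoothFun m M 𝕜) N] : ∃ (k : ℕ) (u : Fin k → N)
      (g : Fin k → N →ₗ[SmoothFun m M 𝕜] SmoothFun m M 𝕜), ∀ a, ∑ i, g i a • u i = a := by
  obtain ⟨k, f, g, -, -, h⟩ := Module.Finite.exists_comp_eq_id_of_projective (SmoothFun m M 𝕜) N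
  refine ⟨k, fun i => f (Pi.single i 1), fun i => LinearMap.proj i ∘ₗ g, fun a => ?_⟩
  have h1 := LinearMap.congr_fun h a
  change f (g a) = a at h1
  conv_rhs => rw [← h1, ← Finset.univ_sum_single (g a), map_sum]
  refine Finset.sum_congr rfl fun i _ => ?_
  change (g a) i • f _ = _
  rw [← map_smul]
  congr 1
  ext j : 1
  rw [Pi.smul_apply, smul_eq_mul, Pi.single_apply, Pi.single_apply]
  split_ifs with hj
  · rw [mul_one]
  · rw [mul_zero]

variable [Module.Finite (SmoothFun m M 𝕜) N] [Module.Projective (SmoothFun m M 𝕜) N]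

theorem eq_of_value_eq {a b : N} (h : ∀ x : M, (value x a : Fiber m 𝕜 x N) = value x b) :
    a = b := by
  obtain ⟨k, u, g, hg⟩ := exists_dual_frame (m := m) (M := M) (𝕜 := 𝕜) (N := N)
  rw [← hg a, ← hg b]
  refine Finset.sum_congr rfl fun i _ => ?_
  congr 1
  ext x
  rw [← functionalAt_value, ← functionalAt_value, h]

/-- A family of elements of the fibers that agrees locally with sections is a section. -/
theorem exists_section (s : ∀ x : M, Fiber m 𝕜 x N)
    (hs : ∀ x, ∃ a : N, ∀ᶠ y in 𝓝 x, s y = value y a) : ∃ a : N, ∀ x, value x a = s x := by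
  obtain ⟨k, u, g, hg⟩ := exists_dual_frame (m := m) (M := M) (𝕜 := 𝕜) (N := N)
  -- Each coefficient function is locally that of a global section, hence smooth; the family is then
  -- the combination of the generators with these coefficients.
  have hc : ∀ i, ContMDiff (𝓡 m) 𝓘(ℝ, 𝕜) ∞ fun x => functionalAt x (g i) (s x) := by
    intro i x
    obtain ⟨a, ha⟩ := hs x
    refine ((g i a).contMDiff x).congr_of_eventuallyEq ?_
    filter_upwards [ha] with y hy
    rw [hy, functionalAt_value]
  let c : Fin k → SmoothFun m M 𝕜 := fun i => ⟨_, hc i⟩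
  refine ⟨∑ i, c i • u i, fun x => ?_⟩
  obtain ⟨a, ha⟩ := value_surjective x (s x)
  rw [← ha]
  conv_rhs => rw [← hg a]
  rw [value_sum, value_sum]
  refine Finset.sum_congr rfl fun i _ => ?_
  rw [value_smul, value_smul]
  congr 1
  change functionalAt x (g i) (s x) = _
  rw [← ha, functionalAt_value]

theorem form_ext {p : ℕ} {w w' : N' [⋀^Fin p]→ₗ[SmoothFun m M 𝕜] N}
    (h : ∀ x : M, formAt x w = formAt x w') : w = w' := by
  ext a
  refine eq_of_value_eq (m := m) (M := M) (𝕜 := 𝕜) fun x => ?_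
  rw [← formAt_value, ← formAt_value, h]

/-- A family of alternating maps of the fibers that depends smoothly on the point is a form. -/
theorem exists_form {p : ℕ} (s : ∀ x : M, Fiber m 𝕜 x N' [⋀^Fin p]→ₗ[𝕜] Fiber m 𝕜 x N)
    (hs : ∀ (v : Fin p → N') (x : M), ∃ a : N, ∀ᶠ y in 𝓝 x, s y (fun i => value y (v i)) = value y a) :
    ∃ w : N' [⋀^Fin p]→ₗ[SmoothFun m M 𝕜] N, ∀ x, formAt x w = s x := by
  choose F hF using fun v => exists_section (fun y => s y fun i => value y (v i)) (hs v)
  have hu : ∀ [DecidableEq (Fin p)] (x : M) (v : Fin p → N') (i : Fin p) (a : N'),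
      value x (F (Function.update v i a))
        = s x (Function.update (fun j => value x (v j)) i (value x a)) := by
    intro _ x v i a
    rw [hF]
    congr 1
    exact Function.comp_update (value x : N' → Fiber m 𝕜 x N') v i a
  refine ⟨{ toFun := F, map_update_add' := ?_, map_update_smul' := ?_, map_eq_zero_of_eq' := ?_ },
    fun x => ?_⟩
  · intro _ v i a b
    refine eq_of_value_eq (m := m) (M := M) (𝕜 := 𝕜) fun x => ?_
    rw [value_add, hu, hu, hu, value_add, AlternatingMap.map_update_add]
  · intro _ v i c a
    refine eq_of_value_eq (m := m) (M := M) (𝕜 := 𝕜) fun x => ?_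
    rw [value_smul, hu, hu, value_smul, AlternatingMap.map_update_smul]
  · intro v i j hij hne
    refine eq_of_value_eq (m := m) (M := M) (𝕜 := 𝕜) fun x => ?_
    rw [hF]
    exact (s x).map_eq_zero_of_eq _ (by rw [hij]) hne
  · ext v
    choose a ha using fun i => value_surjective x (v i)
    obtain rfl : (fun i => value x (a i)) = v := funext ha
    rw [formAt_value]
    exact hF a x

end Sections

section FormAt

variable {m : ℕ} {M 𝕜 N N' : Type*} [RCLike 𝕜] [TopologicalSpace M]
  [ChartedSpace (EuclideanSpace ℝ (Fin m)) M] [AddCommGroup N] [Module (SmoothFun m M 𝕜) N]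
  [AddCommGroup N'] [Module (SmoothFun m M 𝕜) N'] (x : M) {p : ℕ}

theorem formAt_ext {w : Fiber m 𝕜 x N' [⋀^Fin p]→ₗ[𝕜] Fiber m 𝕜 x N}
    {w' : Fiber m 𝕜 x N' [⋀^Fin p]→ₗ[𝕜] Fiber m 𝕜 x N}
    (h : ∀ a : Fin p → N', w (fun i => value x (a i)) = w' fun i => value x (a i)) : w = w' := by
  ext v
  choose a ha using fun i => value_surjective x (v i)
  obtain rfl : (fun i => value x (a i)) = v := funext ha
  exact h a

theorem formAt_add (w w' : N' [⋀^Fin p]→ₗ[SmoothFun m M 𝕜] N) :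
    formAt x (w + w') = formAt x w + formAt x w' :=
  formAt_ext x fun a => by
    rw [AlternatingMap.add_apply, formAt_value, formAt_value, formAt_value, AlternatingMap.add_apply,
      value_add]

theorem formAt_smul (f : SmoothFun m M 𝕜) (w : N' [⋀^Fin p]→ₗ[SmoothFun m M 𝕜] N) :
    formAt x (f • w) = f x • formAt x w :=
  formAt_ext x fun a => by
    rw [AlternatingMap.smul_apply, formAt_value, formAt_value, AlternatingMap.smul_apply,
      value_smul]

theorem formAt_sum {κ : Type*} (s : Finset κ) (w : κ → N' [⋀^Fin p]→ₗ[SmoothFun m M 𝕜] N) :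
    formAt x (∑ i ∈ s, w i) = ∑ i ∈ s, formAt x (w i) := by
  have h0 : formAt x (0 : N' [⋀^Fin p]→ₗ[SmoothFun m M 𝕜] N) = 0 :=
    formAt_ext x fun a => by
      rw [formAt_value]
      rfl
  exact map_sum (⟨⟨formAt x, h0⟩, formAt_add x⟩ :
    (N' [⋀^Fin p]→ₗ[SmoothFun m M 𝕜] N) →+ _) w s

theorem formAt_comp (w : N' [⋀^Fin p]→ₗ[SmoothFun m M 𝕜] N) (F : N' →ₗ[SmoothFun m M 𝕜] N') :
    formAt x (w.compLinearMap F) = (formAt x w).compLinearMap (mapAt x F) :=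
  formAt_ext x fun a => by
    rw [AlternatingMap.compLinearMap_apply, formAt_value]
    exact (formAt_value x w _).symm

end FormAt

/-! ## Gradation -/

variable {m n : ℕ} {M 𝕜 A 𝔤 : Type*} [RCLike 𝕜] [TopologicalSpace M] [T2Space M]
  [ChartedSpace (EuclideanSpace ℝ (Fin m)) M] [IsManifold (𝓡 m) ∞ M] [LieRing A]
  [Module (SmoothFun m M 𝕜) A] [LieRing 𝔤] [LieAlgebra 𝕜 𝔤] {P : LieAlgebroid m M 𝕜 A}

/-- The connection splits $A$: $-\iota$ followed by $\lambda$ is the identity of $L$, so $L$ is a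
quotient, and also a direct summand, of $A$. -/
theorem finite_kernel (D : P.Connection) : Module.Finite (SmoothFun m M 𝕜) P.kernel := by
  have := P.finite
  refine Module.Finite.of_surjective D.form fun l => ⟨-(l : A), ?_⟩
  rw [map_neg, form_kernel, neg_neg]

theorem projective_kernel (D : P.Connection) : Module.Projective (SmoothFun m M 𝕜) P.kernel := by
  have := P.projective
  refine Module.Projective.of_split (-P.kernel.subtype) D.form ?_
  ext l : 1
  change D.form (-(l : A)) = l
  rw [map_neg, form_kernel, neg_neg]

/-- The endomorphism of the Lie algebroid which multiplies horizontal vectors by `t` and fixes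
vertical vectors. -/
def scaling (D : P.Connection) (t : 𝕜) : A →ₗ[SmoothFun m M 𝕜] A :=
  constFun m M 𝕜 t • (D.toLinearMap ∘ₗ P.anchor) - P.kernel.subtype ∘ₗ D.form

theorem mapAt_scaling (D : P.Connection) (t : 𝕜) (x : M) (v : Fiber m 𝕜 x A) :
    mapAt x (scaling D t) v = t • mapAt x D.toLinearMap (mapAt x P.anchor v)
      - mapAt x P.kernel.subtype (mapAt x D.form v) := by
  obtain ⟨a, rfl⟩ := value_surjective x v
  rfl

theorem isScaling_scaling {φ : OpenPartialHomeomorph M (EuclideanSpace ℝ (Fin m))}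
    (D : P.Connection) (T : P.LocalTriv 𝔤) (E : Module.Basis (Fin n) 𝕜 𝔤)
    (hφ : φ ∈ IsManifold.maximalAtlas (𝓡 m) ∞ M) {x : T.U} (hx : (x : M) ∈ φ.source) (t : 𝕜) :
    IsScaling (mixedBasis D T E hφ hx) t (mapAt (x : M) (scaling D t)) := by
  constructor
  · intro μ v
    rw [mapAt_scaling, mixedBasis_coord_inl, mixedBasis_coord_inl, map_sub, map_smul,
      mapAt_anchor_conn, mapAt_anchor_kernel, sub_zero, map_smul, smul_eq_mul]
  · intro a v
    rw [mapAt_scaling, mixedBasis_coord_inr, mixedBasis_coord_inr, map_sub, map_smul,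
      mapAt_form_conn, mapAt_form_kernel, smul_zero, zero_sub, neg_neg]

/-- The operator `w ↦ ∑ κ_j (w ∘ θ_j)` on forms, where `θ_j` multiplies horizontal vectors by
`j + 1`. -/
def gradeForm (D : P.Connection) (κ : Fin (m + 1) → 𝕜) {p : ℕ} (w : P.Form p) : P.Form p :=
  ∑ j, constFun m M 𝕜 (κ j) • w.compLinearMap (scaling D ((j : 𝕜) + 1))

theorem formAt_gradeForm (D : P.Connection) (κ : Fin (m + 1) → 𝕜) {p : ℕ} (w : P.Form p) (x : M) :
    formAt x (gradeForm D κ w)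
      = gradeOp κ (fun j => mapAt x (scaling D ((j : 𝕜) + 1))) (formAt x w) := by
  rw [gradeForm, formAt_sum, gradeOp_apply]
  refine Finset.sum_congr rfl fun j _ => ?_
  rw [formAt_smul, formAt_comp]
  rfl

end LieAlgd

/-! ## Smoothness of the duality operator -/

namespace LieAlgd

open AlternatingForm SmoothGerm Matrix

section Smooth

variable {m : ℕ} {M 𝕜 N N' : Type*} [RCLike 𝕜] [TopologicalSpace M] [T2Space M]
  [ChartedSpace (EuclideanSpace ℝ (Fin m)) M] [IsManifold (𝓡 m) ∞ M]
  [AddCommGroup N] [Module (SmoothFun m M 𝕜) N] [AddCommGroup N'] [Module (SmoothFun m M 𝕜) N']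

theorem exists_comp_eventuallyEq (f : SmoothFun m M 𝕜) {x : M} (hx : f x ≠ 0) {u : 𝕜 → 𝕜}
    (hu : ∀ z, z ≠ 0 → ContDiffAt ℝ ∞ u z) : ∃ f' : SmoothFun m M 𝕜, ∀ᶠ y in 𝓝 x, f' y = u (f y) :=
  exists_smoothFun_eventuallyEq (f.contMDiff.continuous.isOpen_preimage _ isOpen_compl_singleton)
    (by simpa using hx) fun y hy =>
      ((hu _ hy).comp_contMDiffAt (f.contMDiff y)).contMDiffWithinAt

/-- The norm is $\sqrt{\mathrm{re}^2+\mathrm{im}^2}$, real smooth and positive away from zero. -/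
theorem contDiffAt_sqrt_norm {z : 𝕜} (hz : z ≠ 0) :
    ContDiffAt ℝ ∞ (fun z : 𝕜 => ((Real.sqrt ‖z‖ : ℝ) : 𝕜)) z := by
  have h1 : (fun z : 𝕜 => ((Real.sqrt ‖z‖ : ℝ) : 𝕜)) = fun z : 𝕜 => (RCLike.ofRealCLM (K := 𝕜))
      (Real.sqrt (Real.sqrt (RCLike.reCLM z ^ 2 + RCLike.imCLM z ^ 2))) := by
    funext z
    rw [show RCLike.reCLM z ^ 2 + RCLike.imCLM z ^ 2 = ‖z‖ ^ 2 by
      rw [RCLike.norm_sq_eq_def]; simp [sq], Real.sqrt_sq (norm_nonneg z)]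
    rfl
  have h2 : RCLike.reCLM z ^ 2 + RCLike.imCLM z ^ 2 ≠ 0 := by
    rw [show RCLike.reCLM z ^ 2 + RCLike.imCLM z ^ 2 = ‖z‖ ^ 2 by
      rw [RCLike.norm_sq_eq_def]; simp [sq]]
    exact pow_ne_zero 2 (norm_ne_zero_iff.2 hz)
  rw [h1]
  refine (RCLike.ofRealCLM (K := 𝕜)).contDiff.contDiffAt.comp z (ContDiffAt.sqrt (ContDiffAt.sqrt ?_ h2) ?_)
  · exact (((RCLike.reCLM (K := 𝕜)).contDiff.pow 2).add ((RCLike.imCLM (K := 𝕜)).contDiff.pow 2)).contDiffAt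
  · exact (Real.sqrt_ne_zero (by positivity)).2 h2

variable {J : Type*} [Fintype J] [DecidableEq J]
  (B : N →ₗ[SmoothFun m M 𝕜] N →ₗ[SmoothFun m M 𝕜] SmoothFun m M 𝕜)

theorem det_eval {κ : Type*} [Fintype κ] [DecidableEq κ] (Γ : κ → κ → SmoothFun m M 𝕜) (y : M) :
    (of Γ).det y = (of fun i j => Γ i j y).det := (evalAt m 𝕜 y).map_det (of Γ)

/-- The explicit formula is polynomial in smooth data, apart from $\det^{-1}$ and $\sqrt{|\det|}$ of
the Gram matrix. These agree near `x` with global functions because the determinant does not vanish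
at `x`. -/
theorem exists_metricDual_section {p q : ℕ} (e : J → N) {x : M}
    (hx : (of fun i j => B (e i) (e j) x).det ≠ 0) (ε : Fin p ⊕ Fin q ≃ J)
    (w : N [⋀^Fin p]→ₗ[SmoothFun m M 𝕜] N') (v : Fin q → N) : ∃ a : N', ∀ᶠ y in 𝓝 x,
      ∀ b : Module.Basis J 𝕜 (Fiber m 𝕜 y N), (∀ j, b j = value y (e j)) →
        metricDual (bilinAt y B) b ε (formAt y w) (fun i => value y (v i)) = value y a := by
  set Γ : Matrix J J (SmoothFun m M 𝕜) := of fun i j => B (e i) (e j)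
  have hΓ : ∀ y, Γ.det y = (of fun i j => B (e i) (e j) y).det := det_eval _
  rw [← hΓ] at hx
  obtain ⟨δ, hδ⟩ := exists_comp_eventuallyEq Γ.det hx fun z hz => contDiffAt_inv ℝ hz
  obtain ⟨ρ, hρ⟩ := exists_comp_eventuallyEq Γ.det hx fun z hz => contDiffAt_sqrt_norm hz
  have h0 : ∀ᶠ y in 𝓝 x, Γ.det y ≠ 0 :=
    Γ.det.contMDiff.continuous.continuousAt.eventually_ne hx
  -- The global counterpart of $\sharp b^i$: the inverse Gram matrix is the adjugate times `δ`,
  -- which equals $1/\det$ near `x`.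
  let sh : J → N := fun i => ∑ j, (δ * Γ.adjugate i j) • e j
  let I' : (Fin p → J) → (Fin p ⊕ Fin q) → N := fun I => Sum.elim (fun i => sh (I i)) v
  refine ⟨constFun m M 𝕜 ((Fintype.card (Fin p)).factorial : 𝕜)⁻¹ • ∑ I : Fin p → J,
    (ρ * (of fun i j => B (sh j) (I' I (ε.symm i))).det) • w fun i => e (I i), ?_⟩
  filter_upwards [hδ, hρ, h0] with y h1 h2 h3 b hb
  have hg : gramMatrix (bilinAt y B) b = (evalAt m 𝕜 y).mapMatrix Γ := by
    ext i j
    change bilinAt y B (b i) (b j) = _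
    rw [hb, hb]
    rfl
  have hd : (gramMatrix (bilinAt y B) b).det = Γ.det y := by
    rw [hg, ← RingHom.map_det]
    rfl
  have hsh : ∀ i, sharp b (gramMatrix (bilinAt y B) b) (b.coord i) = value y (sh i) := by
    intro i
    rw [sharp_apply, value_sum]
    refine Finset.sum_congr rfl fun j _ => ?_
    rw [value_smul, hb]
    congr 1
    rw [Finset.sum_eq_single i (fun k _ hk => by simp [hk])
      (fun h => absurd (Finset.mem_univ i) h), inv_def, hd, hg, ← RingHom.map_adjugate,
      Ring.inverse_eq_inv', ← h1]
    rw [Module.Basis.coord_apply, Module.Basis.repr_self, Finsupp.single_eq_same, one_mul]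
    rfl
  rw [metricDual_apply (by rw [hd]; exact h3), value_const_smul, value_sum]
  congr 1
  refine Finset.sum_congr rfl fun I _ => ?_
  rw [value_smul]
  congr 1
  · change _ = ρ y * (of fun i j => B (sh j) (I' I (ε.symm i))).det y
    rw [hd, h2]
    congr 1
    rw [det_eval]
    refine congrArg Matrix.det ?_
    ext i j
    rw [of_apply, of_apply, hsh]
    have : (Sum.elim (fun i => sharp b (gramMatrix (bilinAt y B) b) (b.coord (I i)))
        (fun i => value y (v i)) ∘ ε.symm) i = value y (I' I (ε.symm i)) := by
      rw [Function.comp_apply]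
      rcases ε.symm i with k | k
      · exact hsh _
      · rfl
    rw [this, bilinAt_value]
  · rw [← formAt_value]
    congr 1
    funext i
    exact hb _

end Smooth

end LieAlgd

/-! ## The metric in mixed bases -/

namespace LieAlgd

open AlternatingForm SmoothGerm Matrix

variable {m n : ℕ} {M 𝕜 A 𝔤 : Type*} [RCLike 𝕜] [TopologicalSpace M] [T2Space M]
  [ChartedSpace (EuclideanSpace ℝ (Fin m)) M] [IsManifold (𝓡 m) ∞ M] [LieRing A]
  [Module (SmoothFun m M 𝕜) A] [LieRing 𝔤] [LieAlgebra 𝕜 𝔤] {P : LieAlgebroid m M 𝕜 A}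
  {φ φ' : OpenPartialHomeomorph M (EuclideanSpace ℝ (Fin m))}

section Metric

variable (G : P.Metric) (T : P.LocalTriv 𝔤) (E : Module.Basis (Fin n) 𝕜 𝔤)

/-- The $dx^\mu$ are the coordinates of `tangentBasis`, so the matrix of components exists and is
unique. -/
theorem isBaseMatrix_iff (hφ : φ ∈ IsManifold.maximalAtlas (𝓡 m) ∞ M) {x : M} (hx : x ∈ φ.source)
    (g : Matrix (Fin m) (Fin m) 𝕜) :
    IsBaseMatrix G φ x g ↔ g = gramMatrix (bilinAt x G.base) (tangentBasis 𝕜 hφ hx) := by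
  have hc : ∀ μ ν, dcoord 𝕜 φ x μ (tangentBasis 𝕜 hφ hx ν) = if μ = ν then 1 else 0 := by
    intro μ ν
    rw [← tangentBasis_coord hφ hx]
    simp [Finsupp.single_apply, eq_comm]
  constructor
  · intro h
    ext μ ν
    rw [← apply_basis, h]
    simp [hc]
  · rintro rfl ξ ζ
    conv_lhs => rw [← (tangentBasis 𝕜 hφ hx).sum_repr ξ, ← (tangentBasis 𝕜 hφ hx).sum_repr ζ]
    simp only [map_sum, LinearMap.sum_apply, map_smul, LinearMap.smul_apply, smul_eq_mul,
      Finset.mul_sum]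
    rw [Finset.sum_comm]
    refine (Finset.sum_congr rfl fun μ _ => Finset.sum_congr rfl fun ν _ => ?_)
    rw [apply_basis, ← tangentBasis_coord hφ hx, ← tangentBasis_coord hφ hx,
      Module.Basis.coord_apply, Module.Basis.coord_apply]
    ring

theorem base_symm_at (x : M) (ξ ζ : Fiber m 𝕜 x (VecField m M 𝕜)) :
    bilinAt x G.base ξ ζ = bilinAt x G.base ζ ξ := by
  obtain ⟨X, rfl⟩ := value_surjective x ξ
  obtain ⟨Y, rfl⟩ := value_surjective x ζ
  rw [bilinAt_value, bilinAt_value, G.base_symm]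

theorem inner_symm_at (x : M) (k l : Fiber m 𝕜 x P.kernel) :
    bilinAt x G.inner k l = bilinAt x G.inner l k := by
  obtain ⟨X, rfl⟩ := value_surjective x k
  obtain ⟨Y, rfl⟩ := value_surjective x l
  rw [bilinAt_value, bilinAt_value, G.inner_symm]

theorem innerMatrix_eq_gram (x : T.U) :
    innerMatrix G T E x = gramMatrix (bilinAt (x : M) G.inner) (E.map (T.Ψ x)) := by
  ext a c
  simp [innerMatrix, gramMatrix]

theorem innerMatrix_isSymm (x : T.U) : (innerMatrix G T E x).IsSymm := by
  rw [innerMatrix_eq_gram]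
  exact gramMatrix_isSymm _ _ (inner_symm_at G x)

theorem innerMatrix_det_ne_zero (x : T.U) : (innerMatrix G T E x).det ≠ 0 := by
  rw [innerMatrix_eq_gram]
  exact gramMatrix_det_ne_zero _ _ (G.inner_nondegenerate x)

theorem bilinAt_hat (x : M) (v u : Fiber m 𝕜 x A) : bilinAt x G.hat v u
    = bilinAt x G.base (mapAt x P.anchor v) (mapAt x P.anchor u)
      + bilinAt x G.inner (mapAt x G.conn.form v) (mapAt x G.conn.form u) := by
  obtain ⟨a, rfl⟩ := value_surjective x v
  obtain ⟨c, rfl⟩ := value_surjective x u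
  rw [bilinAt_value, G.hat_apply]
  rfl

/-- Horizontal vectors are killed by $\lambda$ and vertical ones by $\rho$, so the mixed entries
vanish. The sign in $-\iota\Psi(E_a)$ makes $\lambda$ send it to $\Psi(E_a)$. -/
theorem gramMatrix_hat (hφ : φ ∈ IsManifold.maximalAtlas (𝓡 m) ∞ M) {x : T.U} (hx : (x : M) ∈ φ.source) :
    gramMatrix (bilinAt (x : M) G.hat) (mixedBasis G.conn T E hφ hx)
      = blockMatrix (gramMatrix (bilinAt (x : M) G.base) (tangentBasis 𝕜 hφ hx))
        (innerMatrix G T E x) := by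
  ext i j
  rw [← apply_basis, bilinAt_hat]
  have r1 : ∀ μ, mapAt (x : M) P.anchor (mixedBasis G.conn T E hφ hx (Sum.inl μ))
      = tangentBasis 𝕜 hφ hx μ := fun μ => by rw [mixedBasis_inl, mapAt_anchor_conn]
  have r2 : ∀ a, mapAt (x : M) P.anchor (mixedBasis G.conn T E hφ hx (Sum.inr a)) = 0 :=
    fun a => by rw [mixedBasis_inr, map_neg, mapAt_anchor_kernel, neg_zero]
  have l1 : ∀ μ, mapAt (x : M) G.conn.form (mixedBasis G.conn T E hφ hx (Sum.inl μ)) = 0 :=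
    fun μ => by rw [mixedBasis_inl, mapAt_form_conn]
  have l2 : ∀ a, mapAt (x : M) G.conn.form (mixedBasis G.conn T E hφ hx (Sum.inr a))
      = T.Ψ x (E a) := fun a => by rw [mixedBasis_inr, map_neg, mapAt_form_kernel, neg_neg]
  rcases i with μ | a <;> rcases j with ν | c
  · rw [r1, r1, l1, map_zero, LinearMap.zero_apply, add_zero]
    rfl
  · rw [r2, l1, map_zero, map_zero, LinearMap.zero_apply, add_zero]
    rfl
  · rw [r2, l1, map_zero, map_zero, LinearMap.zero_apply, add_zero]
    rfl
  · rw [r2, l2, l2, map_zero, LinearMap.zero_apply, zero_add]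
    rfl

theorem gramMatrix_hat_det_ne_zero (hφ : φ ∈ IsManifold.maximalAtlas (𝓡 m) ∞ M) {x : T.U}
    (hx : (x : M) ∈ φ.source) :
    (gramMatrix (bilinAt (x : M) G.hat) (mixedBasis G.conn T E hφ hx)).det ≠ 0 := by
  rw [gramMatrix_hat, det_blockMatrix]
  exact mul_ne_zero (gramMatrix_det_ne_zero _ _ (G.base_nondegenerate x)) (innerMatrix_det_ne_zero G T E x)

end Metric

section Overlap

theorem det_jacobian (F : EuclideanSpace ℝ (Fin m) →L[ℝ] EuclideanSpace ℝ (Fin m)) :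
    (of fun ν μ => ((F (EuclideanSpace.single μ 1) ν : ℝ) : 𝕜)).det = ((F.det : ℝ) : 𝕜) := by
  have h : (of fun ν μ => ((F (EuclideanSpace.single μ 1) ν : ℝ) : 𝕜))
      = (algebraMap ℝ 𝕜).mapMatrix (LinearMap.toMatrix (EuclideanSpace.basisFun (Fin m) ℝ).toBasis
        (EuclideanSpace.basisFun (Fin m) ℝ).toBasis (F : _ →ₗ[ℝ] _)) := by
    ext ν μ
    simp [LinearMap.toMatrix_apply]
  rw [h, ← RingHom.map_det, LinearMap.det_toMatrix]

/-- Both bases use the same connection, so horizontal and vertical vectors do not mix. The blocks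
are the Jacobian of the charts and the matrix of $\Psi'^{-1}\Psi$. -/
theorem det_mixedBasis_change (D : P.Connection) (T T' : P.LocalTriv 𝔤)
    (E : Module.Basis (Fin n) 𝕜 𝔤) (hφ : φ ∈ IsManifold.maximalAtlas (𝓡 m) ∞ M)
    (hφ' : φ' ∈ IsManifold.maximalAtlas (𝓡 m) ∞ M) {x : M} (hT : x ∈ T.U) (hT' : x ∈ T'.U)
    (hx : x ∈ φ.source) (hx' : x ∈ φ'.source) :
    (of fun k i => (mixedBasis D T' E hφ' (x := ⟨x, hT'⟩) hx').coord k
      (mixedBasis D T E hφ (x := ⟨x, hT⟩) hx i)).det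
      = (((fderiv ℝ (φ' ∘ φ.symm) (φ x)).det : ℝ) : 𝕜)
        * LinearMap.det (T'.transition T x hT' hT).toLinearMap := by
  have h : (of fun k i => (mixedBasis D T' E hφ' (x := ⟨x, hT'⟩) hx').coord k
      (mixedBasis D T E hφ (x := ⟨x, hT⟩) hx i))
      = fromBlocks (of fun ν μ =>
          ((fderiv ℝ (φ' ∘ φ.symm) (φ x) (EuclideanSpace.single μ 1) ν : ℝ) : 𝕜)) 0 0
        (LinearMap.toMatrix E E (T'.transition T x hT' hT).toLinearMap) := by
    ext k i
    rcases k with ν | c <;> rcases i with μ | a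
    · rw [of_apply, mixedBasis_inl, mixedBasis_coord_inl _ _ _ _ _ _ (mapAt _ _ _)]
      change dcoord 𝕜 φ' x ν (mapAt x P.anchor (mapAt x D.toLinearMap _)) = _
      rw [mapAt_anchor_conn, dcoord_tangentBasis hφ hx hφ' hx']
      rfl
    · rw [of_apply, mixedBasis_inr, map_neg, mixedBasis_coord_inl _ _ _ _ _ _ (mapAt _ _ _)]
      change -dcoord 𝕜 φ' x ν (mapAt x P.anchor (mapAt x P.kernel.subtype _)) = _
      rw [mapAt_anchor_kernel, map_zero, neg_zero]
      rfl
    · rw [of_apply, mixedBasis_inl, mixedBasis_coord_inr _ _ _ _ _ _ (mapAt _ _ _)]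
      change E.coord c ((T'.Ψ ⟨x, hT'⟩).symm (mapAt x D.form (mapAt x D.toLinearMap _))) = _
      rw [mapAt_form_conn, map_zero, map_zero]
      rfl
    · rw [of_apply, mixedBasis_inr, map_neg, mixedBasis_coord_inr _ _ _ _ _ _ (mapAt _ _ _)]
      change -E.coord c ((T'.Ψ ⟨x, hT'⟩).symm (mapAt x D.form (mapAt x P.kernel.subtype _))) = _
      rw [mapAt_form_kernel, map_neg, map_neg, neg_neg, fromBlocks_apply₂₂,
        LinearMap.toMatrix_apply]
      rfl
  rw [h, det_fromBlocks_zero₂₁, det_jacobian, LinearMap.det_toMatrix]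

end Overlap

section Frame

/-- Coordinate fields cut off by a bump function and sections representing $\Psi(E_a)$ near `x` give
global sections that restrict to the mixed basis at all nearby points. -/
theorem exists_mixed_frame (D : P.Connection) (T : P.LocalTriv 𝔤) (E : Module.Basis (Fin n) 𝕜 𝔤)
    (hφ : φ ∈ IsManifold.maximalAtlas (𝓡 m) ∞ M) {x : M} (hT : x ∈ T.U) (hx : x ∈ φ.source) :
    ∃ e : Fin m ⊕ Fin n → A, ∀ᶠ y in 𝓝 x, ∀ (h : y ∈ T.U) (h' : y ∈ φ.source) (j : Fin m ⊕ Fin n),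
      mixedBasis D T E hφ (x := ⟨y, h⟩) h' j = value y (e j) := by
  obtain ⟨X, hX⟩ := exists_coord_frame (𝕜 := 𝕜) hφ hx
  choose l hl using fun a => T.smooth_Ψ (E a) ⟨x, hT⟩
  refine ⟨Sum.elim (fun μ => D.toLinearMap (X μ)) fun a => -(l a : A), ?_⟩
  have hl' : ∀ᶠ y in 𝓝 x, ∀ (a : Fin n) (h : y ∈ T.U), T.Ψ ⟨y, h⟩ (E a) = value y (l a) := by
    rw [Filter.eventually_all]
    intro a
    have := hl a
    rw [nhds_subtype_eq_comap, Filter.eventually_comap] at this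
    filter_upwards [this] with y hy h using hy ⟨y, h⟩ rfl
  filter_upwards [hX, hl'] with y h1 h2 hy hy' j
  rcases j with μ | a
  · rw [mixedBasis_inl]
    have : tangentBasis 𝕜 hφ hy' μ = value y (X μ) := by
      refine (tangentBasis 𝕜 hφ hy').ext_elem fun ν => ?_
      rw [← Module.Basis.coord_apply, ← Module.Basis.coord_apply, tangentBasis_coord,
        dcoord_tangentBasis hφ hy' hφ hy', h1 φ hφ hy']
    exact congrArg (mapAt y D.toLinearMap) this
  · rw [mixedBasis_inr, h2]
    rfl

end Frame

end LieAlgd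

/-! ## The Hodge operator -/

namespace LieAlgd

open AlternatingForm SmoothGerm Matrix

variable {m n : ℕ} {M 𝕜 A 𝔤 ι : Type*} [RCLike 𝕜] [TopologicalSpace M] [T2Space M]
  [ChartedSpace (EuclideanSpace ℝ (Fin m)) M] [IsManifold (𝓡 m) ∞ M] [LieRing A]
  [Module (SmoothFun m M 𝕜) A] [LieRing 𝔤] [LieAlgebra 𝕜 𝔤] {P : LieAlgebroid m M 𝕜 A}
  {φ : OpenPartialHomeomorph M (EuclideanSpace ℝ (Fin m))}
  (G : P.Metric) (E : Module.Basis (Fin n) 𝕜 𝔤)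

section Local

variable (T : P.LocalTriv 𝔤) (hφ : φ ∈ IsManifold.maximalAtlas (𝓡 m) ∞ M) {x : T.U}
  (hx : (x : M) ∈ φ.source)

theorem dx_eq : dx 𝕜 𝔤 φ (x : M)
    = fun μ => (mixedBasis G.conn T E hφ hx).coord (Sum.inl μ) ∘ₗ T.S x := by
  funext μ
  refine LinearMap.ext fun u => ?_
  rw [LinearMap.comp_apply, mixedBasis_coord_inl, anchor_S]
  rfl

theorem mixed_eq : mixed G.conn T E x
    = fun a => (mixedBasis G.conn T E hφ hx).coord (Sum.inr a) ∘ₗ T.S x := by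
  funext a
  refine LinearMap.ext fun u => ?_
  rw [LinearMap.comp_apply, mixedBasis_coord_inr]
  rfl

/-- The forms $dx^\mu$ and $\lambda^a$ of the trivial algebroid are the pull-backs by $S$ of the
mixed coordinates, and this pull-back is injective. -/
theorem localForm_eq_expansion_iff {p : ℕ} (w : P.Form p) (c : Components m n 𝔤) :
    T.localForm x w = expansion (dx 𝕜 𝔤 φ (x : M)) (mixed G.conn T E x) p c
      ↔ (T.Ψ x).symm.toLinearMap.compAlternatingMap (formAt (x : M) w)
        = expansion (fun μ => (mixedBasis G.conn T E hφ hx).coord (Sum.inl μ))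
          (fun a => (mixedBasis G.conn T E hφ hx).coord (Sum.inr a)) p c := by
  rw [dx_eq G E T hφ hx, mixed_eq G E T hφ hx, ← expansion_comp]
  constructor
  · exact fun h => AlternatingMap.compLinearMap_injective (T.S x) (surjective_S T G.conn x) h
  · exact fun h => congrArg (fun w => w.compLinearMap (T.S x)) h

/-- The local formula for the Hodge operator computes the duality operator of the metric. -/
theorem hodgeFormula_eq_metricDual {p q : ℕ} (hpq : p + q = m + n) {κ : Fin (m + 1) → 𝕜}
    (hκ : ∀ r, r ≤ m → ∑ j, κ j * ((j : 𝕜) + 1) ^ r = hodgeWeight 𝕜 m n p r) {w : P.Form p}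
    {c : Components m n 𝔤}
    (hw : T.localForm x w = expansion (dx 𝕜 𝔤 φ (x : M)) (mixed G.conn T E x) p c) :
    hodgeFormula (dx 𝕜 𝔤 φ (x : M)) (mixed G.conn T E x)
        (gramMatrix (bilinAt (x : M) G.base) (tangentBasis 𝕜 hφ hx)) (innerMatrix G T E x) p q hpq c
      = (T.Ψ x).symm.toLinearMap.compAlternatingMap
        ((metricDual (bilinAt (x : M) G.hat) (mixedBasis G.conn T E hφ hx) (blockEquiv hpq)
          (formAt (x : M) (gradeForm G.conn κ w))).compLinearMap (T.S x)) := by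
  rw [localForm_eq_expansion_iff G E T hφ hx] at hw
  rw [dx_eq G E T hφ hx, mixed_eq G E T hφ hx, ← hodgeFormula_comp,
    hodgeFormula_eq _ (gramMatrix_det_ne_zero _ _ (G.base_nondegenerate x))
      (innerMatrix_det_ne_zero G T E x) hpq hκ
      (fun j => isScaling_scaling G.conn T E hφ hx ((j : 𝕜) + 1)), ← hw,
    gradeOp_compAlternatingMap, dualize_compAlternatingMap, ← formAt_gradeForm, metricDual,
    gramMatrix_hat, det_blockMatrix, norm_mul, Real.sqrt_mul (norm_nonneg _), RCLike.ofReal_mul,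
    mul_comm ((Real.sqrt ‖(innerMatrix G T E x).det‖ : ℝ) : 𝕜)]
  rfl

theorem metricDual_metricDual {p q : ℕ} (hpq : p + q = m + n) (hqp : q + p = m + n)
    {κ κ' : Fin (m + 1) → 𝕜}
    (hκ : ∀ r, r ≤ m → ∑ j, κ j * ((j : 𝕜) + 1) ^ r = hodgeWeight 𝕜 m n p r)
    (hκ' : ∀ r, r ≤ m → ∑ j, κ' j * ((j : 𝕜) + 1) ^ r = hodgeWeight 𝕜 m n q r)
    {w : P.Form p} {η : P.Form q} (hη : formAt (x : M) η
      = metricDual (bilinAt (x : M) G.hat) (mixedBasis G.conn T E hφ hx) (blockEquiv hpq)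
        (formAt (x : M) (gradeForm G.conn κ w))) :
    metricDual (bilinAt (x : M) G.hat) (mixedBasis G.conn T E hφ hx) (blockEquiv hqp)
        (formAt (x : M) (gradeForm G.conn κ' η))
      = ((-1 : 𝕜) ^ (q * p)
          * ((‖(gramMatrix (bilinAt (x : M) G.base) (tangentBasis 𝕜 hφ hx)).det
            * (innerMatrix G T E x).det‖ : ℝ) : 𝕜)
          / ((gramMatrix (bilinAt (x : M) G.base) (tangentBasis 𝕜 hφ hx)).det
            * (innerMatrix G T E x).det)) • formAt (x : M) w := by
  rw [formAt_gradeForm, hη, formAt_gradeForm, metricDual, metricDual, gramMatrix_hat,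
    dualize_gradeOp_dualize_gradeOp _ (gramMatrix_det_ne_zero _ _ (G.base_nondegenerate x))
      (innerMatrix_det_ne_zero G T E x) (gramMatrix_isSymm _ _ (base_symm_at G x))
      (innerMatrix_isSymm G T E x) _ hpq hqp hκ hκ'
      (fun j => isScaling_scaling G.conn T E hφ hx ((j : 𝕜) + 1)), det_blockMatrix,
    ← RCLike.ofReal_mul, Real.mul_self_sqrt (norm_nonneg _), div_eq_mul_inv, mul_assoc]

end Local

section Global

variable (𝒯 : P.OrientedAtlas 𝔤 ι) (𝒪 : OrientedCharts m M)

/-- The duality operator of the metric at a point. -/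
def starAt {p q : ℕ} (hpq : p + q = m + n) (x : M) :
    (Fiber m 𝕜 x A [⋀^Fin p]→ₗ[𝕜] Fiber m 𝕜 x P.kernel) →ₗ[𝕜]
      (Fiber m 𝕜 x A [⋀^Fin q]→ₗ[𝕜] Fiber m 𝕜 x P.kernel) :=
  metricDual (bilinAt x G.hat) (mixedBasis G.conn (𝒯.triv (𝒯.cover x).choose) E
    (𝒪.smooth (𝒪.cover x).choose_spec.1) (x := ⟨x, (𝒯.cover x).choose_spec⟩)
    (𝒪.cover x).choose_spec.2) (blockEquiv hpq)

theorem metricDual_mixedBasis_congr {p q : ℕ} (hpq : p + q = m + n) (T T' : P.LocalTriv 𝔤)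
    {φ φ' : OpenPartialHomeomorph M (EuclideanSpace ℝ (Fin m))}
    (hφ : φ ∈ IsManifold.maximalAtlas (𝓡 m) ∞ M) (hφ' : φ' ∈ IsManifold.maximalAtlas (𝓡 m) ∞ M) {x : M} (hT : x ∈ T.U) (hT' : x ∈ T'.U)
    (hx : x ∈ φ.source) (hx' : x ∈ φ'.source) {t s : ℝ} (ht : 0 < t) (hs : 0 < s)
    (h : LinearMap.det (T'.transition T x hT' hT).toLinearMap = (s : 𝕜))
    (h' : (fderiv ℝ (φ' ∘ φ.symm) (φ x)).det = t) :
    metricDual (W := Fiber m 𝕜 x P.kernel) (bilinAt x G.hat)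
        (mixedBasis G.conn T E hφ (x := ⟨x, hT⟩) hx) (blockEquiv hpq)
      = metricDual (bilinAt x G.hat) (mixedBasis G.conn T' E hφ' (x := ⟨x, hT'⟩) hx')
        (blockEquiv hpq) := by
  have hd := det_mixedBasis_change G.conn T T' E hφ hφ' hT hT' hx hx'
  rw [h, h', ← RCLike.ofReal_mul] at hd
  exact metricDual_congr (gramMatrix_hat_det_ne_zero G T E hφ (x := ⟨x, hT⟩) hx)
    (mul_pos ht hs) hd _

/-- The trivialization and chart chosen at each point are immaterial: by the two orientations the
change of mixed basis has positive determinant. -/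
theorem starAt_eq {p q : ℕ} (hpq : p + q = m + n) (i : ι) (hφ : φ ∈ 𝒪.charts)
    (x : (𝒯.triv i).U) (hx : (x : M) ∈ φ.source) : starAt G E 𝒯 𝒪 hpq (x : M)
      = metricDual (bilinAt (x : M) G.hat) (mixedBasis G.conn (𝒯.triv i) E (𝒪.smooth hφ) hx)
        (blockEquiv hpq) := by
  obtain ⟨x, hT⟩ := x
  obtain ⟨r, hr, h⟩ := 𝒯.det_pos i (𝒯.cover x).choose x hT (𝒯.cover x).choose_spec
  have hj := 𝒪.jacobian_pos _ (𝒪.cover x).choose_spec.1 φ hφ x ⟨(𝒪.cover x).choose_spec.2, hx⟩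
  exact metricDual_mixedBasis_congr G E hpq _ _ _ _ _ hT _ hx hj hr h rfl

/-- Near each point the operator can be computed in a single smooth mixed frame, whatever choices
`starAt` makes at the individual points. -/
theorem exists_star {p q : ℕ} (hpq : p + q = m + n) (w : P.Form p) :
    ∃ η : P.Form q, ∀ x, formAt x η = starAt G E 𝒯 𝒪 hpq x (formAt x w) := by
  have := finite_kernel G.conn
  have := projective_kernel G.conn
  refine exists_form _ fun v x => ?_
  obtain ⟨i, hT⟩ := 𝒯.cover x
  obtain ⟨φ, hφ, hx⟩ := 𝒪.cover x
  obtain ⟨e, he⟩ := exists_mixed_frame G.conn (𝒯.triv i) E (𝒪.smooth hφ) hT hx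
  have hdet := gramMatrix_hat_det_ne_zero G (𝒯.triv i) E (𝒪.smooth hφ) (x := ⟨x, hT⟩) hx
  have hdet' : (of fun j k => G.hat (e j) (e k) x).det ≠ 0 := by
    convert hdet using 2
    ext j k
    rw [← apply_basis, he.self_of_nhds hT hx, he.self_of_nhds hT hx]
    rfl
  obtain ⟨a, ha⟩ := exists_metricDual_section G.hat e hdet' (blockEquiv hpq) w v
  refine ⟨a, ?_⟩
  filter_upwards [he, ha, (𝒯.triv i).U.isOpen.mem_nhds hT, φ.open_source.mem_nhds hx]
    with y h1 h2 hy hy'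
  rw [starAt_eq G E 𝒯 𝒪 hpq i hφ ⟨y, hy⟩ hy']
  exact h2 _ (h1 hy hy')

theorem exists_star_linear {p q : ℕ} (hpq : p + q = m + n) (κ : Fin (m + 1) → 𝕜) :
    ∃ st : P.Form p →ₗ[SmoothFun m M 𝕜] P.Form q, ∀ w x,
      formAt x (st w) = starAt G E 𝒯 𝒪 hpq x (formAt x (gradeForm G.conn κ w)) := by
  have := finite_kernel G.conn
  have := projective_kernel G.conn
  choose F hF using fun w : P.Form p => exists_star G E 𝒯 𝒪 hpq (gradeForm G.conn κ w)
  refine ⟨{ toFun := F, map_add' := fun w w' => form_ext fun x => ?_,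
            map_smul' := fun f w => form_ext fun x => ?_ }, hF⟩
  · rw [formAt_add]
    simp only [hF, formAt_gradeForm, formAt_add, map_add]
  · rw [formAt_smul, RingHom.id_apply]
    simp only [hF, formAt_gradeForm, formAt_smul, map_smul]

end Global

end LieAlgd

end

/-! ### The Hodge operator and its square -/

open LieAlgd in
theorem mainTheorem7 {m n : ℕ} {M 𝕜 A 𝔤 ι : Type*} [RCLike 𝕜] [TopologicalSpace M] [T2Space M]
    [SecondCountableTopology M] [ChartedSpace (EuclideanSpace ℝ (Fin m)) M]
    [IsManifold (𝓡 m) ∞ M] [LieRing A] [Module (SmoothFun m M 𝕜) A] [LieRing 𝔤] [LieAlgebra 𝕜 𝔤]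
    (E : Module.Basis (Fin n) 𝕜 𝔤) (P : LieAlgebroid m M 𝕜 A) (hP : P.IsTransitive)
    (𝒯 : P.OrientedAtlas 𝔤 ι) (𝒪 : OrientedCharts m M) (G : P.Metric) :
    ∃ star : ∀ p q : ℕ, p + q = m + n → (P.Form p →ₗ[SmoothFun m M 𝕜] P.Form q),
      -- the Hodge dual of each form exists, is unique, and depends linearly on the form
      (∀ (p q : ℕ) (hpq : p + q = m + n) (w : P.Form p) (η : P.Form q),
        IsHodgeDual G E 𝒯 𝒪 hpq w η ↔ η = star p q hpq w) ∧
      -- the double dual, for metrics with positive determinants (for instance Riemannian ones)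
      ((∀ (i : ι), ∀ φ ∈ 𝒪.charts, ∀ (x : (𝒯.triv i).U), (x : M) ∈ φ.source →
          ∀ g : Matrix (Fin m) (Fin m) 𝕜, IsBaseMatrix G φ x g →
            ∃ t : ℝ, 0 < t ∧ g.det * (innerMatrix G (𝒯.triv i) E x).det = (t : 𝕜)) →
        ∀ (p q : ℕ) (hpq : p + q = m + n) (hqp : q + p = m + n) (w : P.Form p),
          star q p hqp (star p q hpq w) = ((-1 : ℤ) ^ (q * p)) • w) ∧
      -- the double dual, for arbitrary nondegenerate metrics
      (∀ (p q : ℕ) (hpq : p + q = m + n) (hqp : q + p = m + n) (w : P.Form p),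
        ∀ (i : ι), ∀ φ ∈ 𝒪.charts, ∀ (x : (𝒯.triv i).U), (x : M) ∈ φ.source →
          ∀ g : Matrix (Fin m) (Fin m) 𝕜, IsBaseMatrix G φ x g →
            formAt (x : M) (star q p hqp (star p q hpq w))
              = ((-1 : 𝕜) ^ (q * p)
                  * ((‖g.det * (innerMatrix G (𝒯.triv i) E x).det‖ : ℝ) : 𝕜)
                  / (g.det * (innerMatrix G (𝒯.triv i) E x).det)) • formAt (x : M) w) := by
  have := finite_kernel G.conn
  have := projective_kernel G.conn
  -- The weights are constants that depend only on the degree, so the rescaling of bidegrees is the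
  -- same operator at every point.
  choose κ hκ using fun p => AlternatingForm.exists_weights 𝕜 m
    (AlternatingForm.hodgeWeight 𝕜 m n p)
  choose star hstar using fun (p q : ℕ) (hpq : p + q = m + n) =>
    exists_star_linear G E 𝒯 𝒪 hpq (κ p)
  have key : ∀ (p q : ℕ) (hpq : p + q = m + n) (hqp : q + p = m + n) (w : P.Form p),
      ∀ (i : ι), ∀ φ ∈ 𝒪.charts, ∀ (x : (𝒯.triv i).U), (x : M) ∈ φ.source →
        ∀ g : Matrix (Fin m) (Fin m) 𝕜, IsBaseMatrix G φ x g →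
          formAt (x : M) (star q p hqp (star p q hpq w))
            = ((-1 : 𝕜) ^ (q * p)
                * ((‖g.det * (innerMatrix G (𝒯.triv i) E x).det‖ : ℝ) : 𝕜)
                / (g.det * (innerMatrix G (𝒯.triv i) E x).det)) • formAt (x : M) w := by
    intro p q hpq hqp w i φ hφ x hx g hg
    obtain rfl := (isBaseMatrix_iff G (𝒪.smooth hφ) hx g).1 hg
    rw [hstar, starAt_eq G E 𝒯 𝒪 hqp i hφ x hx]
    refine metricDual_metricDual G E _ (𝒪.smooth hφ) hx hpq hqp (hκ p) (hκ q) ?_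
    rw [hstar, starAt_eq G E 𝒯 𝒪 hpq i hφ x hx]
  refine ⟨star, fun p q hpq w η => ⟨fun h => form_ext fun x => ?_, ?_⟩,
    fun h p q hpq hqp w => form_ext fun x => ?_, key⟩
  · obtain ⟨i, hT⟩ := 𝒯.cover x
    obtain ⟨φ, hφ, hx⟩ := 𝒪.cover x
    -- Uniqueness: every form has components in the mixed basis at each point, so the defining
    -- property is never vacuous and determines `η` there.
    obtain ⟨c, hc⟩ := AlternatingForm.exists_expansion
      (mixedBasis G.conn (𝒯.triv i) E (𝒪.smooth hφ) (x := ⟨x, hT⟩) hx)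
      (((𝒯.triv i).Ψ ⟨x, hT⟩).symm.toLinearMap.compAlternatingMap (formAt x w))
    have hc' := (localForm_eq_expansion_iff G E (𝒯.triv i) (𝒪.smooth hφ) (x := ⟨x, hT⟩) hx w c).2 hc
    have h1 := h i φ hφ ⟨x, hT⟩ hx _ ((isBaseMatrix_iff G (𝒪.smooth hφ) hx _).2 rfl) c hc'
    rw [hodgeFormula_eq_metricDual G E _ (𝒪.smooth hφ) (x := ⟨x, hT⟩) hx hpq (hκ p) hc',
      ← starAt_eq G E 𝒯 𝒪 hpq i hφ ⟨x, hT⟩ hx, ← hstar] at h1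
    have h2 : ((𝒯.triv i).Ψ ⟨x, hT⟩).symm.toLinearMap.compAlternatingMap (formAt x η)
        = ((𝒯.triv i).Ψ ⟨x, hT⟩).symm.toLinearMap.compAlternatingMap
          (formAt x (star p q hpq w)) :=
      AlternatingMap.compLinearMap_injective _ (surjective_S (𝒯.triv i) G.conn ⟨x, hT⟩) h1
    ext v
    exact ((𝒯.triv i).Ψ ⟨x, hT⟩).symm.injective (DFunLike.congr_fun h2 v)
  · rintro rfl i φ hφ x hx g hg c hc
    obtain rfl := (isBaseMatrix_iff G (𝒪.smooth hφ) hx g).1 hg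
    rw [hodgeFormula_eq_metricDual G E _ (𝒪.smooth hφ) hx hpq (hκ p) hc,
      ← starAt_eq G E 𝒯 𝒪 hpq i hφ x hx, ← hstar]
    rfl
  · obtain ⟨i, hT⟩ := 𝒯.cover x
    obtain ⟨φ, hφ, hx⟩ := 𝒪.cover x
    have hg := (isBaseMatrix_iff G (𝒪.smooth hφ) hx _).2 rfl
    obtain ⟨t, ht, ht'⟩ := h i φ hφ ⟨x, hT⟩ hx _ hg
    -- The integer sign is read as a constant function, so that it can be evaluated at the point.
    have hz : ((-1 : ℤ) ^ (q * p)) • w = ((-1 : SmoothFun m M 𝕜) ^ (q * p)) • w := by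
      rw [← Int.cast_smul_eq_zsmul (SmoothFun m M 𝕜), Int.cast_pow, Int.cast_neg, Int.cast_one]
    rw [key p q hpq hqp w i φ hφ ⟨x, hT⟩ hx _ hg, ht', hz, formAt_smul, RCLike.norm_ofReal,
      abs_of_pos ht, mul_div_assoc, div_self (RCLike.ofReal_ne_zero.2 ht.ne'), mul_one]
    congr 1
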